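/- **Theorem (characterization of the Wigner–Yanase–Dyson $\alpha$-metrics).** Let $\mathcal M_n$ be the manifold of positive definite complex $n\times n$ matrices of trace $1$; its tangent space at every point is the real space of traceless selfadjoint $n\times n$ matrices. A *Fisher-adjusted symmetric monotone metric* is a family $K$ of smooth Riemannian metrics $K_D(A,B)$ (real-valued on traceless selfadjoint $A,B$) on all $\mathcal M_n$, $n\ge 1$, such that $K_{T(D)}(T(A),T(A))\le K_D(A,A)$ for every completely positive trace preserving linear $T:M_n(\mathbb C)\to M_m(\mathbb C)$, every $D\in\mathcal M_n$ with $T(D)\in\mathcal M_m$ and every tangent vector $A$, and such that $K_D(A,A)=\sum_i a_i^2/p_i$ for diagonal $D=\mathrm{Diag}(p_1,\dots,p_n)$ and $A=\mathrm{Diag}(a_1,\dots,a_n)$. For $\alpha\in\mathbb R$, $\alpha\neq\pm1$, put $$S_\alpha(D_1,D_2)=\frac{4}{1-\alpha^2}\,\mathrm{Tr}\Big(\big(I-D_2^{\frac{1+\alpha}{2}}D_1^{-\frac{1+\alpha}{2}}\big)D_1\Big),$$ and, as the limits on $\mathcal M_n$, $S_{-1}(D_1,D_2)=\mathrm{Tr}\,D_1(\log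 D_1-\log D_2)$ and $S_{1}(D_1,D_2)=\mathrm{Tr}\,D_2(\log D_2-\log D_1)$. The *$\alpha$-metric* (Wigner–Yanase–Dyson metric) is $$K^\alpha_D(A,B)=-\frac{\partial^2}{\partial t\,\partial u}S_\alpha(D+tA,D+uB)\Big|_{t=u=0}.$$ For smooth $g,g^*:(0,\infty)\to\mathbb R$ say that $(g,g^*)$ *generates* $K$ if for all $n$, all $\rho\in\mathcal M_n$ and all selfadjoint $X,Y\in M_n(\mathbb C)$, with $A=\mathrm i[\rho,X]$ and $B=\mathrm i[\rho,Y]$, $$K_\rho(A,B)=\frac{\partial^2}{\partial t\,\partial s}\,\mathrm{Tr}\,g(\rho+tA)\,g^*(\rho+sB)\Big|_{t=s=0}.$$ Then: 1. For every $\alpha\in[-3,3]$, $K^\alpha$ is a Fisher-adjusted symmetric monotone metric. 2. A Fisher-adjusted symmetric monotone metric $K$ is generated by some pair of smooth functions $(g,g^*)$ if and only if $K=K^\alpha$ for some $\alpha\in[-3,3]$. 3. For a Fisher-adjusted symmetric monotone metric $K$ and smooth $g,g^*$, the pair $(g,g^*)$ generates $K$ if and only if there are $p\in[-1,2]$ with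 $K=K^{2p-1}$ and real constants $a,b,k,l$ such that on $(0,1)$ - $g(x)=ax^p+k$, $g^*(x)=bx^{1-p}+l$ and $ab=\frac1{p(1-p)}$, if $p\ne0,1$; - $g(x)=a\log x+k$, $g^*(x)=bx+l$ and $ab=1$, if $p=0$; - $g(x)=ax+k$, $g^*(x)=b\log x+l$ and $ab=1$, if $p=1$. -/

import Mathlib

open scoped ContDiff ComplexOrder

noncomputable section

namespace WYD

/-- Complex `n × n` matrices. -/
abbrev Mat (n : ℕ) : Type := Matrix (Fin n) (Fin n) ℂ

/-- The manifold of positive definite `n × n` density matrices. -/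
def States (n : ℕ) : Set (Mat n) := {D | D.PosDef ∧ D.trace = 1}

/-- The tangent space of `States n` at any of its points: traceless selfadjoint matrices. -/
def Tangent (n : ℕ) : Set (Mat n) := {A | A.IsHermitian ∧ A.trace = 0}

/-- Stochastic mappings: trace preserving completely positive linear maps of matrices, complete
positivity being `∑ i j, a i ^* T (b i ^* b j) a j ≥ 0` for all finite families `a`, `b`. -/
structure IsStochastic {n m : ℕ} (T : Mat n →ₗ[ℂ] Mat m) : Prop where
  trace_map : ∀ A : Mat n, (T A).trace = A.trace
  completelyPositive : ∀ (k : ℕ) (a : Fin k → Mat m) (b : Fin k → Mat n),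
    (∑ i, ∑ j, (a i).conjTranspose * T ((b i).conjTranspose * b j) * a j).PosSemidef

/-- A family of real bilinear forms on the tangent spaces of all the state spaces: `K n D A B` is
the value at the state `D` on the tangent vectors `A`, `B`. Only the values at `D ∈ States n` and
`A, B ∈ Tangent n` are meaningful. -/
abbrev MetricFamily : Type := (n : ℕ) → Mat n → Mat n → Mat n → ℝ

/-- Two families agree at all states, on all tangent vectors. -/
def SameMetric (K L : MetricFamily) : Prop :=
  ∀ (n : ℕ), ∀ D ∈ States n, ∀ A ∈ Tangent n, ∀ B ∈ Tangent n, K n D A B = L n D A B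

/-- Fisher-adjusted symmetric monotone metrics: a smooth Riemannian metric on every state space
(a real-valued, symmetric, positive definite form on the selfadjoint traceless matrices), such
that stochastic mappings are contractions and such that the Fisher metric is recovered on
diagonal states and diagonal tangent vectors. -/
structure IsSymmetricMonotoneMetric (K : MetricFamily) : Prop where
  add_left : ∀ (n : ℕ), ∀ D ∈ States n, ∀ A ∈ Tangent n, ∀ A' ∈ Tangent n, ∀ B ∈ Tangent n,
    K n D (A + A') B = K n D A B + K n D A' B
  smul_left : ∀ (n : ℕ), ∀ D ∈ States n, ∀ (r : ℝ), ∀ A ∈ Tangent n, ∀ B ∈ Tangent n,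
    K n D (r • A) B = r * K n D A B
  symm : ∀ (n : ℕ), ∀ D ∈ States n, ∀ A ∈ Tangent n, ∀ B ∈ Tangent n,
    K n D A B = K n D B A
  pos : ∀ (n : ℕ), ∀ D ∈ States n, ∀ A ∈ Tangent n, A ≠ 0 → 0 < K n D A A
  /-- Smoothness in the state, as a function of the matrix entries. -/
  smooth : ∀ (n : ℕ), ∀ A ∈ Tangent n, ∀ B ∈ Tangent n,
    ContDiffOn ℝ ∞ (fun M : Fin n → Fin n → ℂ => K n (Matrix.of M) A B)
      {M | Matrix.of M ∈ States n}
  monotone : ∀ (n m : ℕ) (T : Mat n →ₗ[ℂ] Mat m), IsStochastic T →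
    ∀ D ∈ States n, T D ∈ States m → ∀ A ∈ Tangent n, K m (T D) (T A) (T A) ≤ K n D A A
  fisher : ∀ (n : ℕ) (p a : Fin n → ℝ), (∀ i, 0 < p i) → ∑ i, p i = 1 → ∑ i, a i = 0 →
    K n (Matrix.diagonal fun i => (p i : ℂ)) (Matrix.diagonal fun i => (a i : ℂ))
      (Matrix.diagonal fun i => (a i : ℂ)) = ∑ i, a i ^ 2 / p i

/-- The mixed derivative `∂²F/∂t∂s` at `t = s = 0`. -/
def mixedDeriv (F : ℝ → ℝ → ℝ) : ℝ := deriv (fun t => deriv (fun s => F t s) 0) 0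

/-- The `α`-entropy `4 / (1 - α²) * Tr (I - D₂^((1+α)/2) D₁^(-(1+α)/2)) D₁`; for `α = ±1` its limit
on states, which is the relative entropy (with the arguments exchanged when `α = 1`).
The traces are real, and powers and logarithms are those of the functional calculus. -/
def alphaEntropy (α : ℝ) {n : ℕ} (D₁ D₂ : Mat n) : ℝ :=
  if α = 1 then (D₂ * (cfc Real.log D₂ - cfc Real.log D₁)).trace.re
  else if α = -1 then (D₁ * (cfc Real.log D₁ - cfc Real.log D₂)).trace.re
  else 4 / (1 - α ^ 2) *
    ((1 - cfc (fun x : ℝ => x ^ ((1 + α) / 2)) D₂ *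
      cfc (fun x : ℝ => x ^ (-((1 + α) / 2))) D₁) * D₁).trace.re

/-- The `α`-metric (Wigner-Yanase-Dyson metric): minus the mixed second derivative of the
`α`-entropy on the diagonal. -/
def alphaMetric (α : ℝ) : MetricFamily := fun _ D A B =>
  -mixedDeriv fun t u => alphaEntropy α (D + t • A) (D + u • B)

/-- The tangent vector `i[ρ, X]`. -/
def commTangent {n : ℕ} (ρ X : Mat n) : Mat n := Complex.I • (ρ * X - X * ρ)

/-- On the vectors `A = i[ρ, X]`, `B = i[ρ, Y]` with `X`, `Y` selfadjoint, the metric is the mixed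
derivative of `Tr g(ρ + tA) g*(ρ + sB)` (a real trace, as both factors are selfadjoint). -/
def IsGeneratedBy (K : MetricFamily) (g gs : ℝ → ℝ) : Prop :=
  ∀ (n : ℕ), ∀ ρ ∈ States n, ∀ X Y : Mat n, X.IsHermitian → Y.IsHermitian →
    K n ρ (commTangent ρ X) (commTangent ρ Y) =
      mixedDeriv fun t s =>
        (cfc g (ρ + t • commTangent ρ X) * cfc gs (ρ + s • commTangent ρ Y)).trace.re

/-- Up to additive constants, `g = a x^p` and `g* = b x^(1-p)` with `a b = 1 / (p (1 - p))` on
`(0, 1)`; in the limiting cases `p = 0` and `p = 1` the two functions are multiples of `x` and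
`log x`, with `a b = 1`. -/
def IsPowerPair (p : ℝ) (g gs : ℝ → ℝ) : Prop :=
  ∃ a b k l : ℝ,
    (p ≠ 0 ∧ p ≠ 1 ∧ a * b = 1 / (p * (1 - p)) ∧
      ∀ x ∈ Set.Ioo (0 : ℝ) 1, g x = a * x ^ p + k ∧ gs x = b * x ^ (1 - p) + l) ∨
    (p = 0 ∧ a * b = 1 ∧
      ∀ x ∈ Set.Ioo (0 : ℝ) 1, g x = a * Real.log x + k ∧ gs x = b * x + l) ∨
    (p = 1 ∧ a * b = 1 ∧
      ∀ x ∈ Set.Ioo (0 : ℝ) 1, g x = a * x + k ∧ gs x = b * Real.log x + l)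

end WYD

end

/-! Put p = (1+α)/2, so that α ∈ [-3,3] becomes p ∈ [-1,2], and let `pw p` be the primitive of
x^(p-1), which is the logarithm when p = 0. Up to terms in one argument only, the α-entropy is −Tr
pw_{1-p}(D₁) pw_p(D₂). By the Daleckii–Krein formula, `hasDerivAt_cfc_line`, the α-metric is
therefore a weighted sum over matrix entries in an eigenbasis of the state, with weight `wydKernel
p`, the product of the divided differences of `pw p` and `pw (1 - p)` (`alphaMetric_eq_sum`).

Monotonicity: the quadratic form of the kernel 1/(x+ty), t ≥ 0, is the maximum of a concave
functional, and the Kadison–Schwarz inequality for the trace adjoint of a stochastic map makes this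
maximum contract (`isMonotoneKernel_resolvent`). Integral representations of real powers exhibit
`wydKernel p` as a positive superposition of symmetrized kernels of this kind for 0 < p < 1 and for
1 < p < 2; p = 1 is a limit, p = 2 is explicit, and p ↦ 1−p gives the rest. Smoothness in the state
holds because the matrix logarithm is a local inverse of the exponential.

Converse: in a commutator direction the derivative of the functional calculus of g is the commutator
with g(ρ), so a generated metric is governed by the numerator (g(x)−g(y))(g*(x)−g*(y)). Monotonicity
under ρ ↦ ρ⊗1/k and under the partial trace that inverts it makes this numerator homogeneous of
degree 1 (`genNum_mul`). The Fisher condition at a double eigenvalue gives g'·g*' = 1/x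
(`deriv_mul_deriv_generated`). Eliminating g* from the mixed derivative of the homogeneity relation,
the function G = √x·g' has G(x)/G(y) + G(y)/G(x) homogeneous of degree 0, which forces G to be a
power. Hence g and g* are multiples of `pw p` and `pw (1 - p)` plus constants. A channel preparing
two pure states bounds the numerator from above, and letting x → 0 yields p ≤ 2 and, by symmetry, p
≥ −1.

The metric itself is then recovered because a Fisher-adjusted monotone metric is determined by its
values on commutators at diagonal states with simple spectrum (`sameMetric_of_commTangent`):
pinching separates diagonal from off-diagonal directions, the Fisher condition fixes the former, and
continuity, unitary invariance and polarization do the rest. -/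

noncomputable section
namespace WYD

open Filter Topology

/-! ### Differentiating the functional calculus of Hermitian matrices -/

/-- The spectrum moves by at most the norm of a perturbation of a selfadjoint element. -/
theorem exists_mem_spectrum_abs_sub_le {A : Type*} [CStarAlgebra A] {a b : A}
    (ha : IsSelfAdjoint a) {x : ℝ} (hx : x ∈ spectrum ℝ (a + b)) :
    ∃ y ∈ spectrum ℝ a, |x - y| ≤ ‖b‖ := by
  by_contra! hcon
  have hne : ∀ y ∈ spectrum ℝ a, x - y ≠ 0 := fun y hy h0 => by
    have := hcon y hy
    rw [h0, abs_zero] at this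
    linarith [norm_nonneg b]
  have hcont : ContinuousOn (fun y : ℝ => (x - y)⁻¹) (spectrum ℝ a) :=
    ContinuousOn.inv₀ (by fun_prop) hne
  have hlin : algebraMap ℝ A x - a = cfc (fun y : ℝ => x - y) a := by
    rw [cfc_sub (fun _ => x) (fun y => y) a continuousOn_const continuousOn_id,
      cfc_const x a ha, cfc_id' ℝ a ha]
  -- If x is farther than ‖b‖ from the spectrum of a, its resolvent r has norm below 1/‖b‖, so x −
  -- (a+b) = (x−a)(1 − rb) is invertible by the Neumann series.
  set r := cfc (fun y : ℝ => (x - y)⁻¹) a with hr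
  have h1 : (algebraMap ℝ A x - a) * r = 1 := by
    rw [hlin, hr, ← cfc_mul _ _ a (by fun_prop) (by fun_prop), ← cfc_one ℝ a ha]
    exact cfc_congr fun y hy => mul_inv_cancel₀ (hne y hy)
  have h2 : r * (algebraMap ℝ A x - a) = 1 := by
    rw [hlin, hr, ← cfc_mul _ _ a (by fun_prop) (by fun_prop), ← cfc_one ℝ a ha]
    exact cfc_congr fun y hy => inv_mul_cancel₀ (hne y hy)
  have hrb : ‖r * b‖ < 1 := by
    rcases (norm_nonneg b).eq_or_lt with hb | hb
    · rw [norm_eq_zero.mp hb.symm, mul_zero, norm_zero]; exact one_pos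
    · have hlt : ‖r‖ < ‖b‖⁻¹ := by
        refine norm_cfc_lt (inv_pos.mpr hb) fun y hy => ?_
        rw [norm_inv, Real.norm_eq_abs]
        exact inv_strictAnti₀ hb (hcon y hy)
      calc ‖r * b‖ ≤ ‖r‖ * ‖b‖ := norm_mul_le _ _
        _ < ‖b‖⁻¹ * ‖b‖ := by gcongr
        _ = 1 := inv_mul_cancel₀ hb.ne'
  refine hx ?_
  have hfac : algebraMap ℝ A x - (a + b) = (algebraMap ℝ A x - a) * (1 - r * b) := by
    rw [mul_sub, ← mul_assoc, h1, mul_one, one_mul, sub_sub]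
  rw [spectrum.mem_resolventSet_iff, hfac]
  exact (IsUnit.mul ⟨⟨_, _, h1, h2⟩, rfl⟩ (isUnit_one_sub_of_norm_lt_one hrb))

/-- If `h` vanishes to second order on the finite spectrum of `a`, then the functional calculus
of `h` vanishes to second order at `a`. -/
theorem cfc_add_smul_isLittleO {A : Type*} [CStarAlgebra A] {a b : A} (ha : IsSelfAdjoint a)
    (hfin : (spectrum ℝ a).Finite) {h : ℝ → ℝ}
    (h0 : ∀ x ∈ spectrum ℝ a, h x = 0 ∧ HasDerivAt h 0 x) :
    (fun t : ℝ => cfc h (a + t • b)) =o[𝓝 0] (fun t => t) := by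
  rw [Asymptotics.isLittleO_iff]
  intro ε hε
  have key : ∀ y ∈ spectrum ℝ a, ∀ᶠ t : ℝ in 𝓝 0, ∀ x : ℝ, |x - y| ≤ ‖t • b‖ →
      ‖h x‖ ≤ ε * ‖t‖ := by
    intro y hy
    have hd := (hasDerivAt_iff_isLittleO.mp (h0 y hy).2)
    rw [Asymptotics.isLittleO_iff] at hd
    have hε' : 0 < ε / (‖b‖ + 1) := by positivity
    have h1 := hd hε'
    rw [Metric.eventually_nhds_iff] at h1
    obtain ⟨δ, hδ, h1⟩ := h1
    have h2 : ∀ᶠ t : ℝ in 𝓝 0, ‖t • b‖ < δ := by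
      have : Tendsto (fun t : ℝ => ‖t • b‖) (𝓝 0) (𝓝 0) := by
        have hc : Continuous fun t : ℝ => ‖t • b‖ := by fun_prop
        simpa using hc.tendsto 0
      exact this.eventually_lt_const hδ
    filter_upwards [h2] with t ht x hx
    have h3 := h1 (y := x) (by rw [Real.dist_eq]; linarith)
    simp only [(h0 y hy).1, sub_zero, smul_zero] at h3
    calc ‖h x‖ ≤ ε / (‖b‖ + 1) * ‖x - y‖ := h3
      _ ≤ ε / (‖b‖ + 1) * (‖t‖ * ‖b‖) := by
        rw [Real.norm_eq_abs (x - y)]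
        gcongr
        rwa [norm_smul] at hx
      _ = ε * ‖t‖ * (‖b‖ / (‖b‖ + 1)) := by ring
      _ ≤ ε * ‖t‖ * 1 := by
        gcongr
        exact (div_le_one (by positivity)).mpr (by linarith)
      _ = ε * ‖t‖ := mul_one _
  filter_upwards [(Filter.eventually_all_finite hfin).mpr key] with t ht
  refine norm_cfc_le (by positivity) fun x hx => ?_
  obtain ⟨y, hy, hxy⟩ := exists_mem_spectrum_abs_sub_le ha hx
  exact ht y hy x hxy

open Polynomial in
/-- Hermite interpolation: prescribed values and derivatives on a finite set. -/
theorem exists_polynomial_eval_derivative (s : Finset ℝ) (u v : ℝ → ℝ) :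
    ∃ q : ℝ[X], ∀ x ∈ s, q.eval x = u x ∧ q.derivative.eval x = v x := by
  induction s using Finset.induction_on with
  | empty => exact ⟨0, by simp⟩
  | insert c s hc ih =>
    obtain ⟨q, hq⟩ := ih
    -- The square makes w and w' both vanish at the old nodes, so a multiple of w changes nothing
    -- there; the linear factor c0 + c1(X − c) then fits the two data at c.
    set w : ℝ[X] := (∏ y ∈ s, (X - C y)) ^ 2 with hw
    have hwc : w.eval c ≠ 0 := by
      rw [hw, eval_pow, eval_prod]
      refine pow_ne_zero _ (Finset.prod_ne_zero_iff.mpr fun y hy => ?_)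
      simp only [eval_sub, eval_X, eval_C]
      exact sub_ne_zero.mpr fun h => hc (h ▸ hy)
    have hws : ∀ x ∈ s, w.eval x = 0 ∧ w.derivative.eval x = 0 := by
      intro x hx
      have h0 : (∏ y ∈ s, (X - C y)).eval x = 0 := by
        rw [eval_prod]
        exact Finset.prod_eq_zero hx (by simp)
      simp [hw, derivative_pow, h0]
    set c0 : ℝ := (u c - q.eval c) / w.eval c
    set c1 : ℝ := (v c - q.derivative.eval c - w.derivative.eval c * c0) / w.eval c
    refine ⟨q + w * (C c0 + C c1 * (X - C c)), fun x hx => ?_⟩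
    rcases Finset.mem_insert.mp hx with rfl | hx
    · constructor
      · simp [c0, field]
      · simp [c1, field]
    · simp [hq x hx, hws x hx]

/-- The real diagonal matrix, as a complex matrix. -/
abbrev rdiag {n : ℕ} (l : Fin n → ℝ) : Mat n := Matrix.diagonal fun i => (l i : ℂ)

theorem rdiag_isHermitian {n : ℕ} (l : Fin n → ℝ) : (rdiag l).IsHermitian := by
  rw [Matrix.IsHermitian, Matrix.diagonal_conjTranspose]
  congr 1; ext i; simp

theorem conj_isHermitian {n : ℕ} {A : Mat n} (U : Mat n) (hA : A.IsHermitian) :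
    (U * A * star U).IsHermitian :=
  Matrix.isHermitian_mul_mul_conjTranspose U hA

theorem conj_isHermitian' {n : ℕ} {A : Mat n} (U : Mat n) (hA : A.IsHermitian) :
    (star U * A * U).IsHermitian :=
  Matrix.isHermitian_conjTranspose_mul_mul U hA

theorem exists_unitary_rdiag {n : ℕ} {D : Mat n} (hD : D.IsHermitian) :
    ∃ (U : Mat n) (l : Fin n → ℝ), star U * U = 1 ∧ U * star U = 1 ∧
      D = U * rdiag l * star U :=
  ⟨hD.eigenvectorUnitary, hD.eigenvalues, Unitary.coe_star_mul_self _,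
    Unitary.coe_mul_star_self _, hD.spectral_theorem⟩

open Polynomial in
theorem aeval_unitary_rdiag {n : ℕ} {U : Mat n} (h1 : star U * U = 1) (h2 : U * star U = 1)
    (l : Fin n → ℝ) (q : ℝ[X]) :
    aeval (U * rdiag l * star U) q = U * rdiag (fun i => q.eval (l i)) * star U := by
  induction q using Polynomial.induction_on' with
  | add p q hp hq =>
    have : rdiag (fun i => (p + q).eval (l i)) =
      rdiag (fun i => p.eval (l i)) + rdiag fun i => q.eval (l i) := by
      ext i j; rcases eq_or_ne i j with rfl | h <;> simp [*]
    rw [map_add, hp, hq, this, mul_add, add_mul]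
  | monomial k c =>
    have hpow : (U * rdiag l * star U) ^ k = U * rdiag l ^ k * star U := by
      induction k with
      | zero => simp [h2]
      | succ k ih =>
        rw [pow_succ, ih, pow_succ]
        calc _ = U * rdiag l ^ k * (star U * U) * rdiag l * star U := by noncomm_ring
          _ = _ := by rw [h1]; noncomm_ring
    have : rdiag (fun i => (monomial k c).eval (l i)) = c • rdiag l ^ k := by
      rw [Matrix.diagonal_pow]; ext i j; rcases eq_or_ne i j with rfl | h <;> simp [*]
    rw [aeval_monomial, hpow, this, ← Algebra.smul_def]
    simp

theorem spectrum_unitary_rdiag {n : ℕ} {U : Mat n} (h1 : star U * U = 1) (h2 : U * star U = 1)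
    (l : Fin n → ℝ) : spectrum ℝ (U * rdiag l * star U) = Set.range l := by
  have h3 : spectrum ℝ (U * rdiag l * star U) = spectrum ℝ (rdiag l) :=
    Unitary.spectrum_star_right_conjugate (U := ⟨U, Unitary.mem_iff.mpr ⟨h1, h2⟩⟩)
  ext x
  rw [h3, ← spectrum.algebraMap_mem_iff ℂ, spectrum_diagonal]
  simp [Set.mem_range]

/-- The functional calculus in a diagonalizing basis. -/
theorem cfc_unitary_rdiag {n : ℕ} {U : Mat n} (h1 : star U * U = 1) (h2 : U * star U = 1)
    (l : Fin n → ℝ) (g : ℝ → ℝ) :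
    cfc g (U * rdiag l * star U) = U * rdiag (fun i => g (l i)) * star U := by
  -- Only the values of q on the spectrum matter here; the prescribed derivative 0 is arbitrary.
  obtain ⟨q, hq⟩ := exists_polynomial_eval_derivative (Finset.univ.image l) g 0
  have hH : IsSelfAdjoint (U * rdiag l * star U) := conj_isHermitian U (rdiag_isHermitian l)
  have hq' : ∀ i, q.eval (l i) = g (l i) := fun i => (hq _ (by simp)).1
  have : cfc g (U * rdiag l * star U) = cfc (fun x => q.eval x) (U * rdiag l * star U) := by
    refine cfc_congr ?_
    rw [spectrum_unitary_rdiag h1 h2]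
    rintro _ ⟨i, rfl⟩
    exact (hq' i).symm
  rw [this, cfc_polynomial q _ hH, aeval_unitary_rdiag h1 h2]
  simp only [hq']

theorem cfc_rdiag {n : ℕ} (l : Fin n → ℝ) (g : ℝ → ℝ) :
    cfc g (rdiag l) = rdiag (fun i => g (l i)) := by
  simpa using cfc_unitary_rdiag (U := (1 : Mat n)) (by simp) (by simp) l g

/-- The derivative of the functional calculus of `g` at `U diag(l) U*` in the direction `A`. -/
def cfcDeriv {n : ℕ} (U : Mat n) (l : Fin n → ℝ) (g : ℝ → ℝ) (A : Mat n) : Mat n :=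
  U * (Matrix.of fun i j => ((dslope g (l i) (l j) : ℝ) : ℂ) * (star U * A * U) i j) * star U

-- This is the Leibniz rule for divided differences, applied to z^k · z; it matches the product rule
-- in the induction for matrix powers.
open Polynomial in
theorem dslope_monomial_mul_X (k : ℕ) (x y : ℝ) :
    dslope (fun z : ℝ => z ^ (k + 1)) x y = x ^ k + dslope (fun z : ℝ => z ^ k) x y * y := by
  rcases eq_or_ne y x with rfl | h
  · simp only [dslope_same]
    rcases k with _ | k
    · simp
    · simp; ring
  · rw [dslope_of_ne _ h, dslope_of_ne _ h, slope_def_field, slope_def_field]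
    field_simp [sub_ne_zero.mpr h]
    ring

open scoped Matrix.Norms.L2Operator in
open Polynomial in
theorem hasDerivAt_pow_line {n : ℕ} {U : Mat n} (h1 : star U * U = 1) (h2 : U * star U = 1)
    (l : Fin n → ℝ) (A : Mat n) (k : ℕ) :
    HasDerivAt (fun t : ℝ => (U * rdiag l * star U + t • A) ^ k)
      (cfcDeriv U l (fun x => x ^ k) A) 0 := by
  induction k with
  | zero =>
    have : cfcDeriv U l (fun x => x ^ 0) A = 0 := by
      have : (fun x : ℝ => x ^ 0) = fun _ => (1 : ℝ) := by ext; simp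
      have hz : ∀ x y : ℝ, dslope (fun _ : ℝ => (1 : ℝ)) x y = 0 := fun x y => by
        rcases eq_or_ne y x with rfl | h
        · simp
        · simp [dslope_of_ne _ h, slope_def_field]
      rw [cfcDeriv, this]
      simp only [hz]
      ext; simp [Matrix.mul_apply]
    rw [this]
    simpa using hasDerivAt_const (0 : ℝ) (1 : Mat n)
  | succ k ih =>
    have hl : HasDerivAt (fun t : ℝ => U * rdiag l * star U + t • A) A 0 := by
      simpa using ((hasDerivAt_id (0 : ℝ)).smul_const A).const_add (U * rdiag l * star U)
    have := ih.mul hl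
    simp only [zero_smul, add_zero] at this
    convert! this using 1
    have hp : (U * rdiag l * star U) ^ k = U * rdiag (fun i => l i ^ k) * star U := by
      have := aeval_unitary_rdiag h1 h2 l (X ^ k)
      simpa using this
    have hA : A = U * (star U * A * U) * star U := by
      calc A = (U * star U) * A * (U * star U) := by rw [h2]; simp
        _ = _ := by noncomm_ring
    rw [hp]
    conv_rhs => rw [hA]
    rw [cfcDeriv, cfcDeriv]
    set B := star U * A * U
    have e1 : ∀ M N : Mat n, (U * M * star U) * (U * N * star U) = U * (M * N) * star U := by
      intro M N
      calc _ = U * M * (star U * U) * N * star U := by noncomm_ring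
        _ = _ := by rw [h1]; noncomm_ring
    have e2 : star U * (U * B * star U) * U = B := by
      calc _ = (star U * U) * B * (star U * U) := by noncomm_ring
        _ = B := by rw [h1]; simp
    rw [e2, e1, e1, ← add_mul, ← mul_add]
    congr 2
    ext i j
    simp only [Matrix.of_apply, Matrix.add_apply, Matrix.mul_diagonal, Matrix.diagonal_mul]
    rw [dslope_monomial_mul_X]
    push_cast
    ring

open scoped Matrix.Norms.L2Operator in
open Polynomial in
theorem hasDerivAt_aeval_line {n : ℕ} {U : Mat n} (h1 : star U * U = 1) (h2 : U * star U = 1)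
    (l : Fin n → ℝ) (A : Mat n) (q : ℝ[X]) :
    HasDerivAt (fun t : ℝ => aeval (U * rdiag l * star U + t • A) q)
      (cfcDeriv U l (fun x => q.eval x) A) 0 := by
  induction q using Polynomial.induction_on' with
  | add p q hp hq =>
    simp only [map_add]
    convert! hp.add hq using 1
    rw [cfcDeriv, cfcDeriv, cfcDeriv, ← add_mul, ← mul_add]
    congr 2
    ext i j
    simp only [Matrix.of_apply, Matrix.add_apply, ← add_mul, ← Complex.ofReal_add]
    congr 2
    rcases eq_or_ne (l j) (l i) with h | h
    · simp only [h, dslope_same, eval_add, Polynomial.deriv]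
      simpa using Polynomial.deriv (p := p + q) (x := l i)
    · simp only [dslope_of_ne _ h, slope_def_field, eval_add]
      ring
  | monomial k c =>
    have := (hasDerivAt_pow_line h1 h2 l A k).const_smul c
    simp only [aeval_monomial, ← Algebra.smul_def]
    convert! this using 1
    rw [cfcDeriv, cfcDeriv, ← smul_mul_assoc, ← mul_smul_comm]
    congr 2
    ext i j
    simp only [Matrix.of_apply, Matrix.smul_apply, Complex.real_smul, ← mul_assoc,
      ← Complex.ofReal_mul]
    congr 2
    rcases eq_or_ne (l j) (l i) with h | h
    · simp [h, dslope_same]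
    · simp only [dslope_of_ne _ h, slope_def_field, eval_monomial]
      ring

open scoped Matrix.Norms.L2Operator in
open Polynomial in
/-- The Daleckii-Krein formula along a line. -/
theorem hasDerivAt_cfc_line {n : ℕ} {U : Mat n} (h1 : star U * U = 1) (h2 : U * star U = 1)
    (l : Fin n → ℝ) {A : Mat n} (hA : A.IsHermitian) {g : ℝ → ℝ}
    (hg : ∀ i, DifferentiableAt ℝ g (l i)) :
    HasDerivAt (fun t : ℝ => cfc g (U * rdiag l * star U + t • A)) (cfcDeriv U l g A) 0 := by
  -- The polynomial q agrees with g to first order on the spectrum. The formula holds for q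
  -- algebraically, and g − q contributes only o(t), so differentiability of g at the eigenvalues
  -- suffices.
  obtain ⟨q, hq⟩ := exists_polynomial_eval_derivative (Finset.univ.image l) g (deriv g)
  have hq1 : ∀ i, q.eval (l i) = g (l i) := fun i => (hq _ (by simp)).1
  have hq2 : ∀ i, q.derivative.eval (l i) = deriv g (l i) := fun i => (hq _ (by simp)).2
  have hD : (U * rdiag l * star U).IsHermitian := conj_isHermitian U (rdiag_isHermitian l)
  have hH : ∀ t : ℝ, IsSelfAdjoint (U * rdiag l * star U + t • A) := fun t =>
    IsSelfAdjoint.add hD (IsSelfAdjoint.smul (IsSelfAdjoint.all t) hA)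
  have hsplit : ∀ t : ℝ, cfc g (U * rdiag l * star U + t • A) =
      aeval (U * rdiag l * star U + t • A) q +
        cfc (fun x => g x - q.eval x) (U * rdiag l * star U + t • A) := by
    intro t
    have hc : ∀ f : ℝ → ℝ, ContinuousOn f (spectrum ℝ (U * rdiag l * star U + t • A)) := fun f =>
      Matrix.finite_real_spectrum.continuousOn f
    rw [← cfc_polynomial q _ (hH t), ← cfc_add _ _ _ (hc _) (hc _)]
    congr 1
    ext x
    ring
  have ho : (fun t : ℝ => cfc (fun x => g x - q.eval x) (U * rdiag l * star U + t • A))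
      =o[𝓝 0] (fun t => t) := by
    refine cfc_add_smul_isLittleO (A := Mat n) hD Matrix.finite_real_spectrum ?_
    rw [spectrum_unitary_rdiag h1 h2]
    rintro _ ⟨i, rfl⟩
    refine ⟨by rw [hq1, sub_self], ?_⟩
    have := (hg i).hasDerivAt.sub (q.hasDerivAt (l i))
    rwa [hq2, sub_self] at this
  have ho' : HasDerivAt
      (fun t : ℝ => cfc (fun x => g x - q.eval x) (U * rdiag l * star U + t • A)) 0 0 := by
    rw [hasDerivAt_iff_isLittleO]
    have hz : cfc (fun x => g x - q.eval x) (U * rdiag l * star U) = 0 := by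
      rw [cfc_unitary_rdiag h1 h2]
      have : rdiag (fun i => g (l i) - q.eval (l i)) = 0 := by
        ext i j; simp [hq1, Matrix.diagonal_apply]
      rw [this, mul_zero, zero_mul]
    simpa [hz] using ho
  have hfin := (hasDerivAt_aeval_line h1 h2 l A q).add ho'
  simp only [hsplit]
  convert! hfin using 1
  rw [add_zero, cfcDeriv, cfcDeriv]
  congr 3
  ext i j
  congr 2
  rcases eq_or_ne (l j) (l i) with h | h
  · simp [h, dslope_same, hq2]
  · simp only [dslope_of_ne _ h, slope_def_field, hq1]

end WYD
end

/-! ### The α-metrics in an eigenbasis, and commutator directions -/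

noncomputable section
namespace WYD

open Filter Topology

/-- The primitive of `x ^ (p - 1)` on `(0, ∞)`: a multiple of a power, or the logarithm. -/
def pw (p x : ℝ) : ℝ := if p = 0 then Real.log x else x ^ p / p

theorem pw_zero : pw 0 = Real.log := by ext; simp [pw]

theorem pw_of_ne {p : ℝ} (hp : p ≠ 0) : pw p = fun x => x ^ p / p := by ext; simp [pw, hp]

theorem pw_one : pw 1 = id := by ext; simp [pw]

theorem hasDerivAt_pw (p : ℝ) {x : ℝ} (hx : 0 < x) : HasDerivAt (pw p) (x ^ (p - 1)) x := by
  rcases eq_or_ne p 0 with rfl | hp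
  · rw [pw_zero]
    convert! Real.hasDerivAt_log hx.ne' using 1
    rw [zero_sub, Real.rpow_neg_one]
  · rw [pw_of_ne hp]
    convert! (Real.hasDerivAt_rpow_const (p := p) (Or.inl hx.ne')).div_const p using 1
    field_simp

theorem contDiffOn_pw (p : ℝ) : ContDiffOn ℝ ∞ (pw p) (Set.Ioi 0) := by
  rcases eq_or_ne p 0 with rfl | hp
  · rw [pw_zero]
    exact fun x hx => (Real.contDiffAt_log.mpr (ne_of_gt hx)).contDiffWithinAt
  · rw [pw_of_ne hp]
    exact fun x hx => ((Real.contDiffAt_rpow_const_of_ne (ne_of_gt hx)).div_const p).contDiffWithinAt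

theorem strictMonoOn_pw (p : ℝ) : StrictMonoOn (pw p) (Set.Ioi 0) := by
  refine strictMonoOn_of_deriv_pos (convex_Ioi 0)
    (fun x hx => (hasDerivAt_pw p hx).continuousAt.continuousWithinAt) fun x hx => ?_
  rw [interior_Ioi] at hx
  rw [(hasDerivAt_pw p hx).deriv]
  exact Real.rpow_pos_of_pos hx _

theorem dslope_comm (g : ℝ → ℝ) (x y : ℝ) : dslope g x y = dslope g y x := by
  rcases eq_or_ne y x with rfl | h
  · rfl
  · rw [dslope_of_ne _ h, dslope_of_ne _ h.symm, slope_comm]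

theorem dslope_pw_pos (p : ℝ) {x y : ℝ} (hx : 0 < x) (hy : 0 < y) : 0 < dslope (pw p) x y := by
  rcases eq_or_ne y x with rfl | h
  · rw [dslope_same, (hasDerivAt_pw p hx).deriv]
    exact Real.rpow_pos_of_pos hx _
  · rw [dslope_of_ne _ h, slope_def_field]
    rcases h.lt_or_gt with h | h
    · exact div_pos_of_neg_of_neg (sub_neg.mpr (strictMonoOn_pw p hy hx h)) (sub_neg.mpr h)
    · exact div_pos (sub_pos.mpr (strictMonoOn_pw p hx hy h)) (sub_pos.mpr h)

/-- The kernel of the metric `alphaMetric (2 * p - 1)` in an eigenbasis of the state. -/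
def wydKernel (p x y : ℝ) : ℝ := dslope (pw p) x y * dslope (pw (1 - p)) x y

theorem wydKernel_comm (p x y : ℝ) : wydKernel p x y = wydKernel p y x := by
  rw [wydKernel, wydKernel, dslope_comm, dslope_comm (pw (1 - p))]

/-- The duality α ↔ −α: exchanging p and 1 − p swaps the two factors. -/
theorem wydKernel_one_sub (p x y : ℝ) : wydKernel (1 - p) x y = wydKernel p x y := by
  rw [wydKernel, wydKernel, sub_sub_cancel, mul_comm]

theorem wydKernel_pos (p : ℝ) {x y : ℝ} (hx : 0 < x) (hy : 0 < y) : 0 < wydKernel p x y :=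
  mul_pos (dslope_pw_pos p hx hy) (dslope_pw_pos (1 - p) hx hy)

/-- The exponents p − 1 and −p add up to −1, which is the Fisher normalization. -/
theorem wydKernel_self (p : ℝ) {x : ℝ} (hx : 0 < x) : wydKernel p x x = 1 / x := by
  rw [wydKernel, dslope_same, dslope_same, (hasDerivAt_pw p hx).deriv,
    (hasDerivAt_pw (1 - p) hx).deriv, ← Real.rpow_add hx]
  ring_nf
  rw [Real.rpow_neg_one]

theorem wydKernel_of_ne (p : ℝ) {x y : ℝ} (h : y ≠ x) :
    wydKernel p x y = (pw p x - pw p y) * (pw (1 - p) x - pw (1 - p) y) / (x - y) ^ 2 := by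
  rw [wydKernel, dslope_of_ne _ h, dslope_of_ne _ h, slope_def_field, slope_def_field]
  field_simp [sub_ne_zero.mpr h, sub_ne_zero.mpr h.symm]
  ring

section Matrices

variable {n : ℕ}

theorem exists_unitary_of_mem_states {D : Mat n} (hD : D ∈ States n) :
    ∃ (U : Mat n) (l : Fin n → ℝ), star U * U = 1 ∧ U * star U = 1 ∧ (∀ i, 0 < l i) ∧
      ∑ i, l i = 1 ∧ D = U * rdiag l * star U := by
  refine ⟨hD.1.1.eigenvectorUnitary, hD.1.1.eigenvalues, Unitary.coe_star_mul_self _,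
    Unitary.coe_mul_star_self _, hD.1.eigenvalues_pos, ?_, hD.1.1.spectral_theorem⟩
  have := hD.1.1.trace_eq_sum_eigenvalues.symm.trans hD.2
  rw [← Complex.ofReal_inj, Complex.ofReal_one, Complex.ofReal_sum]
  exact this

theorem trace_unitary_conj {U : Mat n} (h1 : star U * U = 1) (M : Mat n) :
    (U * M * star U).trace = M.trace := by
  rw [Matrix.trace_mul_comm, ← mul_assoc, h1, one_mul]

theorem posDef_unitary_rdiag {U : Mat n} (h1 : star U * U = 1) (h2 : U * star U = 1)
    {l : Fin n → ℝ} (hl : ∀ i, 0 < l i) : (U * rdiag l * star U).PosDef := by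
  have hd : (rdiag l).PosDef := Matrix.PosDef.diagonal fun i => by exact_mod_cast hl i
  refine hd.mul_mul_conjTranspose_same ?_
  exact Matrix.vecMul_injective_of_isUnit ⟨⟨U, star U, h2, h1⟩, rfl⟩

theorem unitary_rdiag_mem_states {U : Mat n} (h1 : star U * U = 1) (h2 : U * star U = 1)
    {l : Fin n → ℝ} (hl : ∀ i, 0 < l i) (hs : ∑ i, l i = 1) : U * rdiag l * star U ∈ States n := by
  refine ⟨posDef_unitary_rdiag h1 h2 hl, ?_⟩
  rw [trace_unitary_conj h1, Matrix.trace_diagonal]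
  exact_mod_cast hs

theorem rdiag_mem_states {l : Fin n → ℝ} (hl : ∀ i, 0 < l i) (hs : ∑ i, l i = 1) :
    rdiag l ∈ States n := by
  simpa using unitary_rdiag_mem_states (U := (1 : Mat n)) (by simp) (by simp) hl hs

/-- States stay positive along short lines. -/
theorem eventually_spectrum_pos {D A : Mat n} (hD : D.PosDef) :
    ∀ᶠ t : ℝ in 𝓝 0, ∀ x ∈ spectrum ℝ (D + t • A), 0 < x := by
  open scoped Matrix.Norms.L2Operator in
  have h1 : ∀ y ∈ spectrum ℝ D, ∀ᶠ t : ℝ in 𝓝 0, ‖t • A‖ < y := by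
    intro y hy
    have hy0 : 0 < y := by
      rw [hD.1.spectrum_real_eq_range_eigenvalues] at hy
      obtain ⟨i, rfl⟩ := hy
      exact hD.eigenvalues_pos i
    have : Tendsto (fun t : ℝ => ‖t • A‖) (𝓝 0) (𝓝 0) := by
      have hc : Continuous fun t : ℝ => ‖t • A‖ := by fun_prop
      simpa using hc.tendsto 0
    exact this.eventually_lt_const hy0
  filter_upwards [(Filter.eventually_all_finite Matrix.finite_real_spectrum).mpr h1] with t ht x hx
  obtain ⟨y, hy, hxy⟩ := exists_mem_spectrum_abs_sub_le (A := Mat n) hD.1 hx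
  linarith [ht y hy, (abs_le.mp hxy).1]

theorem mixedDeriv_congr {F G : ℝ → ℝ → ℝ} (h : ∀ᶠ t in 𝓝 0, ∀ s, F t s = G t s) :
    mixedDeriv F = mixedDeriv G := by
  refine Filter.EventuallyEq.deriv_eq ?_
  filter_upwards [h] with t ht
  congr 1
  ext s
  exact ht s

open scoped Matrix.Norms.L2Operator in
theorem hasDerivAt_re_trace {G : ℝ → Mat n} {G' : Mat n} {t : ℝ} (hG : HasDerivAt G G' t) :
    HasDerivAt (fun t => (G t).trace.re) G'.trace.re t := by
  exact (LinearMap.toContinuousLinearMap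
    ((Complex.reLm : ℂ →ₗ[ℝ] ℝ).comp
      ((Matrix.traceLinearMap (Fin n) ℂ ℂ).restrictScalars ℝ))).hasFDerivAt.comp_hasDerivAt t hG

open scoped Matrix.Norms.L2Operator in
theorem mixedDeriv_trace_mul {a b : ℝ → ℝ} {c : ℝ} {G H : ℝ → Mat n} {G' H' : Mat n}
    (hb : DifferentiableAt ℝ b 0) (hG : HasDerivAt G G' 0) (hH : HasDerivAt H H' 0) :
    mixedDeriv (fun t s => a t + b s + c * (G t * H s).trace.re) = c * (G' * H').trace.re := by
  have h1 : ∀ t, deriv (fun s => a t + b s + c * (G t * H s).trace.re) 0 =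
      deriv b 0 + c * (G t * H').trace.re := fun t =>
    ((hb.hasDerivAt.const_add (a t)).add
      ((hasDerivAt_re_trace (hH.const_mul (G t))).const_mul c)).deriv
  rw [mixedDeriv]
  simp only [h1]
  exact (((hasDerivAt_re_trace (hG.mul_const H')).const_mul c).const_add _).deriv

theorem trace_cfcDeriv_mul_cfcDeriv {U : Mat n} (h1 : star U * U = 1) (l : Fin n → ℝ)
    (g h : ℝ → ℝ) (A B : Mat n) :
    (cfcDeriv U l g A * cfcDeriv U l h B).trace.re =
      ∑ i, ∑ j, dslope g (l i) (l j) * dslope h (l i) (l j) *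
        ((star U * A * U) i j * (star U * B * U) j i).re := by
  have e1 : ∀ M N : Mat n, (U * M * star U) * (U * N * star U) = U * (M * N) * star U := by
    intro M N
    calc _ = U * M * (star U * U) * N * star U := by noncomm_ring
      _ = _ := by rw [h1]; noncomm_ring
  rw [cfcDeriv, cfcDeriv, e1, trace_unitary_conj h1, Matrix.trace, Complex.re_sum]
  refine Finset.sum_congr rfl fun i _ => ?_
  rw [Matrix.diag_apply, Matrix.mul_apply, Complex.re_sum]
  refine Finset.sum_congr rfl fun j _ => ?_
  rw [Matrix.of_apply, Matrix.of_apply, dslope_comm h (l j) (l i)]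
  rw [← Complex.re_ofReal_mul]
  congr 1
  push_cast
  ring

theorem cfc_id_of_isHermitian {M : Mat n} (hM : M.IsHermitian) : cfc (id : ℝ → ℝ) M = M :=
  cfc_id ℝ M hM

theorem cfc_rpow_neg_mul_self {M : Mat n} (hM : M.IsHermitian)
    (hpos : ∀ x ∈ spectrum ℝ M, 0 < x) (q : ℝ) :
    cfc (fun x : ℝ => x ^ (-q)) M * M = cfc (fun x : ℝ => x ^ (1 - q)) M := by
  have hc : ∀ f : ℝ → ℝ, ContinuousOn f (spectrum ℝ M) := fun f =>
    Matrix.finite_real_spectrum.continuousOn f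
  have h : cfc (fun x : ℝ => x ^ (-q) * x) M = cfc (fun x : ℝ => x ^ (-q)) M * cfc id M :=
    cfc_mul _ _ M (hc _) (hc _)
  rw [cfc_id_of_isHermitian hM] at h
  rw [← h]
  refine cfc_congr fun x hx => ?_
  rw [sub_eq_add_neg, add_comm, Real.rpow_add (hpos x hx), Real.rpow_one]

theorem isHermitian_add_smul {D A : Mat n} (hD : D.IsHermitian) (hA : A.IsHermitian) (t : ℝ) :
    (D + t • A).IsHermitian :=
  IsSelfAdjoint.add hD (IsSelfAdjoint.smul (IsSelfAdjoint.all t) hA)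

-- This merges the three cases in the definition of the entropy into one bilinear expression, modulo
-- functions of t alone and of s alone. The restriction to small t is there because D₁^(-p) D₁ =
-- D₁^(1-p) is used with D₁ of positive spectrum; nothing similar is required of D₂.
open scoped Matrix.Norms.L2Operator in
theorem alphaEntropy_eventually_eq (p : ℝ) {U : Mat n} (h1 : star U * U = 1) (h2 : U * star U = 1)
    {l : Fin n → ℝ} (hl : ∀ i, 0 < l i) {A B : Mat n} (hA : A.IsHermitian) (hB : B.IsHermitian) :
    ∃ a b : ℝ → ℝ, DifferentiableAt ℝ b 0 ∧ ∀ᶠ t : ℝ in 𝓝 0, ∀ s : ℝ,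
      alphaEntropy (2 * p - 1) (U * rdiag l * star U + t • A) (U * rdiag l * star U + s • B) =
        a t + b s + -1 * (cfc (pw (1 - p)) (U * rdiag l * star U + t • A) *
          cfc (pw p) (U * rdiag l * star U + s • B)).trace.re := by
  set D := U * rdiag l * star U with hD
  have hDpd : D.PosDef := posDef_unitary_rdiag h1 h2 hl
  have hcont : ∀ (M : Mat n) (f : ℝ → ℝ), ContinuousOn f (spectrum ℝ M) := fun M f =>
    Matrix.finite_real_spectrum.continuousOn f
  by_cases hp1 : p = 1
  · subst hp1
    refine ⟨0, fun s => ((D + s • B) * cfc Real.log (D + s • B)).trace.re, ?_,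
      Eventually.of_forall fun t s => ?_⟩
    · have hl' : HasDerivAt (fun s : ℝ => D + s • B) B 0 := by
        simpa using ((hasDerivAt_id (0 : ℝ)).smul_const B).const_add D
      exact (hasDerivAt_re_trace (hl'.mul (hasDerivAt_cfc_line h1 h2 l hB (g := Real.log)
        fun i => (Real.differentiableAt_log (hl i).ne')))).differentiableAt
    · rw [sub_self, pw_zero, pw_one, cfc_id_of_isHermitian (isHermitian_add_smul hDpd.1 hB s), alphaEntropy,
        if_pos (by norm_num), mul_sub, Matrix.trace_sub, Complex.sub_re,
        Matrix.trace_mul_comm (cfc Real.log _)]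
      simp only [Pi.zero_apply]
      ring
  by_cases hp0 : p = 0
  · subst hp0
    refine ⟨fun t => ((D + t • A) * cfc Real.log (D + t • A)).trace.re, 0, by simp,
      Eventually.of_forall fun t s => ?_⟩
    rw [sub_zero, pw_zero, pw_one, cfc_id_of_isHermitian (isHermitian_add_smul hDpd.1 hA t), alphaEntropy,
      if_neg (by norm_num), if_pos (by norm_num), mul_sub, Matrix.trace_sub, Complex.sub_re]
    simp only [Pi.zero_apply]
    ring
  · have hq : 1 - p ≠ 0 := sub_ne_zero.mpr (Ne.symm hp1)
    refine ⟨fun t => 4 / (1 - (2 * p - 1) ^ 2) * (D + t • A).trace.re, 0, by simp, ?_⟩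
    filter_upwards [eventually_spectrum_pos (A := A) hDpd] with t ht s
    rw [alphaEntropy, if_neg (by intro h; apply hp1; linarith),
      if_neg (by intro h; apply hp0; linarith)]
    have e1 : (1 + (2 * p - 1)) / 2 = p := by ring
    have e2 : 4 / (1 - (2 * p - 1) ^ 2) = 1 / (p * (1 - p)) := by
      rw [show 1 - (2 * p - 1) ^ 2 = 4 * (p * (1 - p)) by ring]
      field_simp
    have e3 : ∀ (r : ℝ), r ≠ 0 → ∀ M : Mat n, cfc (pw r) M = (1 / r) • cfc (fun x : ℝ => x ^ r) M := by
      intro r hr M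
      rw [← cfc_smul (1 / r) (fun x : ℝ => x ^ r) M (hcont M _), pw_of_ne hr]
      congr 1
      ext x
      simp [div_eq_inv_mul]
    rw [e1, e2, sub_mul, one_mul, mul_assoc,
      cfc_rpow_neg_mul_self (isHermitian_add_smul hDpd.1 hA t) ht, e3 p hp0, e3 _ hq,
      smul_mul_smul_comm, Matrix.trace_smul, Matrix.trace_sub, Complex.sub_re, Complex.smul_re,
      Matrix.trace_mul_comm (cfc (fun x : ℝ => x ^ p) _)]
    simp only [Pi.zero_apply, smul_eq_mul]
    field_simp
    ring

/-- The `α`-metric as the trace of a product of derivatives of the functional calculus. -/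
theorem alphaMetric_eq_trace (p : ℝ) {U : Mat n} (h1 : star U * U = 1) (h2 : U * star U = 1)
    {l : Fin n → ℝ} (hl : ∀ i, 0 < l i) {A B : Mat n} (hA : A.IsHermitian) (hB : B.IsHermitian) :
    alphaMetric (2 * p - 1) n (U * rdiag l * star U) A B =
      (cfcDeriv U l (pw (1 - p)) A * cfcDeriv U l (pw p) B).trace.re := by
  obtain ⟨a, b, hb, hab⟩ := alphaEntropy_eventually_eq p h1 h2 hl hA hB
  rw [alphaMetric, mixedDeriv_congr hab, mixedDeriv_trace_mul hb
    (hasDerivAt_cfc_line h1 h2 l hA fun i => (hasDerivAt_pw _ (hl i)).differentiableAt)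
    (hasDerivAt_cfc_line h1 h2 l hB fun i => (hasDerivAt_pw _ (hl i)).differentiableAt)]
  ring

/-- The `α`-metric in an eigenbasis of the state. -/
theorem alphaMetric_eq_sum (p : ℝ) {U : Mat n} (h1 : star U * U = 1) (h2 : U * star U = 1)
    {l : Fin n → ℝ} (hl : ∀ i, 0 < l i) {A B : Mat n} (hA : A.IsHermitian) (hB : B.IsHermitian) :
    alphaMetric (2 * p - 1) n (U * rdiag l * star U) A B =
      ∑ i, ∑ j, wydKernel p (l i) (l j) *
        ((star U * A * U) i j * (star U * B * U) j i).re := by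
  rw [alphaMetric_eq_trace p h1 h2 hl hA hB, trace_cfcDeriv_mul_cfcDeriv h1]
  simp only [wydKernel, mul_comm (dslope (pw p) _ _)]

theorem re_mul_apply_swap {A : Mat n} (hA : A.IsHermitian) (i j : Fin n) :
    (A i j * A j i).re = Complex.normSq (A i j) := by
  rw [← hA.apply j i, Complex.star_def, Complex.mul_conj, Complex.ofReal_re]

theorem alphaMetric_self_eq_sum (p : ℝ) {U : Mat n} (h1 : star U * U = 1) (h2 : U * star U = 1)
    {l : Fin n → ℝ} (hl : ∀ i, 0 < l i) {A : Mat n} (hA : A.IsHermitian) :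
    alphaMetric (2 * p - 1) n (U * rdiag l * star U) A A =
      ∑ i, ∑ j, wydKernel p (l i) (l j) * Complex.normSq ((star U * A * U) i j) := by
  rw [alphaMetric_eq_sum p h1 h2 hl hA hA]
  simp only [re_mul_apply_swap (conj_isHermitian' U hA)]

theorem commTangent_isHermitian {ρ X : Mat n} (hρ : ρ.IsHermitian) (hX : X.IsHermitian) :
    (commTangent ρ X).IsHermitian := by
  rw [commTangent, Matrix.IsHermitian, Matrix.conjTranspose_smul, Matrix.conjTranspose_sub,
    Matrix.conjTranspose_mul, Matrix.conjTranspose_mul, hρ.eq, hX.eq, Complex.star_def,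
    Complex.conj_I, neg_smul, ← smul_neg, neg_sub]

theorem commTangent_mem_tangent {ρ X : Mat n} (hρ : ρ.IsHermitian) (hX : X.IsHermitian) :
    commTangent ρ X ∈ Tangent n :=
  ⟨commTangent_isHermitian hρ hX, by
    rw [commTangent, Matrix.trace_smul, Matrix.trace_sub, Matrix.trace_mul_comm, sub_self,
      smul_zero]⟩

/-- In the direction of a commutator, the functional calculus is differentiated by the commutator. -/
theorem cfcDeriv_commTangent {U : Mat n} (h1 : star U * U = 1) (h2 : U * star U = 1)
    (l : Fin n → ℝ) (g : ℝ → ℝ) (X : Mat n) :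
    cfcDeriv U l g (commTangent (U * rdiag l * star U) X) =
      commTangent (cfc g (U * rdiag l * star U)) X := by
  have e1 : ∀ m : Fin n → ℝ, commTangent (U * rdiag m * star U) X =
      U * (commTangent (rdiag m) (star U * X * U)) * star U := by
    intro m
    simp only [commTangent, mul_smul_comm, smul_mul_assoc]
    congr 1
    calc _ = U * rdiag m * star U * X * (U * star U) - (U * star U) * X * U * rdiag m * star U := by
            rw [h2]; noncomm_ring
      _ = _ := by noncomm_ring
  rw [cfc_unitary_rdiag h1 h2, e1, e1, cfcDeriv]
  have e2 : ∀ M : Mat n, star U * (U * M * star U) * U = M := by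
    intro M
    calc _ = (star U * U) * M * (star U * U) := by noncomm_ring
      _ = M := by rw [h1]; simp
  rw [e2]
  congr 2
  ext i j
  simp only [commTangent, Matrix.of_apply, Matrix.smul_apply, Matrix.sub_apply,
    Matrix.diagonal_mul, Matrix.mul_diagonal, smul_eq_mul]
  have h3 : (dslope g (l i) (l j)) * (l i - l j) = g (l i) - g (l j) := by
    rcases eq_or_ne (l j) (l i) with h | h
    · simp [h]
    · rw [dslope_of_ne _ h, slope_def_field]
      field_simp [sub_ne_zero.mpr h]
      ring
  have h4 : ((dslope g (l i) (l j) : ℝ) : ℂ) * ((l i : ℂ) - l j) = g (l i) - g (l j) := by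
    exact_mod_cast h3
  linear_combination Complex.I * (star U * X * U) i j * h4

/-- The right-hand side of `IsGeneratedBy`. -/
theorem mixedDeriv_generated {ρ X Y : Mat n} (hρ : ρ ∈ States n) (hX : X.IsHermitian)
    (hY : Y.IsHermitian) {g gs : ℝ → ℝ} (hg : ∀ x, 0 < x → DifferentiableAt ℝ g x)
    (hgs : ∀ x, 0 < x → DifferentiableAt ℝ gs x) :
    (mixedDeriv fun t s =>
        (cfc g (ρ + t • commTangent ρ X) * cfc gs (ρ + s • commTangent ρ Y)).trace.re) =
      (commTangent (cfc g ρ) X * commTangent (cfc gs ρ) Y).trace.re := by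
  obtain ⟨U, l, h1, h2, hl, -, rfl⟩ := exists_unitary_of_mem_states hρ
  have hH := conj_isHermitian U (rdiag_isHermitian l)
  have := mixedDeriv_trace_mul (a := 0) (b := 0) (c := 1) (by simp)
    (hasDerivAt_cfc_line h1 h2 l (commTangent_isHermitian hH hX) fun i => hg _ (hl i))
    (hasDerivAt_cfc_line h1 h2 l (commTangent_isHermitian hH hY) fun i => hgs _ (hl i))
  rw [cfcDeriv_commTangent h1 h2, cfcDeriv_commTangent h1 h2] at this
  simpa using this

theorem trace_commTangent_rdiag (u v : Fin n → ℝ) {X : Mat n} (hX : X.IsHermitian) :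
    (commTangent (rdiag u) X * commTangent (rdiag v) X).trace.re =
      ∑ i, ∑ j, (u i - u j) * (v i - v j) * Complex.normSq (X i j) := by
  rw [Matrix.trace, Complex.re_sum]
  refine Finset.sum_congr rfl fun i _ => ?_
  rw [Matrix.diag_apply, Matrix.mul_apply, Complex.re_sum]
  refine Finset.sum_congr rfl fun j _ => ?_
  rw [← re_mul_apply_swap hX, ← Complex.re_ofReal_mul]
  congr 1
  simp only [commTangent, Matrix.smul_apply, Matrix.sub_apply,
    Matrix.diagonal_mul, Matrix.mul_diagonal, smul_eq_mul]
  push_cast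
  linear_combination (-(u i - u j) * (v i - v j) * X i j * X j i : ℂ) * Complex.I_sq

/-- The metric generated by `g`, `gs` at a diagonal state. -/
theorem IsGeneratedBy.apply_rdiag {K : MetricFamily} {g gs : ℝ → ℝ} (hK : IsGeneratedBy K g gs)
    (hg : ∀ x, 0 < x → DifferentiableAt ℝ g x) (hgs : ∀ x, 0 < x → DifferentiableAt ℝ gs x)
    {l : Fin n → ℝ} (hl : ∀ i, 0 < l i) (hs : ∑ i, l i = 1) {X : Mat n} (hX : X.IsHermitian) :
    K n (rdiag l) (commTangent (rdiag l) X) (commTangent (rdiag l) X) =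
      ∑ i, ∑ j, (g (l i) - g (l j)) * (gs (l i) - gs (l j)) * Complex.normSq (X i j) := by
  rw [hK n _ (rdiag_mem_states hl hs) X X hX hX,
    mixedDeriv_generated (rdiag_mem_states hl hs) hX hX hg hgs, cfc_rdiag, cfc_rdiag,
    trace_commTangent_rdiag _ _ hX]

end Matrices

end WYD
end

/-! ### The Schwarz inequality and monotone kernels -/

noncomputable section
namespace WYD

open Filter Topology

section Stochastic

variable {n m : ℕ} {T : Mat n →ₗ[ℂ] Mat m}

theorem IsStochastic.map_isHermitian (hT : IsStochastic T) {A : Mat n} (hA : A.IsHermitian) :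
    (T A).IsHermitian := by
  have h1 : ∀ b : Mat n, (T (b.conjTranspose * b)).IsHermitian := fun b => by
    have := (hT.completelyPositive 1 (fun _ => 1) (fun _ => b)).1
    simpa using this
  -- Positivity speaks of T only on matrices b*b, and polarization writes a Hermitian A as a
  -- difference of two of these.
  have h2 : A = (1 / 4 : ℝ) • ((A + 1).conjTranspose * (A + 1)) -
      (1 / 4 : ℝ) • ((A - 1).conjTranspose * (A - 1)) := by
    rw [← smul_sub, Matrix.conjTranspose_add, Matrix.conjTranspose_sub, hA.eq,
      Matrix.conjTranspose_one]
    have : (A + 1) * (A + 1) - (A - 1) * (A - 1) = (4 : ℝ) • A := by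
      rw [show (4 : ℝ) • A = A + A + A + A by module]
      noncomm_ring
    rw [this, smul_smul]
    norm_num
  rw [h2, map_sub, LinearMap.map_smul_of_tower, LinearMap.map_smul_of_tower]
  exact IsSelfAdjoint.sub (IsSelfAdjoint.smul (IsSelfAdjoint.all _) (h1 _))
    (IsSelfAdjoint.smul (IsSelfAdjoint.all _) (h1 _))

theorem IsStochastic.map_mem_tangent (hT : IsStochastic T) {A : Mat n} (hA : A ∈ Tangent n) :
    T A ∈ Tangent m :=
  ⟨hT.map_isHermitian hA.1, (hT.trace_map A).trans hA.2⟩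

/-- The adjoint of `T` for the trace pairing. -/
def traceAdjoint (T : Mat n →ₗ[ℂ] Mat m) (Y : Mat m) : Mat n :=
  Matrix.of fun i j => (Y * T (Matrix.single j i 1)).trace

theorem trace_traceAdjoint_mul (T : Mat n →ₗ[ℂ] Mat m) (Y : Mat m) (A : Mat n) :
    (traceAdjoint T Y * A).trace = (Y * T A).trace := by
  conv_rhs => rw [Matrix.matrix_eq_sum_single A]
  simp only [map_sum, Matrix.mul_sum, Matrix.trace_sum]
  rw [Matrix.trace, Finset.sum_comm]
  refine Finset.sum_congr rfl fun i _ => ?_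
  rw [Matrix.diag_apply, Matrix.mul_apply]
  refine Finset.sum_congr rfl fun j _ => ?_
  have : Matrix.single j i (A j i) = A j i • Matrix.single j i (1 : ℂ) := by
    rw [Matrix.smul_single, smul_eq_mul, mul_one]
  rw [this, map_smul, mul_smul_comm, Matrix.trace_smul, smul_eq_mul, mul_comm]
  rfl

theorem eq_of_trace_mul_eq {X Y : Mat n} (h : ∀ A, (X * A).trace = (Y * A).trace) : X = Y := by
  ext i j
  simpa [Matrix.trace_mul_single] using h (Matrix.single j i 1)

theorem IsStochastic.map_conjTranspose (hT : IsStochastic T) (A : Mat n) :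
    T A.conjTranspose = (T A).conjTranspose := by
  have h1 : (A + A.conjTranspose).IsHermitian := Matrix.isHermitian_add_transpose_self A
  have h2 : (Complex.I • (A - A.conjTranspose)).IsHermitian := by
    rw [Matrix.IsHermitian, Matrix.conjTranspose_smul, Matrix.conjTranspose_sub,
      Matrix.conjTranspose_conjTranspose, Complex.star_def, Complex.conj_I, neg_smul, ← smul_neg,
      neg_sub]
  have e1 := (hT.map_isHermitian h1).eq
  have e2 := (hT.map_isHermitian h2).eq
  simp only [map_add, map_sub, map_smul, Matrix.conjTranspose_add, Matrix.conjTranspose_sub,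
    Matrix.conjTranspose_smul, Complex.star_def, Complex.conj_I, neg_smul] at e1 e2
  rw [← smul_neg] at e2
  have e3 := smul_right_injective (Mat m) Complex.I_ne_zero e2
  have e4 : (2 : ℂ) • T A.conjTranspose = (2 : ℂ) • (T A).conjTranspose := by
    have h3 : (2 : ℂ) • T A.conjTranspose =
      (T A + T A.conjTranspose) - (T A - T A.conjTranspose) := by module
    rw [h3, ← e1]
    rw [← e3]
    module
  exact smul_right_injective (Mat m) (two_ne_zero (α := ℂ)) e4

theorem traceAdjoint_conjTranspose (hT : IsStochastic T) (Y : Mat m) :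
    traceAdjoint T Y.conjTranspose = (traceAdjoint T Y).conjTranspose := by
  refine eq_of_trace_mul_eq fun A => ?_
  rw [trace_traceAdjoint_mul]
  have h1 := trace_traceAdjoint_mul T Y A.conjTranspose
  have h2 := congrArg star h1
  rw [← Matrix.trace_conjTranspose, ← Matrix.trace_conjTranspose, Matrix.conjTranspose_mul,
    Matrix.conjTranspose_mul, hT.map_conjTranspose, Matrix.conjTranspose_conjTranspose,
    Matrix.conjTranspose_conjTranspose, Matrix.trace_mul_comm, Matrix.trace_mul_comm (T A)] at h2
  exact h2.symm

theorem traceAdjoint_one (hT : IsStochastic T) : traceAdjoint T 1 = 1 := by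
  refine eq_of_trace_mul_eq fun A => ?_
  rw [trace_traceAdjoint_mul, one_mul, one_mul, hT.trace_map]

theorem exists_conjTranspose_mul_self {D : Mat n} (hD : D.PosSemidef) :
    ∃ W : Mat n, D = W.conjTranspose * W := by
  obtain ⟨U, l, hl, h⟩ : ∃ (U : Mat n) (l : Fin n → ℝ), (∀ i, 0 ≤ l i) ∧
      D = U * rdiag l * star U :=
    ⟨hD.1.eigenvectorUnitary, hD.1.eigenvalues, hD.eigenvalues_nonneg, hD.1.spectral_theorem⟩
  refine ⟨rdiag (fun i => √(l i)) * star U, ?_⟩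
  have : rdiag l = rdiag (fun i => √(l i)) * rdiag (fun i => √(l i)) := by
    ext i j
    rcases eq_or_ne i j with rfl | hij
    · simp [← Complex.ofReal_mul, Real.mul_self_sqrt (hl i)]
    · simp [hij]
  rw [Matrix.conjTranspose_mul, (rdiag_isHermitian _).eq, h, this,
    Matrix.star_eq_conjTranspose, Matrix.conjTranspose_conjTranspose]
  noncomm_ring

/-- The Kadison-Schwarz inequality for the trace adjoint of a stochastic mapping. -/
theorem IsStochastic.schwarz (hT : IsStochastic T) {D : Mat n} (hD : D.PosSemidef) (Y : Mat m) :
    (traceAdjoint T Y * (traceAdjoint T Y).conjTranspose * D).trace.re ≤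
      (Y * Y.conjTranspose * T D).trace.re := by
  obtain ⟨W, hW⟩ := exists_conjTranspose_mul_self hD
  set X := traceAdjoint T Y with hX
  -- With D = W*W and X = T*(Y), these families give after taking traces Tr YY*T(D) − 2 Tr XX*D + Tr
  -- XX*D ≥ 0; the last term uses that T* is unital, that is, that T preserves the trace.
  have hps := hT.completelyPositive 2 ![Y, 1] ![W, -(W * X)]
  have cyc : ∀ (a a' : Mat m) (B : Mat n), (a.conjTranspose * T B * a').trace =
      (traceAdjoint T (a' * a.conjTranspose) * B).trace := by
    intro a a' B
    rw [trace_traceAdjoint_mul, Matrix.trace_mul_comm, mul_assoc]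
  have htr := (Complex.le_def.mp hps.trace_nonneg).1
  rw [Fin.sum_univ_two, Fin.sum_univ_two, Fin.sum_univ_two] at htr
  change 0 ≤ (Matrix.trace ((Y.conjTranspose * T (W.conjTranspose * W) * Y +
    Y.conjTranspose * T (W.conjTranspose * -(W * X)) * 1) +
    ((1 : Mat m).conjTranspose * T ((-(W * X)).conjTranspose * W) * Y +
    (1 : Mat m).conjTranspose * T ((-(W * X)).conjTranspose * -(W * X)) * 1))).re at htr
  rw [Matrix.trace_add, Matrix.trace_add, Matrix.trace_add, cyc, cyc, cyc, cyc] at htr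
  rw [Matrix.conjTranspose_one, one_mul, mul_one, mul_one, traceAdjoint_one hT,
    traceAdjoint_conjTranspose hT, ← hX, trace_traceAdjoint_mul T (Y * Y.conjTranspose), ← hW,
    Matrix.conjTranspose_neg, Matrix.conjTranspose_mul] at htr
  have e1 : (X.conjTranspose * (W.conjTranspose * -(W * X))).trace =
      -(X * X.conjTranspose * D).trace := by
    rw [hW, mul_assoc X, Matrix.trace_mul_comm X, ← Matrix.trace_neg]
    congr 1; noncomm_ring
  have e2 : (X * (-(X.conjTranspose * W.conjTranspose) * W)).trace =
      -(X * X.conjTranspose * D).trace := by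
    rw [hW, ← Matrix.trace_neg]
    congr 1; noncomm_ring
  have e3 : (1 * (-(X.conjTranspose * W.conjTranspose) * -(W * X))).trace =
      (X * X.conjTranspose * D).trace := by
    rw [hW, mul_assoc X, Matrix.trace_mul_comm X]
    congr 1; noncomm_ring
  rw [e1, e2, e3] at htr
  simp only [Complex.add_re, Complex.neg_re] at htr
  linarith

end Stochastic

section Kernels

/-- The concave functional whose maximum is the quadratic form of the kernel `1 / (x + t y)`. -/
def resolventFunctional {n : ℕ} (t : ℝ) (D A X : Mat n) : ℝ :=
  2 * (A * X.conjTranspose).trace.re - (X * X.conjTranspose * D).trace.re -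
    t * (X.conjTranspose * X * D).trace.re

/-- In an eigenbasis of the state the functional decouples into one scalar quadratic per matrix
entry, so its maximum is found by completing squares. -/
theorem resolventFunctional_eq_sum {n : ℕ} {U : Mat n} (h1 : star U * U = 1) (h2 : U * star U = 1)
    (t : ℝ) (l : Fin n → ℝ) (A X : Mat n) :
    resolventFunctional t (U * rdiag l * star U) A X =
      ∑ i, ∑ j, (2 * ((star U * A * U) i j * star ((star U * X * U) i j)).re -
        (l i + t * l j) * Complex.normSq ((star U * X * U) i j)) := by
  have tr : ∀ M : Mat n, M.trace = (star U * M * U).trace := fun M => by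
    rw [Matrix.trace_mul_comm, ← mul_assoc, h2, one_mul]
  have e1 : ∀ M N : Mat n, star U * (M * N) * U = (star U * M * U) * (star U * N * U) := by
    intro M N
    calc _ = star U * M * 1 * N * U := by noncomm_ring
      _ = star U * M * (U * star U) * N * U := by rw [h2]
      _ = _ := by noncomm_ring
  have e2 : star U * X.conjTranspose * U = (star U * X * U).conjTranspose := by
    simp only [Matrix.conjTranspose_mul, Matrix.star_eq_conjTranspose,
      Matrix.conjTranspose_conjTranspose, mul_assoc]
  have e3 : star U * (U * rdiag l * star U) * U = rdiag l := by
    calc _ = (star U * U) * rdiag l * (star U * U) := by noncomm_ring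
      _ = _ := by rw [h1]; simp
  rw [resolventFunctional, tr (A * _), tr (_ * (U * rdiag l * star U)),
    tr (X.conjTranspose * X * _), e1 _ (U * rdiag l * star U), e1 _ (U * rdiag l * star U), e3,
    e1 A, e1 X, e1 _ X, e2]
  generalize star U * A * U = B
  generalize star U * X * U = Z
  have t1 : (B * Z.conjTranspose).trace.re = ∑ i, ∑ j, (B i j * star (Z i j)).re := by
    simp only [Matrix.trace, Matrix.diag_apply, Matrix.mul_apply, Complex.re_sum,
      Matrix.conjTranspose_apply]
  have t2 : (Z * Z.conjTranspose * rdiag l).trace.re =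
      ∑ i, ∑ j, l i * Complex.normSq (Z i j) := by
    rw [Matrix.trace, Complex.re_sum]
    refine Finset.sum_congr rfl fun i _ => ?_
    rw [Matrix.diag_apply, Matrix.mul_diagonal, Matrix.mul_apply, Finset.sum_mul, Complex.re_sum]
    refine Finset.sum_congr rfl fun j _ => ?_
    rw [Matrix.conjTranspose_apply, Complex.star_def, Complex.mul_conj, ← Complex.ofReal_mul,
      Complex.ofReal_re, mul_comm]
  have t3 : (Z.conjTranspose * Z * rdiag l).trace.re =
      ∑ i, ∑ j, l j * Complex.normSq (Z i j) := by
    rw [Finset.sum_comm, Matrix.trace, Complex.re_sum]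
    refine Finset.sum_congr rfl fun i _ => ?_
    rw [Matrix.diag_apply, Matrix.mul_diagonal, Matrix.mul_apply, Finset.sum_mul, Complex.re_sum]
    refine Finset.sum_congr rfl fun j _ => ?_
    rw [Matrix.conjTranspose_apply, Complex.star_def, ← Complex.normSq_eq_conj_mul_self,
      ← Complex.ofReal_mul, Complex.ofReal_re, mul_comm]
  rw [t1, t2, t3]
  simp only [Finset.mul_sum, ← Finset.sum_sub_distrib]
  refine Finset.sum_congr rfl fun i _ => Finset.sum_congr rfl fun j _ => ?_
  ring

theorem two_mul_re_sub_le {w : ℝ} (hw : 0 < w) (a x : ℂ) :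
    2 * (a * star x).re - w * Complex.normSq x ≤ 1 / w * Complex.normSq a := by
  simp only [Complex.normSq_apply, Complex.mul_re, Complex.star_def, Complex.conj_re,
    Complex.conj_im]
  rw [one_div, inv_mul_eq_div, le_div_iff₀ hw]
  nlinarith [sq_nonneg (a.re - w * x.re), sq_nonneg (a.im - w * x.im)]

theorem resolventFunctional_le {n : ℕ} {U : Mat n} (h1 : star U * U = 1) (h2 : U * star U = 1)
    {t : ℝ} (ht : 0 ≤ t) {l : Fin n → ℝ} (hl : ∀ i, 0 < l i) (A X : Mat n) :
    resolventFunctional t (U * rdiag l * star U) A X ≤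
      ∑ i, ∑ j, 1 / (l i + t * l j) * Complex.normSq ((star U * A * U) i j) := by
  rw [resolventFunctional_eq_sum h1 h2]
  refine Finset.sum_le_sum fun i _ => Finset.sum_le_sum fun j _ => two_mul_re_sub_le ?_ _ _
  have := mul_nonneg ht (hl j).le
  linarith [hl i]

theorem exists_resolventFunctional_eq {n : ℕ} {U : Mat n} (h1 : star U * U = 1)
    (h2 : U * star U = 1) {t : ℝ} (ht : 0 ≤ t) {l : Fin n → ℝ} (hl : ∀ i, 0 < l i) (A : Mat n) :
    ∃ X, resolventFunctional t (U * rdiag l * star U) A X =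
      ∑ i, ∑ j, 1 / (l i + t * l j) * Complex.normSq ((star U * A * U) i j) := by
  -- The maximizer of each scalar problem 2 Re(a x̄) − w|x|² is x = a/w.
  refine ⟨U * (Matrix.of fun i j => ((1 / (l i + t * l j) : ℝ) : ℂ) * (star U * A * U) i j) *
    star U, ?_⟩
  rw [resolventFunctional_eq_sum h1 h2]
  have e : ∀ M : Mat n, star U * (U * M * star U) * U = M := by
    intro M
    calc _ = (star U * U) * M * (star U * U) := by noncomm_ring
      _ = M := by rw [h1]; simp
  rw [e]
  refine Finset.sum_congr rfl fun i _ => Finset.sum_congr rfl fun j _ => ?_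
  have hw : 0 < l i + t * l j := by
    have := mul_nonneg ht (hl j).le
    linarith [hl i]
  rw [Matrix.of_apply]
  generalize (star U * A * U) i j = a
  simp only [Complex.normSq_apply, Complex.mul_re, Complex.mul_im, Complex.star_def,
    Complex.conj_re, Complex.conj_im, Complex.ofReal_re, Complex.ofReal_im]
  field_simp
  ring

/-- Kernels whose quadratic forms contract under stochastic mappings. -/
def IsMonotoneKernel (c : ℝ → ℝ → ℝ) : Prop :=
  ∀ (n m : ℕ) (T : Mat n →ₗ[ℂ] Mat m), IsStochastic T → ∀ (U : Mat n) (l : Fin n → ℝ)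
    (V : Mat m) (k : Fin m → ℝ), star U * U = 1 → U * star U = 1 → star V * V = 1 →
    V * star V = 1 → (∀ i, 0 < l i) → (∀ i, 0 < k i) →
    T (U * rdiag l * star U) = V * rdiag k * star V → ∀ A : Mat n, A.IsHermitian →
    ∑ i, ∑ j, c (k i) (k j) * Complex.normSq ((star V * T A * V) i j) ≤
      ∑ i, ∑ j, c (l i) (l j) * Complex.normSq ((star U * A * U) i j)

/-- Take the optimal Y for T(A) and test the functional at D and A with T*(Y). The linear term is
unchanged by adjointness, and the two quadratic terms can only shrink, by the Schwarz inequality for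
Y and for Y*. So the maximum before applying T dominates the one after. -/
theorem isMonotoneKernel_resolvent {t : ℝ} (ht : 0 ≤ t) :
    IsMonotoneKernel fun x y => 1 / (x + t * y) := by
  intro n m T hT U l V k hU hU' hV hV' hl hk hTD A hA
  obtain ⟨Y, hY⟩ := exists_resolventFunctional_eq hV hV' ht hk (T A)
  rw [← hY]
  refine le_trans ?_ (resolventFunctional_le hU hU' ht hl A (traceAdjoint T Y))
  have hps : (U * rdiag l * star U).PosSemidef := (posDef_unitary_rdiag hU hU' hl).posSemidef
  have s1 := hT.schwarz hps Y
  have s2 := hT.schwarz hps Y.conjTranspose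
  rw [traceAdjoint_conjTranspose hT, Matrix.conjTranspose_conjTranspose,
    Matrix.conjTranspose_conjTranspose] at s2
  have s3 : (A * (traceAdjoint T Y).conjTranspose).trace = (T A * Y.conjTranspose).trace := by
    rw [← traceAdjoint_conjTranspose hT, Matrix.trace_mul_comm, trace_traceAdjoint_mul,
      Matrix.trace_mul_comm]
  rw [resolventFunctional, resolventFunctional, s3, ← hTD]
  have := mul_le_mul_of_nonneg_left s2 ht
  linarith

/-- For Hermitian A the entries at (i,j) and (j,i) have equal modulus, so the quadratic form does
not see the order of the arguments. -/
theorem IsMonotoneKernel.swap {c : ℝ → ℝ → ℝ} (hc : IsMonotoneKernel c) :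
    IsMonotoneKernel fun x y => c y x := by
  intro n m T hT U l V k hU hU' hV hV' hl hk hTD A hA
  have key : ∀ {r : ℕ} (B : Mat r) (u : Fin r → ℝ), B.IsHermitian →
      ∑ i, ∑ j, c (u j) (u i) * Complex.normSq (B i j) =
        ∑ i, ∑ j, c (u i) (u j) * Complex.normSq (B i j) := by
    intro r B u hB
    rw [Finset.sum_comm]
    refine Finset.sum_congr rfl fun i _ => Finset.sum_congr rfl fun j _ => ?_
    rw [← hB.apply i j, Complex.star_def, Complex.normSq_conj]
  rw [key _ _ (conj_isHermitian' V (hT.map_isHermitian hA)), key _ _ (conj_isHermitian' U hA)]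
  exact hc n m T hT U l V k hU hU' hV hV' hl hk hTD A hA

theorem IsMonotoneKernel.add {c d : ℝ → ℝ → ℝ} (hc : IsMonotoneKernel c)
    (hd : IsMonotoneKernel d) : IsMonotoneKernel fun x y => c x y + d x y := by
  intro n m T hT U l V k hU hU' hV hV' hl hk hTD A hA
  simp only [add_mul, Finset.sum_add_distrib]
  exact add_le_add (hc n m T hT U l V k hU hU' hV hV' hl hk hTD A hA)
    (hd n m T hT U l V k hU hU' hV hV' hl hk hTD A hA)

theorem IsMonotoneKernel.const_mul {c : ℝ → ℝ → ℝ} (hc : IsMonotoneKernel c) {r : ℝ}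
    (hr : 0 ≤ r) : IsMonotoneKernel fun x y => r * c x y := by
  intro n m T hT U l V k hU hU' hV hV' hl hk hTD A hA
  have h := mul_le_mul_of_nonneg_left (hc n m T hT U l V k hU hU' hV hV' hl hk hTD A hA) hr
  simp only [Finset.mul_sum, ← mul_assoc r] at h
  exact h

theorem IsMonotoneKernel.congr {c d : ℝ → ℝ → ℝ} (hc : IsMonotoneKernel c)
    (h : ∀ x y, 0 < x → 0 < y → c x y = d x y) : IsMonotoneKernel d := by
  intro n m T hT U l V k hU hU' hV hV' hl hk hTD A hA
  simp only [← h _ _ (hk _) (hk _), ← h _ _ (hl _) (hl _)]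
  exact hc n m T hT U l V k hU hU' hV hV' hl hk hTD A hA

theorem isMonotoneKernel_of_tendsto {F : Filter ℝ} [F.NeBot] {c : ℝ → ℝ → ℝ → ℝ}
    {d : ℝ → ℝ → ℝ} (hc : ∀ᶠ p in F, IsMonotoneKernel (c p))
    (h : ∀ x y, 0 < x → 0 < y → Tendsto (fun p => c p x y) F (𝓝 (d x y))) :
    IsMonotoneKernel d := by
  intro n m T hT U l V k hU hU' hV hV' hl hk hTD A hA
  have hlim : ∀ {r : ℕ} (B : Mat r) (u : Fin r → ℝ), (∀ i, 0 < u i) →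
      Tendsto (fun p => ∑ i, ∑ j, c p (u i) (u j) * Complex.normSq (B i j)) F
        (𝓝 (∑ i, ∑ j, d (u i) (u j) * Complex.normSq (B i j))) := fun B u hu =>
    tendsto_finsetSum _ fun i _ => tendsto_finsetSum _ fun j _ =>
      (h _ _ (hu i) (hu j)).mul_const _
  refine le_of_tendsto_of_tendsto (hlim _ k hk) (hlim _ l hl) ?_
  filter_upwards [hc] with p hp
  exact hp n m T hT U l V k hU hU' hV hV' hl hk hTD A hA

open MeasureTheory in
theorem isMonotoneKernel_integral {μ : Measure ℝ} {c : ℝ → ℝ → ℝ → ℝ}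
    (hc : ∀ᵐ t ∂μ, IsMonotoneKernel (c t))
    (hint : ∀ x y, 0 < x → 0 < y → Integrable (fun t => c t x y) μ) :
    IsMonotoneKernel fun x y => ∫ t, c t x y ∂μ := by
  intro n m T hT U l V k hU hU' hV hV' hl hk hTD A hA
  have hI : ∀ {r : ℕ} (B : Mat r) (u : Fin r → ℝ), (∀ i, 0 < u i) →
      Integrable (fun t => ∑ i, ∑ j, c t (u i) (u j) * Complex.normSq (B i j)) μ :=
    fun B u hu => integrable_finsetSum _ fun i _ => integrable_finsetSum _ fun j _ =>
      (hint _ _ (hu i) (hu j)).mul_const _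
  have hE : ∀ {r : ℕ} (B : Mat r) (u : Fin r → ℝ), (∀ i, 0 < u i) →
      ∑ i, ∑ j, (∫ t, c t (u i) (u j) ∂μ) * Complex.normSq (B i j) =
        ∫ t, ∑ i, ∑ j, c t (u i) (u j) * Complex.normSq (B i j) ∂μ := by
    intro r B u hu
    rw [integral_finsetSum _ fun i _ => integrable_finsetSum _ fun j _ =>
      (hint _ _ (hu i) (hu j)).mul_const _]
    refine Finset.sum_congr rfl fun i _ => ?_
    rw [integral_finsetSum _ fun j _ => (hint _ _ (hu i) (hu j)).mul_const _]
    refine Finset.sum_congr rfl fun j _ => ?_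
    rw [integral_mul_const]
  rw [hE _ k hk, hE _ l hl]
  refine integral_mono_ae (hI _ k hk) (hI _ l hl) ?_
  filter_upwards [hc] with t ht
  exact ht n m T hT U l V k hU hU' hV hV' hl hk hTD A hA

end Kernels

end WYD
end

/-! ### Integral representations of the α-kernels -/

noncomputable section
namespace WYD

open Filter Topology MeasureTheory

/-- The symmetrized resolvent kernel. -/
def resolventKernel (t x y : ℝ) : ℝ := 1 / (x + t * y) + 1 / (y + t * x)

theorem isMonotoneKernel_resolventKernel {t : ℝ} (ht : 0 ≤ t) :
    IsMonotoneKernel (resolventKernel t) :=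
  (isMonotoneKernel_resolvent ht).add (isMonotoneKernel_resolvent ht).swap

theorem resolventKernel_pos {t x y : ℝ} (ht : 0 < t) (hx : 0 < x) (hy : 0 < y) :
    0 < resolventKernel t x y := by
  rw [resolventKernel]; positivity

/-- A kernel which off the diagonal is a positive superposition of resolvent kernels, and is
continuous at the diagonal, is monotone. -/
theorem isMonotoneKernel_of_weight {ν : Measure ℝ} {w : ℝ → ℝ} (hw : Measurable w)
    (hw0 : ∀ᵐ t ∂ν, 0 < t ∧ 0 ≤ w t) {c : ℝ → ℝ → ℝ}
    (hne : ∀ x y, 0 < x → 0 < y → x ≠ y → Integrable (fun t => w t * resolventKernel t x y) ν ∧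
      c x y = ∫ t, w t * resolventKernel t x y ∂ν)
    (hcont : ∀ x, 0 < x → ContinuousAt (c x) x) : IsMonotoneKernel c := by
  have hmeas : ∀ x y, AEStronglyMeasurable (fun t => w t * resolventKernel t x y) ν := by
    intro x y
    unfold resolventKernel
    exact (by fun_prop : Measurable _).aestronglyMeasurable
  -- Resolvent kernels decrease in each argument, so the off-diagonal point (x, x/2) dominates all
  -- (x, y) with y ≥ x/2. This gives integrability at y = x and lets the representation pass to the
  -- diagonal by dominated convergence.
  have hbound : ∀ x y, 0 < x → x / 2 ≤ y → ∀ᵐ t ∂ν, ‖w t * resolventKernel t x y‖ ≤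
      w t * resolventKernel t x (x / 2) := by
    intro x y hx hy
    filter_upwards [hw0] with t ht
    have hy0 : 0 < y := by linarith
    have ht0 := ht.1
    rw [Real.norm_of_nonneg (mul_nonneg ht.2 (resolventKernel_pos ht.1 hx hy0).le)]
    refine mul_le_mul_of_nonneg_left ?_ ht.2
    unfold resolventKernel
    gcongr
  have hhalf : ∀ x, 0 < x → Integrable (fun t => w t * resolventKernel t x (x / 2)) ν :=
    fun x hx => (hne x (x / 2) hx (by linarith) (by linarith)).1
  have hdiag : ∀ x, 0 < x → Integrable (fun t => w t * resolventKernel t x x) ν := fun x hx =>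
    (hhalf x hx).mono' (hmeas x x) (hbound x x hx (by linarith))
  have hdiag' : ∀ x, 0 < x → c x x = ∫ t, w t * resolventKernel t x x ∂ν := by
    intro x hx
    have h1 : ContinuousAt (fun y => ∫ t, w t * resolventKernel t x y ∂ν) x := by
      refine continuousAt_of_dominated (bound := fun t => w t * resolventKernel t x (x / 2))
        (Eventually.of_forall fun y => hmeas x y) ?_ (hhalf x hx) ?_
      · filter_upwards [eventually_ge_nhds (show x / 2 < x by linarith)] with y hy
        exact hbound x y hx hy
      · filter_upwards [hw0] with t ht
        have ht0 := ht.1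
        unfold resolventKernel
        have e1 : x + t * x ≠ 0 := by positivity
        fun_prop (disch := assumption)
    have h2 : (fun y => ∫ t, w t * resolventKernel t x y ∂ν) =ᶠ[𝓝[≠] x] c x := by
      filter_upwards [self_mem_nhdsWithin,
        mem_nhdsWithin_of_mem_nhds (eventually_gt_nhds hx)] with y hy hy0
      exact (hne x y hx hy0 (Ne.symm hy)).2.symm
    exact tendsto_nhds_unique ((hcont x hx).tendsto.mono_left nhdsWithin_le_nhds)
      ((h1.tendsto.mono_left nhdsWithin_le_nhds).congr' h2)
  refine (isMonotoneKernel_integral (μ := ν) (c := fun t x y => w t * resolventKernel t x y)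
    ?_ ?_).congr ?_
  · filter_upwards [hw0] with t ht
    exact (isMonotoneKernel_resolventKernel ht.1.le).const_mul ht.2
  · intro x y hx hy
    rcases eq_or_ne x y with rfl | h
    · exact hdiag x hx
    · exact (hne x y hx hy h).1
  · intro x y hx hy
    rcases eq_or_ne x y with rfl | h
    · exact (hdiag' x hx).symm
    · exact (hne x y hx hy h).2.symm

theorem continuousAt_wydKernel (p : ℝ) {x : ℝ} (hx : 0 < x) :
    ContinuousAt (wydKernel p x) x := by
  have h : ∀ q, ContinuousAt (dslope (pw q) x) x := fun q =>
    continuousAt_dslope_same.mpr (hasDerivAt_pw q hx).differentiableAt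
  exact (h p).mul (h (1 - p))

-- The numerator (x^p − y^p)(x^(1-p) − y^(1-p)) equals (x+y)·1^p − y(x/y)^p − x(y/x)^p. Inserting
-- the integral representation of the p-th power at 1, x/y and y/x, the integrands combine to (x−y)²
-- times a positive weight times the symmetrized resolvent.
open Real in
theorem isMonotoneKernel_wydKernel_of_lt_one {p : ℝ} (hp : p ∈ Set.Ioo (0 : ℝ) 1) :
    IsMonotoneKernel (wydKernel p) := by
  obtain ⟨μ, hμ⟩ := exists_measure_rpow_eq_integral_rpowIntegrand₀₁ hp
  have hp0 : p ≠ 0 := hp.1.ne'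
  have hp1 : 1 - p ≠ 0 := sub_ne_zero.mpr hp.2.ne'
  have hc : 0 < p * (1 - p) := mul_pos hp.1 (sub_pos.mpr hp.2)
  refine isMonotoneKernel_of_weight (ν := μ.restrict (Set.Ioi 0))
    (w := fun t => 1 / (p * (1 - p)) * (t ^ (p - 1) * (t / (1 + t) ^ 2))) (by fun_prop) ?_ ?_
    fun x hx => continuousAt_wydKernel p hx
  · refine ae_restrict_of_forall_mem measurableSet_Ioi fun t ht => ⟨ht, ?_⟩
    have ht0 : (0 : ℝ) < t := ht
    positivity
  · intro x y hx hy hxy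
    have hd : x - y ≠ 0 := sub_ne_zero.mpr hxy
    obtain ⟨i1, e1⟩ := hμ 1 (by simp)
    obtain ⟨i2, e2⟩ := hμ (x / y) (by simp; positivity)
    obtain ⟨i3, e3⟩ := hμ (y / x) (by simp; positivity)
    have hfun : Set.EqOn (fun t => 1 / (p * (1 - p) * (x - y) ^ 2) *
          ((x + y) * rpowIntegrand₀₁ p t 1 - y * rpowIntegrand₀₁ p t (x / y) -
            x * rpowIntegrand₀₁ p t (y / x)))
        (fun t => 1 / (p * (1 - p)) * (t ^ (p - 1) * (t / (1 + t) ^ 2)) * resolventKernel t x y)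
        (Set.Ioi 0) := by
      intro t ht
      have ht0 : (0 : ℝ) < t := ht
      simp only
      rw [rpowIntegrand₀₁_eq_pow_div hp ht0.le zero_le_one,
        rpowIntegrand₀₁_eq_pow_div hp ht0.le (by positivity),
        rpowIntegrand₀₁_eq_pow_div hp ht0.le (by positivity), resolventKernel]
      have e4 : t + x / y = (x + t * y) / y := by field_simp; ring
      have e5 : t + y / x = (y + t * x) / x := by field_simp; ring
      rw [e4, e5, add_comm t 1]
      field_simp
      ring
    have hJ : IntegrableOn (fun t => (x + y) * rpowIntegrand₀₁ p t 1 -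
        y * rpowIntegrand₀₁ p t (x / y)) (Set.Ioi 0) μ := (i1.const_mul (x + y)).sub (i2.const_mul y)
    have hI := (((i1.const_mul (x + y)).sub (i2.const_mul y)).sub (i3.const_mul x)).const_mul
      (1 / (p * (1 - p) * (x - y) ^ 2))
    refine ⟨(integrableOn_congr_fun hfun measurableSet_Ioi).mp hI, ?_⟩
    rw [← setIntegral_congr_fun measurableSet_Ioi hfun, integral_const_mul,
      integral_sub hJ (i3.const_mul x),
      integral_sub (i1.const_mul (x + y)) (i2.const_mul y), integral_const_mul, integral_const_mul,
      integral_const_mul, ← e1, ← e2, ← e3, wydKernel_of_ne p hxy.symm, pw_of_ne hp0,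
      pw_of_ne hp1, Real.one_rpow, Real.div_rpow hx.le hy.le, Real.div_rpow hy.le hx.le]
    beta_reduce
    rw [Real.rpow_sub hx, Real.rpow_sub hy, Real.rpow_one, Real.rpow_one]
    have ha : 0 < x ^ p := Real.rpow_pos_of_pos hx p
    have hb : 0 < y ^ p := Real.rpow_pos_of_pos hy p
    field_simp
    ring

-- With p = q + 1 the numerator is (x+y)·1^q − x(x/y)^q − y(y/x)^q. Here x and y are attached to the
-- opposite quotients, which reverses the sign of the combination; the negative constant p(1−p) =
-- −(q+1)q reverses it back. The weight gains a factor t over the case of exponent q.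
open Real in
theorem isMonotoneKernel_wydKernel_of_one_lt {p : ℝ} (hp : p ∈ Set.Ioo (1 : ℝ) 2) :
    IsMonotoneKernel (wydKernel p) := by
  obtain ⟨q, rfl⟩ : ∃ q, p = q + 1 := ⟨p - 1, by ring⟩
  have hq : q ∈ Set.Ioo (0 : ℝ) 1 := ⟨by linarith [hp.1], by linarith [hp.2]⟩
  obtain ⟨μ, hμ⟩ := exists_measure_rpow_eq_integral_rpowIntegrand₀₁ hq
  have hq0 : q ≠ 0 := hq.1.ne'
  have hqp := hq.1
  refine isMonotoneKernel_of_weight (ν := μ.restrict (Set.Ioi 0))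
    (w := fun t => 1 / ((q + 1) * q) * (t ^ (q - 1) * (t ^ 2 / (1 + t) ^ 2))) (by fun_prop) ?_ ?_
    fun x hx => continuousAt_wydKernel (q + 1) hx
  · refine ae_restrict_of_forall_mem measurableSet_Ioi fun t ht => ⟨ht, ?_⟩
    have ht0 : (0 : ℝ) < t := ht
    positivity
  · intro x y hx hy hxy
    have hd : x - y ≠ 0 := sub_ne_zero.mpr hxy
    obtain ⟨i1, e1⟩ := hμ 1 (by simp)
    obtain ⟨i2, e2⟩ := hμ (x / y) (by simp; positivity)
    obtain ⟨i3, e3⟩ := hμ (y / x) (by simp; positivity)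
    have hfun : Set.EqOn (fun t => 1 / ((q + 1) * q * (x - y) ^ 2) *
          (x * rpowIntegrand₀₁ q t (x / y) + y * rpowIntegrand₀₁ q t (y / x) -
            (x + y) * rpowIntegrand₀₁ q t 1))
        (fun t => 1 / ((q + 1) * q) * (t ^ (q - 1) * (t ^ 2 / (1 + t) ^ 2)) *
          resolventKernel t x y) (Set.Ioi 0) := by
      intro t ht
      have ht0 : (0 : ℝ) < t := ht
      simp only
      rw [rpowIntegrand₀₁_eq_pow_div hq ht0.le zero_le_one,
        rpowIntegrand₀₁_eq_pow_div hq ht0.le (by positivity),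
        rpowIntegrand₀₁_eq_pow_div hq ht0.le (by positivity), resolventKernel]
      have e4 : t + x / y = (x + t * y) / y := by field_simp; ring
      have e5 : t + y / x = (y + t * x) / x := by field_simp; ring
      rw [e4, e5, add_comm t 1]
      field_simp
      ring
    have hJ : IntegrableOn (fun t => x * rpowIntegrand₀₁ q t (x / y) +
        y * rpowIntegrand₀₁ q t (y / x)) (Set.Ioi 0) μ := (i2.const_mul x).add (i3.const_mul y)
    have hI := (((i2.const_mul x).add (i3.const_mul y)).sub (i1.const_mul (x + y))).const_mul
      (1 / ((q + 1) * q * (x - y) ^ 2))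
    refine ⟨(integrableOn_congr_fun hfun measurableSet_Ioi).mp hI, ?_⟩
    rw [← setIntegral_congr_fun measurableSet_Ioi hfun, integral_const_mul,
      integral_sub hJ (i1.const_mul (x + y)),
      integral_add (i2.const_mul x) (i3.const_mul y), integral_const_mul, integral_const_mul,
      integral_const_mul, ← e1, ← e2, ← e3, wydKernel_of_ne _ hxy.symm,
      pw_of_ne (by linarith : q + 1 ≠ 0), show 1 - (q + 1) = -q by ring,
      pw_of_ne (neg_ne_zero.mpr hq0), Real.one_rpow, Real.div_rpow hx.le hy.le,
      Real.div_rpow hy.le hx.le]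
    beta_reduce
    rw [Real.rpow_add hx, Real.rpow_add hy, Real.rpow_one, Real.rpow_one,
      Real.rpow_neg hx.le, Real.rpow_neg hy.le]
    have ha : 0 < x ^ q := Real.rpow_pos_of_pos hx q
    have hb : 0 < y ^ q := Real.rpow_pos_of_pos hy q
    field_simp
    ring

/-- At the endpoint the kernel is (1/x + 1/y)/2, half of the symmetrized resolvent at t = 0. -/
theorem isMonotoneKernel_wydKernel_two : IsMonotoneKernel (wydKernel 2) := by
  refine (((isMonotoneKernel_resolvent le_rfl).add (isMonotoneKernel_resolvent le_rfl).swap).const_mul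
    (r := 1 / 2) (by norm_num)).congr fun x y hx hy => ?_
  rcases eq_or_ne y x with rfl | h
  · rw [wydKernel_self 2 hx]
    field_simp
    norm_num
  · have hd : x - y ≠ 0 := sub_ne_zero.mpr h.symm
    rw [wydKernel_of_ne 2 h, pw_of_ne two_ne_zero, show (1 : ℝ) - 2 = -1 by norm_num,
      pw_of_ne (by norm_num)]
    simp only [Real.rpow_neg_one, Real.rpow_two]
    field_simp
    ring

/-- Let p increase to 1: the difference quotient (x^(1-p) − y^(1-p))/(1−p) tends to log x − log y.
-/
theorem isMonotoneKernel_wydKernel_one : IsMonotoneKernel (wydKernel 1) := by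
  refine isMonotoneKernel_of_tendsto (F := 𝓝[<] (1 : ℝ)) (c := wydKernel) ?_ ?_
  · filter_upwards [Ioo_mem_nhdsLT (show (0 : ℝ) < 1 by norm_num)] with p hp
    exact isMonotoneKernel_wydKernel_of_lt_one hp
  · intro x y hx hy
    rcases eq_or_ne y x with rfl | h
    · simp only [wydKernel_self _ hx]
      exact tendsto_const_nhds
    · simp only [wydKernel_of_ne _ h]
      refine Tendsto.div_const (Tendsto.mul ?_ ?_) _
      · rw [pw_of_ne one_ne_zero]
        have hev : (fun p : ℝ => x ^ p / p - y ^ p / p) =ᶠ[𝓝[<] 1] fun p => pw p x - pw p y := by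
          filter_upwards [Ioo_mem_nhdsLT (show (0 : ℝ) < 1 by norm_num)] with p hp
          rw [pw_of_ne hp.1.ne']
        refine Tendsto.congr' hev (Tendsto.mono_left ?_ nhdsWithin_le_nhds)
        have : ∀ z : ℝ, 0 < z → ContinuousAt (fun p : ℝ => z ^ p / p) 1 := fun z hz =>
          (Real.continuousAt_const_rpow hz.ne').div continuousAt_id one_ne_zero
        exact ((this x hx).sub (this y hy)).tendsto
      · have hd : HasDerivAt (fun e : ℝ => x ^ e - y ^ e) (Real.log x - Real.log y) 0 := by
          have : ∀ z : ℝ, 0 < z → HasDerivAt (fun e : ℝ => z ^ e) (Real.log z) 0 := fun z hz => by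
            simpa using Real.hasStrictDerivAt_const_rpow hz 0 |>.hasDerivAt
          exact (this x hx).sub (this y hy)
        have ht := hasDerivAt_iff_tendsto_slope_zero.mp hd
        have hm : Tendsto (fun p : ℝ => 1 - p) (𝓝[<] 1) (𝓝[≠] 0) := by
          refine tendsto_nhdsWithin_of_tendsto_nhds_of_eventually_within _ ?_ ?_
          · have : ContinuousAt (fun p : ℝ => 1 - p) 1 := by fun_prop
            simpa using this.tendsto.mono_left nhdsWithin_le_nhds
          · filter_upwards [self_mem_nhdsWithin] with p hp
            exact sub_ne_zero.mpr (ne_of_gt hp)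
        have := ht.comp hm
        rw [sub_self, pw_zero]
        refine Tendsto.congr' ?_ this
        filter_upwards [self_mem_nhdsWithin] with p hp
        have hp' : 1 - p ≠ 0 := sub_ne_zero.mpr (ne_of_gt hp)
        simp only [Function.comp, pw_of_ne hp', zero_add, Real.rpow_zero, smul_eq_mul]
        field_simp
        ring

theorem isMonotoneKernel_wydKernel {p : ℝ} (hp : p ∈ Set.Icc (-1 : ℝ) 2) :
    IsMonotoneKernel (wydKernel p) := by
  have key : ∀ q : ℝ, 0 < q → q ≤ 2 → IsMonotoneKernel (wydKernel q) := by
    intro q h0 h2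
    rcases lt_trichotomy q 1 with h | rfl | h
    · exact isMonotoneKernel_wydKernel_of_lt_one ⟨h0, h⟩
    · exact isMonotoneKernel_wydKernel_one
    · rcases h2.eq_or_lt with rfl | h2
      · exact isMonotoneKernel_wydKernel_two
      · exact isMonotoneKernel_wydKernel_of_one_lt ⟨h, h2⟩
  rcases lt_or_ge 0 p with h | h
  · exact key p h hp.2
  · exact (key (1 - p) (by linarith) (by linarith [hp.1])).congr fun x y _ _ =>
      wydKernel_one_sub p x y

/-- The `α`-metrics with `α = 2 * p - 1`, `p ∈ [-1, 2]`, contract under stochastic mappings. -/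
theorem alphaMetric_monotone {p : ℝ} (hp : p ∈ Set.Icc (-1 : ℝ) 2) {n m : ℕ}
    {T : Mat n →ₗ[ℂ] Mat m} (hT : IsStochastic T) {D : Mat n} (hD : D ∈ States n)
    (hTD : T D ∈ States m) {A : Mat n} (hA : A ∈ Tangent n) :
    alphaMetric (2 * p - 1) m (T D) (T A) (T A) ≤ alphaMetric (2 * p - 1) n D A A := by
  obtain ⟨U, l, hU, hU', hl, -, rfl⟩ := exists_unitary_of_mem_states hD
  obtain ⟨V, k, hV, hV', hk, -, h⟩ := exists_unitary_of_mem_states hTD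
  rw [h, alphaMetric_self_eq_sum p hV hV' hk (hT.map_isHermitian hA.1),
    alphaMetric_self_eq_sum p hU hU' hl hA.1]
  exact isMonotoneKernel_wydKernel hp n m T hT U l V k hU hU' hV hV' hl hk h A hA.1

end WYD
end

/-! ### Smooth dependence on the state, and the α-metrics as monotone metrics -/

noncomputable section
namespace WYD

open Filter Topology

section Smoothness

variable {n : ℕ}

theorem cfc_exp_eq {X : Mat n} (hX : X.IsHermitian) : cfc Real.exp X = NormedSpace.exp X := by
  open scoped Matrix.Norms.L2Operator in
  exact CFC.real_exp_eq_normedSpace_exp (A := Mat n) hX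

theorem cfcDeriv_add (U : Mat n) (l : Fin n → ℝ) (g : ℝ → ℝ) (A B : Mat n) :
    cfcDeriv U l g (A + B) = cfcDeriv U l g A + cfcDeriv U l g B := by
  rw [cfcDeriv, cfcDeriv, cfcDeriv, ← add_mul, ← mul_add]
  congr 2
  ext i j
  rw [Matrix.of_apply, Matrix.add_apply, Matrix.of_apply, Matrix.of_apply, mul_add (star U),
    add_mul, Matrix.add_apply, mul_add]

theorem cfcDeriv_smul (U : Mat n) (l : Fin n → ℝ) (g : ℝ → ℝ) (c : ℂ) (A : Mat n) :
    cfcDeriv U l g (c • A) = c • cfcDeriv U l g A := by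
  rw [cfcDeriv, cfcDeriv, ← smul_mul_assoc, ← mul_smul_comm]
  congr 2
  ext i j
  rw [Matrix.of_apply, Matrix.smul_apply, Matrix.of_apply, mul_smul_comm, smul_mul_assoc,
    Matrix.smul_apply, smul_eq_mul, smul_eq_mul]
  ring

theorem cfcDeriv_injective {U : Mat n} (h1 : star U * U = 1) (h2 : U * star U = 1)
    {l : Fin n → ℝ} {g : ℝ → ℝ} (hg : ∀ i j, dslope g (l i) (l j) ≠ 0) {A : Mat n}
    (hA : cfcDeriv U l g A = 0) : A = 0 := by
  have e : star U * cfcDeriv U l g A * U = 0 := by rw [hA]; simp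
  rw [cfcDeriv] at e
  set N : Mat n := Matrix.of fun i j => ((dslope g (l i) (l j) : ℝ) : ℂ) * (star U * A * U) i j
    with hN
  have e' : N = 0 := by
    calc N = (star U * U) * N * (star U * U) := by rw [h1]; simp
      _ = star U * (U * N * star U) * U := by noncomm_ring
      _ = 0 := e
  have e'' : star U * A * U = 0 := by
    ext i j
    have := congrFun (congrFun e' i) j
    rw [hN, Matrix.of_apply] at this
    exact (mul_eq_zero.mp this).resolve_left (by exact_mod_cast hg i j)
  calc A = (U * star U) * A * (U * star U) := by rw [h2]; simp
    _ = U * (star U * A * U) * star U := by noncomm_ring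
    _ = 0 := by rw [e'']; simp

theorem exists_isHermitian_add_smul (A : Mat n) :
    ∃ H₁ H₂ : Mat n, H₁.IsHermitian ∧ H₂.IsHermitian ∧ A = H₁ + Complex.I • H₂ := by
  refine ⟨(realPart A : Mat n), (imaginaryPart A : Mat n), (realPart A).2, (imaginaryPart A).2, ?_⟩
  exact (realPart_add_I_smul_imaginaryPart A).symm

theorem dslope_exp_ne_zero (x y : ℝ) : dslope Real.exp x y ≠ 0 := by
  rcases eq_or_ne y x with rfl | h
  · simp
  · rw [dslope_of_ne _ h, slope_def_field]
    exact div_ne_zero (sub_ne_zero.mpr fun h' => h (Real.exp_injective h')) (sub_ne_zero.mpr h)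

open scoped Matrix.Norms.L2Operator in
/-- The derivative of the matrix exponential at a selfadjoint matrix is injective. -/
theorem fderiv_exp_injective {X : Mat n} (hX : X.IsHermitian) :
    Function.Injective (fderiv ℂ (NormedSpace.exp : Mat n → Mat n) X) := by
  obtain ⟨U, l, h1, h2, rfl⟩ := exists_unitary_rdiag hX
  set X := U * rdiag l * star U with hXdef
  have hd : HasFDerivAt (𝕜 := ℂ) (NormedSpace.exp : Mat n → Mat n) (fderiv ℂ NormedSpace.exp X) X :=
    (NormedSpace.exp_analytic (𝕂 := ℂ) X).differentiableAt.hasFDerivAt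
  have herm : ∀ H : Mat n, H.IsHermitian →
      fderiv ℂ (NormedSpace.exp : Mat n → Mat n) X H = cfcDeriv U l Real.exp H := by
    intro H hH
    have h3 : HasDerivAt (fun t : ℝ => X + t • H) H 0 := by
      simpa using ((hasDerivAt_id (0 : ℝ)).smul_const H).const_add X
    have hd0 : HasFDerivAt (𝕜 := ℂ) (NormedSpace.exp : Mat n → Mat n)
        (fderiv ℂ NormedSpace.exp X) (X + (0 : ℝ) • H) := by simpa using hd
    have h4 := (hd0.restrictScalars ℝ).comp_hasDerivAt (0 : ℝ) h3
    have h5 := hasDerivAt_cfc_line h1 h2 l hH (g := Real.exp)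
      fun i => Real.differentiableAt_exp
    have h6 : (fun t : ℝ => cfc Real.exp (X + t • H)) =
        (NormedSpace.exp : Mat n → Mat n) ∘ fun t : ℝ => X + t • H := by
      ext1 t
      exact cfc_exp_eq (isHermitian_add_smul hX hH t)
    rw [← hXdef, h6] at h5
    exact h4.unique h5
  -- The Daleckii–Krein formula covers Hermitian directions only. Both sides are complex linear, the
  -- exponential being holomorphic, and Hermitian matrices span.
  have hall : ∀ A : Mat n,
      fderiv ℂ (NormedSpace.exp : Mat n → Mat n) X A = cfcDeriv U l Real.exp A := by
    intro A
    obtain ⟨H₁, H₂, hH₁, hH₂, rfl⟩ := exists_isHermitian_add_smul A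
    rw [map_add, map_smul, herm _ hH₁, herm _ hH₂, cfcDeriv_add, cfcDeriv_smul]
  rw [injective_iff_map_eq_zero]
  intro A hA
  rw [hall] at hA
  exact cfcDeriv_injective h1 h2 (fun i j => dslope_exp_ne_zero _ _) hA

theorem exp_unitary_rdiag {U : Mat n} (h1 : star U * U = 1) (h2 : U * star U = 1)
    (l : Fin n → ℝ) : NormedSpace.exp (U * rdiag l * star U) =
      U * rdiag (fun i => Real.exp (l i)) * star U := by
  rw [← cfc_exp_eq (conj_isHermitian U (rdiag_isHermitian l)), cfc_unitary_rdiag h1 h2]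

theorem smul_unitary_rdiag (U : Mat n) (l : Fin n → ℝ) (r : ℝ) :
    r • (U * rdiag l * star U) = U * rdiag (fun i => r * l i) * star U := by
  have : rdiag (fun i => r * l i) = r • rdiag l := by
    ext i j; rcases eq_or_ne i j with rfl | h <;> simp [*]
  rw [this, mul_smul_comm, smul_mul_assoc]

theorem cfc_pw_eq_exp {M : Mat n} (hM : M.PosDef) {p : ℝ} (hp : p ≠ 0) :
    cfc (pw p) M = (1 / p) • NormedSpace.exp (p • cfc Real.log M) := by
  obtain ⟨U, l, h1, h2, hl, rfl⟩ : ∃ (U : Mat n) (l : Fin n → ℝ), star U * U = 1 ∧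
      U * star U = 1 ∧ (∀ i, 0 < l i) ∧ M = U * rdiag l * star U :=
    ⟨hM.1.eigenvectorUnitary, hM.1.eigenvalues, Unitary.coe_star_mul_self _,
      Unitary.coe_mul_star_self _, hM.eigenvalues_pos, hM.1.spectral_theorem⟩
  rw [cfc_unitary_rdiag h1 h2, cfc_unitary_rdiag h1 h2, smul_unitary_rdiag,
    exp_unitary_rdiag h1 h2, smul_unitary_rdiag]
  congr 3
  funext i
  rw [pw_of_ne hp, mul_comm p, ← Real.rpow_def_of_pos (hl i)]
  simp only [div_eq_inv_mul, mul_one]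

theorem exp_cfc_log {M : Mat n} (hM : M.PosDef) : NormedSpace.exp (cfc Real.log M) = M := by
  have h := cfc_pw_eq_exp hM one_ne_zero
  rwa [pw_one, cfc_id_of_isHermitian hM.1, div_one, one_smul, one_smul, eq_comm] at h

theorem cfc_log_isHermitian (M : Mat n) : (cfc Real.log M).IsHermitian :=
  cfc_predicate Real.log M

open scoped Matrix.Norms.L2Operator in
theorem tendsto_cfc_log {D : Mat n} (hD : D.PosDef) :
    Tendsto (cfc Real.log : Mat n → Mat n) (𝓝[{M : Mat n | M.PosDef}] D) (𝓝 (cfc Real.log D)) := by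
  have hc := CFC.continuousOn_log (A := Mat n)
  exact ((hc D ⟨hD.1, hD.isUnit⟩).mono fun M hM => ⟨hM.1, hM.isUnit⟩).tendsto

open scoped Matrix.Norms.L2Operator in
/-- On positive definite matrices, the logarithm extends to a smooth function of all matrices. -/
theorem exists_contDiffAt_log {D : Mat n} (hD : D.PosDef) :
    ∃ Ψ : Mat n → Mat n, ContDiffAt ℝ ∞ Ψ D ∧
      ∀ᶠ M in 𝓝[{M : Mat n | M.PosDef}] D, cfc Real.log M = Ψ M := by
  set X := cfc Real.log D with hX
  have hXH : X.IsHermitian := cfc_log_isHermitian D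
  have hexp : NormedSpace.exp X = D := exp_cfc_log hD
  have han : AnalyticAt ℂ (NormedSpace.exp : Mat n → Mat n) X := NormedSpace.exp_analytic X
  have hcd : ContDiffAt ℂ ∞ (NormedSpace.exp : Mat n → Mat n) X := han.contDiffAt
  -- In finite dimension injectivity gives invertibility, so the inverse function theorem provides a
  -- local inverse of the exponential at log D. Continuity of the logarithm keeps log M in its
  -- source for M near D, hence log M is that inverse.
  set f' : Mat n ≃L[ℂ] Mat n := (LinearEquiv.ofInjectiveEndo
    (fderiv ℂ (NormedSpace.exp : Mat n → Mat n) X : Mat n →ₗ[ℂ] Mat n)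
    (fderiv_exp_injective hXH)).toContinuousLinearEquiv with hf'
  have hfd : HasFDerivAt (NormedSpace.exp : Mat n → Mat n) (f' : Mat n →L[ℂ] Mat n) X := by
    have h := han.differentiableAt.hasFDerivAt
    convert! h using 1
  have hne : (∞ : WithTop ℕ∞) ≠ 0 := by simp
  set e := hcd.toOpenPartialHomeomorph _ hfd hne
  have hsrc : X ∈ e.source := hcd.mem_toOpenPartialHomeomorph_source hfd hne
  refine ⟨e.symm, ?_, ?_⟩
  · have := hcd.to_localInverse hfd hne
    rw [hexp] at this
    exact this.restrict_scalars ℝ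
  · have h1 : ∀ᶠ M in 𝓝[{M : Mat n | M.PosDef}] D, cfc Real.log M ∈ e.source :=
      (tendsto_cfc_log hD).eventually (e.open_source.mem_nhds hsrc)
    filter_upwards [h1, self_mem_nhdsWithin] with M hM hMp
    have h2 := e.left_inv hM
    have h3 : e (cfc Real.log M) = M := exp_cfc_log hMp
    rw [h3] at h2
    exact h2.symm

open scoped Matrix.Norms.L2Operator in
theorem exists_contDiffAt_pw (p : ℝ) {D : Mat n} (hD : D.PosDef) :
    ∃ Ψ : Mat n → Mat n, ContDiffAt ℝ ∞ Ψ D ∧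
      ∀ᶠ M in 𝓝[{M : Mat n | M.PosDef}] D, cfc (pw p) M = Ψ M := by
  obtain ⟨Ψ, h1, h2⟩ := exists_contDiffAt_log hD
  rcases eq_or_ne p 0 with rfl | hp
  · rw [pw_zero]; exact ⟨Ψ, h1, h2⟩
  refine ⟨fun M => (1 / p) • NormedSpace.exp (p • Ψ M), ?_, ?_⟩
  · have hexp : ContDiffAt ℝ ∞ (NormedSpace.exp : Mat n → Mat n) (p • Ψ D) :=
      (NormedSpace.exp_analytic (𝕂 := ℝ) (p • Ψ D)).contDiffAt
    exact (hexp.comp D (h1.const_smul p)).const_smul (1 / p)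
  · filter_upwards [h2, self_mem_nhdsWithin] with M hM hMp
    rw [cfc_pw_eq_exp hMp hp, hM]

theorem eventually_posDef_line {D A : Mat n} (hD : D.PosDef) (hA : A.IsHermitian) :
    ∀ᶠ t : ℝ in 𝓝 0, (D + t • A).PosDef := by
  filter_upwards [eventually_spectrum_pos (A := A) hD] with t ht
  have hH := isHermitian_add_smul hD.1 hA t
  rw [hH.posDef_iff_eigenvalues_pos]
  intro i
  exact ht _ (hH.eigenvalues_mem_spectrum_real i)

-- The states do not form an open set of matrices, so the functional calculus is replaced near D by
-- smooth extensions Ψ₁, Ψ₂ to all matrices. On states near D the metric is then the real trace of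
-- the product of their derivatives in the directions A and B.
open scoped Matrix.Norms.L2Operator in
theorem alphaMetric_contDiffOn (p : ℝ) {A B : Mat n} (hA : A.IsHermitian) (hB : B.IsHermitian) :
    ContDiffOn ℝ ∞ (fun M : Fin n → Fin n → ℂ => alphaMetric (2 * p - 1) n (Matrix.of M) A B)
      {M | Matrix.of M ∈ States n} := by
  intro M₀ hM₀
  set D := Matrix.of M₀ with hD
  have hDs : D ∈ States n := hM₀
  obtain ⟨Ψ₁, hc₁, he₁⟩ := exists_contDiffAt_pw (1 - p) hDs.1
  obtain ⟨Ψ₂, hc₂, he₂⟩ := exists_contDiffAt_pw p hDs.1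
  set F : Mat n → ℝ := fun M => (fderiv ℝ Ψ₁ M A * fderiv ℝ Ψ₂ M B).trace.re with hF
  have hFc : ContDiffAt ℝ ∞ F D := by
    have h1 : ContDiffAt ℝ ∞ (fun M => fderiv ℝ Ψ₁ M A) D :=
      (hc₁.fderiv_right (m := ∞) (by simp)).clm_apply contDiffAt_const
    have h2 : ContDiffAt ℝ ∞ (fun M => fderiv ℝ Ψ₂ M B) D :=
      (hc₂.fderiv_right (m := ∞) (by simp)).clm_apply contDiffAt_const
    exact (LinearMap.toContinuousLinearMap
      ((Complex.reLm : ℂ →ₗ[ℝ] ℝ).comp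
        ((Matrix.traceLinearMap (Fin n) ℂ ℂ).restrictScalars ℝ))).contDiff.contDiffAt.comp D
      (h1.mul h2)
  have hline : ∀ (q : ℝ) (Ψ : Mat n → Mat n) (C : Mat n), C.IsHermitian → ContDiffAt ℝ ∞ Ψ D →
      (∀ᶠ M in 𝓝[{M : Mat n | M.PosDef}] D, cfc (pw q) M = Ψ M) →
      ∀ᶠ M in 𝓝 D, ∀ (U : Mat n) (l : Fin n → ℝ), star U * U = 1 → U * star U = 1 →
        (∀ i, 0 < l i) → M = U * rdiag l * star U →
        cfcDeriv U l (pw q) C = fderiv ℝ Ψ M C := by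
    intro q Ψ C hC hΨ hE
    have h1 : ∀ᶠ M in 𝓝 D, ContDiffAt ℝ 1 Ψ M := (hΨ.of_le (by simp)).eventually (by simp)
    have h2 := (eventually_nhdsWithin_iff.mp hE).eventually_nhds
    filter_upwards [h1, h2] with M hM hM' U l hU hU' hl hMU
    have hMp : M.PosDef := hMU ▸ posDef_unitary_rdiag hU hU' hl
    have h3 : HasDerivAt (fun t : ℝ => M + t • C) C 0 := by
      simpa using ((hasDerivAt_id (0 : ℝ)).smul_const C).const_add M
    have hd0 : HasFDerivAt Ψ (fderiv ℝ Ψ M) (M + (0 : ℝ) • C) := by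
      simpa using (hM.differentiableAt (by simp)).hasFDerivAt
    have h4 := hd0.comp_hasDerivAt (0 : ℝ) h3
    have h5 := hasDerivAt_cfc_line hU hU' l hC (g := pw q)
      fun i => (hasDerivAt_pw q (hl i)).differentiableAt
    rw [← hMU] at h5
    have ht : Tendsto (fun t : ℝ => M + t • C) (𝓝 0) (𝓝 M) := by
      simpa using h3.continuousAt.tendsto
    have h6 : (fun t : ℝ => cfc (pw q) (M + t • C)) =ᶠ[𝓝 0] Ψ ∘ fun t : ℝ => M + t • C := by
      filter_upwards [ht.eventually hM', eventually_posDef_line hMp hC] with t h7 h8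
      exact h7 h8
    exact (h5.congr_of_eventuallyEq h6.symm).unique h4
  have hL₁ := hline _ Ψ₁ A hA hc₁ he₁
  have hL₂ := hline _ Ψ₂ B hB hc₂ he₂
  have hof : ContDiff ℝ ∞ (fun M : Fin n → Fin n → ℂ => (Matrix.of M : Mat n)) :=
    (LinearMap.toContinuousLinearMap
      ((Matrix.ofLinearEquiv ℝ : (Fin n → Fin n → ℂ) ≃ₗ[ℝ] Mat n) :
        (Fin n → Fin n → ℂ) →ₗ[ℝ] Mat n)).contDiff
  have hcomp : ContDiffAt ℝ ∞ (fun M : Fin n → Fin n → ℂ => F (Matrix.of M)) M₀ :=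
    ContDiffAt.comp M₀ (g := F) hFc hof.contDiffAt
  refine hcomp.contDiffWithinAt.congr_of_eventuallyEq_of_mem ?_ hM₀
  have hev := hof.continuous.continuousAt.tendsto.eventually (hL₁.and hL₂)
  filter_upwards [mem_nhdsWithin_of_mem_nhds hev, self_mem_nhdsWithin] with M hM hMs
  obtain ⟨U, l, hU, hU', hl, -, hMU⟩ := exists_unitary_of_mem_states hMs
  rw [hF]
  beta_reduce
  rw [← hM.1 U l hU hU' hl hMU, ← hM.2 U l hU hU' hl hMU, hMU,
    alphaMetric_eq_trace p hU hU' hl hA hB]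

end Smoothness

section AlphaMetric

variable {n : ℕ}

theorem rdiag_apply_self (l : Fin n → ℝ) (i : Fin n) : (rdiag l : Mat n) i i = l i :=
  Matrix.diagonal_apply_eq _ _

theorem rdiag_apply_ne (l : Fin n → ℝ) {i j : Fin n} (h : i ≠ j) : (rdiag l : Mat n) i j = 0 :=
  Matrix.diagonal_apply_ne _ h

theorem add_mem_tangent {A B : Mat n} (hA : A ∈ Tangent n) (hB : B ∈ Tangent n) :
    A + B ∈ Tangent n :=
  ⟨IsSelfAdjoint.add hA.1 hB.1, by rw [Matrix.trace_add, hA.2, hB.2, add_zero]⟩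

theorem smul_mem_tangent {A : Mat n} (hA : A ∈ Tangent n) (r : ℝ) : r • A ∈ Tangent n :=
  ⟨IsSelfAdjoint.smul (IsSelfAdjoint.all r) hA.1, by rw [Matrix.trace_smul, hA.2, smul_zero]⟩

/-- The `α`-metric with `α = 2 * p - 1`, `p ∈ [-1, 2]`, is a Fisher-adjusted symmetric monotone
metric. -/
theorem isSymmetricMonotoneMetric_alphaMetric {p : ℝ} (hp : p ∈ Set.Icc (-1 : ℝ) 2) :
    IsSymmetricMonotoneMetric (alphaMetric (2 * p - 1)) where
  add_left n D hD A hA A' hA' B hB := by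
    obtain ⟨U, l, hU, hU', hl, -, rfl⟩ := exists_unitary_of_mem_states hD
    rw [alphaMetric_eq_trace p hU hU' hl (add_mem_tangent hA hA').1 hB.1,
      alphaMetric_eq_trace p hU hU' hl hA.1 hB.1, alphaMetric_eq_trace p hU hU' hl hA'.1 hB.1,
      cfcDeriv_add, add_mul, Matrix.trace_add, Complex.add_re]
  smul_left n D hD r A hA B hB := by
    obtain ⟨U, l, hU, hU', hl, -, rfl⟩ := exists_unitary_of_mem_states hD
    have : r • A = (r : ℂ) • A := by ext; simp
    rw [alphaMetric_eq_trace p hU hU' hl (smul_mem_tangent hA r).1 hB.1,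
      alphaMetric_eq_trace p hU hU' hl hA.1 hB.1, this, cfcDeriv_smul, smul_mul_assoc,
      Matrix.trace_smul, smul_eq_mul, Complex.re_ofReal_mul]
  symm n D hD A hA B hB := by
    obtain ⟨U, l, hU, hU', hl, -, rfl⟩ := exists_unitary_of_mem_states hD
    rw [alphaMetric_eq_sum p hU hU' hl hA.1 hB.1, alphaMetric_eq_sum p hU hU' hl hB.1 hA.1,
      Finset.sum_comm]
    refine Finset.sum_congr rfl fun i _ => Finset.sum_congr rfl fun j _ => ?_
    rw [wydKernel_comm, mul_comm ((star U * A * U) j i)]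
  pos n D hD A hA hA0 := by
    obtain ⟨U, l, hU, hU', hl, -, rfl⟩ := exists_unitary_of_mem_states hD
    rw [alphaMetric_self_eq_sum p hU hU' hl hA.1]
    have hnn : ∀ i j, 0 ≤ wydKernel p (l i) (l j) * Complex.normSq ((star U * A * U) i j) :=
      fun i j => mul_nonneg (wydKernel_pos p (hl i) (hl j)).le (Complex.normSq_nonneg _)
    obtain ⟨i, j, hij⟩ : ∃ i j, (star U * A * U) i j ≠ 0 := by
      by_contra! hcon
      refine hA0 ?_
      have hz : star U * A * U = 0 := by ext i j; exact hcon i j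
      calc A = (U * star U) * A * (U * star U) := by rw [hU']; simp
        _ = U * (star U * A * U) * star U := by noncomm_ring
        _ = 0 := by rw [hz]; simp
    refine Finset.sum_pos' (fun i _ => Finset.sum_nonneg fun j _ => hnn i j)
      ⟨i, Finset.mem_univ i, Finset.sum_pos' (fun j _ => hnn i j) ⟨j, Finset.mem_univ j, ?_⟩⟩
    exact mul_pos (wydKernel_pos p (hl i) (hl j)) (Complex.normSq_pos.mpr hij)
  smooth n A hA B hB := alphaMetric_contDiffOn p hA.1 hB.1
  monotone n m T hT D hD hTD A hA := alphaMetric_monotone hp hT hD hTD hA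
  fisher n q a hq hqs ha := by
    have h := alphaMetric_self_eq_sum p (U := (1 : Mat n)) (by simp) (by simp) hq
      (rdiag_isHermitian a)
    rw [star_one, one_mul, mul_one, one_mul, mul_one] at h
    refine h.trans (Finset.sum_congr rfl fun i _ => ?_)
    rw [Finset.sum_eq_single i]
    · rw [rdiag_apply_self, wydKernel_self p (hq i), Complex.normSq_ofReal]
      ring
    · intro j _ hj
      rw [rdiag_apply_ne _ hj.symm, Complex.normSq_zero, mul_zero]
    · simp

end AlphaMetric

end WYD
end

/-! ### Kraus maps, and what determines a monotone metric -/

noncomputable section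
namespace WYD

open Filter Topology

section Kraus

variable {n m : ℕ} {ι : Type*} [Fintype ι]

/-- The completely positive mapping with Kraus operators `V r`. -/
def kraus (V : ι → Matrix (Fin m) (Fin n) ℂ) : Mat n →ₗ[ℂ] Mat m where
  toFun A := ∑ r, V r * A * (V r).conjTranspose
  map_add' A B := by simp only [Matrix.mul_add, Matrix.add_mul, Finset.sum_add_distrib]
  map_smul' c A := by
    simp only [Matrix.mul_smul, Matrix.smul_mul, Finset.smul_sum, RingHom.id_apply]

theorem kraus_apply (V : ι → Matrix (Fin m) (Fin n) ℂ) (A : Mat n) :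
    kraus V A = ∑ r, V r * A * (V r).conjTranspose := rfl

theorem isStochastic_kraus {V : ι → Matrix (Fin m) (Fin n) ℂ}
    (hV : ∑ r, (V r).conjTranspose * V r = 1) : IsStochastic (kraus V) where
  trace_map A := by
    rw [kraus_apply, Matrix.trace_sum]
    have h : ∀ r, (V r * A * (V r).conjTranspose).trace =
        ((V r).conjTranspose * V r * A).trace := fun r => by
      rw [Matrix.trace_mul_comm, Matrix.mul_assoc]
    simp only [h]
    rw [← Matrix.trace_sum, ← Matrix.sum_mul, hV, one_mul]
  completelyPositive k a b := by
    have h : ∑ i, ∑ j, (a i).conjTranspose * kraus V ((b i).conjTranspose * b j) * a j =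
        ∑ r, (∑ i, b i * (V r).conjTranspose * a i).conjTranspose *
          (∑ i, b i * (V r).conjTranspose * a i) := by
      simp only [kraus_apply, Matrix.mul_sum, Matrix.sum_mul, Matrix.conjTranspose_sum,
        Matrix.conjTranspose_mul, Matrix.conjTranspose_conjTranspose, Matrix.mul_assoc]
      rw [Finset.sum_comm_cycle]
      refine Finset.sum_congr rfl fun r _ => ?_
      rw [Finset.sum_comm]
    rw [h]
    exact Matrix.posSemidef_sum _ fun r _ => Matrix.posSemidef_conjTranspose_mul_self _

end Kraus

namespace IsSymmetricMonotoneMetric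

variable {K L : MetricFamily} {n m : ℕ}

theorem add_right (hK : IsSymmetricMonotoneMetric K) {D : Mat n} (hD : D ∈ States n)
    {A B B' : Mat n} (hA : A ∈ Tangent n) (hB : B ∈ Tangent n) (hB' : B' ∈ Tangent n) :
    K n D A (B + B') = K n D A B + K n D A B' := by
  rw [hK.symm n D hD A hA _ (add_mem_tangent hB hB'), hK.add_left n D hD B hB B' hB' A hA,
    hK.symm n D hD B hB A hA, hK.symm n D hD B' hB' A hA]

theorem smul_right (hK : IsSymmetricMonotoneMetric K) {D : Mat n} (hD : D ∈ States n)
    {A B : Mat n} (hA : A ∈ Tangent n) (hB : B ∈ Tangent n) (r : ℝ) :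
    K n D A (r • B) = r * K n D A B := by
  rw [hK.symm n D hD A hA _ (smul_mem_tangent hB r), hK.smul_left n D hD r B hB A hA,
    hK.symm n D hD B hB A hA]

theorem add_self (hK : IsSymmetricMonotoneMetric K) {D : Mat n} (hD : D ∈ States n)
    {A B : Mat n} (hA : A ∈ Tangent n) (hB : B ∈ Tangent n) :
    K n D (A + B) (A + B) = K n D A A + 2 * K n D A B + K n D B B := by
  rw [hK.add_left n D hD A hA B hB _ (add_mem_tangent hA hB), hK.add_right hD hA hA hB,
    hK.add_right hD hB hA hB, hK.symm n D hD B hB A hA]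
  ring

theorem smul_self (hK : IsSymmetricMonotoneMetric K) {D : Mat n} (hD : D ∈ States n)
    {A : Mat n} (hA : A ∈ Tangent n) (r : ℝ) :
    K n D (r • A) (r • A) = r ^ 2 * K n D A A := by
  rw [hK.smul_left n D hD r A hA _ (smul_mem_tangent hA r), hK.smul_right hD hA hA]
  ring

/-- Contraction under T and under S gives the two inequalities. Invariance under unitary conjugation
and under ampliation both come from here. -/
theorem eq_of_leftInverse (hK : IsSymmetricMonotoneMetric K) {T : Mat n →ₗ[ℂ] Mat m}
    {S : Mat m →ₗ[ℂ] Mat n} (hT : IsStochastic T) (hS : IsStochastic S) {D A : Mat n}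
    (hD : D ∈ States n) (hTD : T D ∈ States m) (hA : A ∈ Tangent n) (hSD : S (T D) = D)
    (hSA : S (T A) = A) : K m (T D) (T A) (T A) = K n D A A := by
  refine le_antisymm (hK.monotone n m T hT D hD hTD A hA) ?_
  have := hK.monotone m n S hS (T D) hTD (by rwa [hSD]) (T A) (hT.map_mem_tangent hA)
  rwa [hSD, hSA] at this

theorem unitary_conj (hK : IsSymmetricMonotoneMetric K) {U : Mat n} (h1 : star U * U = 1)
    (h2 : U * star U = 1) {D A : Mat n} (hD : D ∈ States n) (hTD : U * D * star U ∈ States n)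
    (hA : A ∈ Tangent n) :
    K n (U * D * star U) (U * A * star U) (U * A * star U) = K n D A A := by
  have hT : ∀ V : Mat n, star V * V = 1 → IsStochastic (kraus fun _ : Unit => V) := fun V hV =>
    isStochastic_kraus (by rwa [Fintype.sum_unique])
  have hap : ∀ V M : Mat n, kraus (fun _ : Unit => V) M = V * M * star V := fun V M => by
    simp [kraus_apply, Matrix.star_eq_conjTranspose]
  have hinv : ∀ M : Mat n, star U * (U * M * star U) * star (star U) = M := by
    intro M
    rw [star_star]
    calc _ = (star U * U) * M * (star U * U) := by noncomm_ring
      _ = M := by rw [h1]; simp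
  have := hK.eq_of_leftInverse (hT U h1) (hT (star U) (by rw [star_star]; exact h2)) hD
    (by rwa [hap]) hA (by rw [hap, hap, hinv]) (by rw [hap, hap, hinv])
  simpa only [hap] using this

theorem unitary_conj' (hK : IsSymmetricMonotoneMetric K) {U : Mat n} (h1 : star U * U = 1)
    (h2 : U * star U = 1) {l : Fin n → ℝ} (hl : ∀ i, 0 < l i) (hs : ∑ i, l i = 1) {A : Mat n}
    (hA : A ∈ Tangent n) :
    K n (U * rdiag l * star U) A A = K n (rdiag l) (star U * A * U) (star U * A * U) := by
  have hA' : star U * A * U ∈ Tangent n := by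
    refine ⟨conj_isHermitian' U hA.1, ?_⟩
    rw [Matrix.trace_mul_comm, ← mul_assoc, h2, one_mul, hA.2]
  rw [← hK.unitary_conj h1 h2 (rdiag_mem_states hl hs) (unitary_rdiag_mem_states h1 h2 hl hs) hA']
  have : U * (star U * A * U) * star U = A := by
    calc _ = (U * star U) * A * (U * star U) := by noncomm_ring
      _ = A := by rw [h2]; simp
  rw [this]

theorem isStochastic_pinching :
    IsStochastic (kraus fun i : Fin n => (Matrix.single i i 1 : Mat n)) := by
  refine isStochastic_kraus ?_
  ext a b
  rw [Matrix.sum_apply]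
  rcases eq_or_ne a b with rfl | h
  · simp [Matrix.single_apply]
  · simp only [Matrix.conjTranspose_single, Matrix.single_mul_single_same, Matrix.one_apply_ne h]
    refine Finset.sum_eq_zero fun i _ => ?_
    rw [Matrix.single_apply, if_neg]
    rintro ⟨rfl, rfl⟩
    exact h rfl

theorem pinching_apply (A : Mat n) :
    kraus (fun i : Fin n => (Matrix.single i i 1 : Mat n)) A = Matrix.diagonal A.diag := by
  ext a b
  rw [kraus_apply, Matrix.sum_apply]
  rcases eq_or_ne a b with rfl | h
  · simp [Matrix.single_apply, Matrix.mul_apply, ite_and]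
  · simp [Matrix.single_apply, Matrix.mul_apply, ite_and, h, h.symm]

/-- Diagonal and off-diagonal directions are orthogonal at diagonal states. -/
theorem rdiag_add_self (hK : IsSymmetricMonotoneMetric K) {l : Fin n → ℝ} (hl : ∀ i, 0 < l i)
    (hs : ∑ i, l i = 1) {a : Fin n → ℝ} (ha : ∑ i, a i = 0) {X : Mat n} (hX : X.IsHermitian)
    (hX0 : X.diag = 0) :
    K n (rdiag l) (rdiag a + X) (rdiag a + X) =
      ∑ i, a i ^ 2 / l i + K n (rdiag l) X X := by
  have hD := rdiag_mem_states hl hs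
  have hat : rdiag a ∈ Tangent n :=
    ⟨rdiag_isHermitian a, by rw [Matrix.trace_diagonal]; exact_mod_cast ha⟩
  have hXt : X ∈ Tangent n := ⟨hX, by
    change ∑ i, X.diag i = 0
    simp only [hX0, Pi.zero_apply, Finset.sum_const_zero]⟩
  have hpd : kraus (fun i : Fin n => (Matrix.single i i 1 : Mat n)) (rdiag l) = rdiag l := by
    rw [pinching_apply, Matrix.diag_diagonal]
  -- Pinching fixes the state, fixes the diagonal direction and kills X, so the purely diagonal
  -- terms cancel. A polynomial 2βs + γs² that is nonnegative for every real s has β = 0.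
  have hineq : ∀ s : ℝ, 0 ≤ 2 * s * K n (rdiag l) (rdiag a) X + s ^ 2 * K n (rdiag l) X X := by
    intro s
    have h1 := hK.monotone n n _ isStochastic_pinching (rdiag l) hD (by rwa [hpd])
      (rdiag a + s • X) (add_mem_tangent hat (smul_mem_tangent hXt s))
    have h2 : kraus (fun i : Fin n => (Matrix.single i i 1 : Mat n)) (rdiag a + s • X) =
        rdiag a := by
      rw [pinching_apply, Matrix.diag_add, Matrix.diag_smul, hX0, smul_zero, add_zero,
        Matrix.diag_diagonal]
    rw [hpd, h2, hK.add_self hD hat (smul_mem_tangent hXt s), hK.smul_right hD hat hXt,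
      hK.smul_self hD hXt] at h1
    linarith
  have hzero : K n (rdiag l) (rdiag a) X = 0 := by
    by_contra hne
    rcases eq_or_ne (K n (rdiag l) X X) 0 with h0 | h0
    · have := hineq (-K n (rdiag l) (rdiag a) X)
      rw [h0] at this
      nlinarith [sq_pos_of_ne_zero hne]
    · have := hineq (-K n (rdiag l) (rdiag a) X / K n (rdiag l) X X)
      have hXp : 0 < K n (rdiag l) X X := by
        refine lt_of_le_of_ne ?_ (Ne.symm h0)
        have h3 := hineq 1
        have h4 := hineq (-1)
        linarith
      have h5 : 2 * (-K n (rdiag l) (rdiag a) X / K n (rdiag l) X X) * K n (rdiag l) (rdiag a) X +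
          (-K n (rdiag l) (rdiag a) X / K n (rdiag l) X X) ^ 2 * K n (rdiag l) X X =
          -(K n (rdiag l) (rdiag a) X ^ 2 / K n (rdiag l) X X) := by
        field_simp
        ring
      rw [h5] at this
      have := div_pos (sq_pos_of_ne_zero hne) hXp
      linarith
  rw [hK.add_self hD hat hXt, hzero, hK.fisher n l a hl hs ha]
  ring

theorem tendsto_rdiag (hK : IsSymmetricMonotoneMetric K) {β : Type*} {F : Filter β}
    {l : β → Fin n → ℝ} {l₀ : Fin n → ℝ} (hlim : Tendsto l F (𝓝 l₀))
    (hl : ∀ᶠ e in F, (∀ i, 0 < l e i) ∧ ∑ i, l e i = 1) (hl₀ : ∀ i, 0 < l₀ i)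
    (hs₀ : ∑ i, l₀ i = 1) {A : Mat n} (hA : A ∈ Tangent n) :
    Tendsto (fun e => K n (rdiag (l e)) A A) F (𝓝 (K n (rdiag l₀) A A)) := by
  have hc := (hK.smooth n A hA A hA).continuousOn (fun i j => rdiag l₀ i j)
    (rdiag_mem_states hl₀ hs₀)
  have hpath : Tendsto (fun e => (fun i j => rdiag (l e) i j : Fin n → Fin n → ℂ)) F
      (𝓝[{M | Matrix.of M ∈ States n}] (fun i j => rdiag l₀ i j)) := by
    refine tendsto_nhdsWithin_iff.mpr ⟨?_, ?_⟩
    · rw [tendsto_pi_nhds]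
      intro i
      rw [tendsto_pi_nhds]
      intro j
      rcases eq_or_ne i j with rfl | h
      · simp only [Matrix.diagonal_apply_eq]
        exact (Complex.continuous_ofReal.tendsto _).comp ((tendsto_pi_nhds.mp hlim) i)
      · simp only [Matrix.diagonal_apply_ne _ h]
        exact tendsto_const_nhds
    · filter_upwards [hl] with e he
      exact rdiag_mem_states he.1 he.2
  exact hc.tendsto.comp hpath

/-- For simple spectrum the equation i(l_i − l_j) Z_ij = X_ij is solvable entrywise, so commutators
exhaust the directions with zero diagonal. On the diagonal the formula for Z reads 0/0 = 0. -/
theorem exists_commTangent_eq {l : Fin n → ℝ} (hl : Function.Injective l) {X : Mat n}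
    (hX : X.IsHermitian) (hX0 : X.diag = 0) :
    ∃ Z : Mat n, Z.IsHermitian ∧ commTangent (rdiag l) Z = X := by
  refine ⟨Matrix.of fun i j => -Complex.I * X i j / ((l i : ℂ) - l j), ?_, ?_⟩
  · ext i j
    rw [Matrix.conjTranspose_apply, Matrix.of_apply, Matrix.of_apply, ← hX.apply i j]
    simp only [Complex.star_def, map_div₀, map_mul, map_neg, Complex.conj_I, map_sub,
      Complex.conj_ofReal]
    rw [← neg_sub (l i : ℂ), div_neg, neg_neg, neg_mul, neg_div]
  · ext i j
    simp only [commTangent, Matrix.smul_apply, Matrix.sub_apply, Matrix.diagonal_mul,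
      Matrix.mul_diagonal, Matrix.of_apply, smul_eq_mul]
    rcases eq_or_ne i j with rfl | h
    · have : X i i = 0 := congrFun hX0 i
      simp [this]
    · have hne : (l i : ℂ) - l j ≠ 0 := by
        rw [sub_ne_zero]
        exact_mod_cast hl.ne h
      field_simp
      linear_combination (-X i j * ((l i : ℂ) - l j)) * Complex.I_sq

/-- Two Fisher-adjusted symmetric monotone metrics agree as soon as they agree on commutators at
diagonal states with simple spectrum. -/
theorem sameMetric_of_commTangent (hK : IsSymmetricMonotoneMetric K)
    (hL : IsSymmetricMonotoneMetric L)
    (h : ∀ (n : ℕ) (l : Fin n → ℝ), (∀ i, 0 < l i) → ∑ i, l i = 1 → Function.Injective l →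
      ∀ Z : Mat n, Z.IsHermitian →
        K n (rdiag l) (commTangent (rdiag l) Z) (commTangent (rdiag l) Z) =
          L n (rdiag l) (commTangent (rdiag l) Z) (commTangent (rdiag l) Z)) :
    SameMetric K L := by
  have hsimple : ∀ (n : ℕ) (l : Fin n → ℝ), (∀ i, 0 < l i) → ∑ i, l i = 1 →
      Function.Injective l → ∀ A ∈ Tangent n, K n (rdiag l) A A = L n (rdiag l) A A := by
    intro n l hl hs hinj A hA
    set a : Fin n → ℝ := fun i => (A i i).re with ha
    have haA : ∀ i, (a i : ℂ) = A i i := fun i => by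
      have := hA.1.apply i i
      exact Complex.conj_eq_iff_re.mp this
    set X := A - rdiag a with hX
    have hXH : X.IsHermitian := IsSelfAdjoint.sub hA.1 (rdiag_isHermitian a)
    have hX0 : X.diag = 0 := by
      ext i
      rw [Matrix.diag_apply, hX, Matrix.sub_apply, rdiag_apply_self, haA, sub_self, Pi.zero_apply]
    have has : ∑ i, a i = 0 := by
      have := hA.2
      rw [Matrix.trace] at this
      have h2 : ((∑ i, a i : ℝ) : ℂ) = 0 := by
        rw [Complex.ofReal_sum, ← this]
        exact Finset.sum_congr rfl fun i _ => haA i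
      exact_mod_cast h2
    have hAX : A = rdiag a + X := by rw [hX]; abel
    obtain ⟨Z, hZ, hZX⟩ := exists_commTangent_eq hinj hXH hX0
    rw [hAX, hK.rdiag_add_self hl hs has hXH hX0, hL.rdiag_add_self hl hs has hXH hX0, ← hZX,
      h n l hl hs hinj Z hZ]
  have hdiag : ∀ (n : ℕ) (l : Fin n → ℝ), (∀ i, 0 < l i) → ∑ i, l i = 1 →
      ∀ A ∈ Tangent n, K n (rdiag l) A A = L n (rdiag l) A A := by
    intro n l hl hs A hA
    -- The state μ has eigenvalues proportional to 1, …, n. Mixing in a small amount e > 0 of it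
    -- makes the spectrum simple, and continuity of both metrics allows e → 0.
    set s : ℝ := ∑ i : Fin n, ((i : ℝ) + 1) with hsdef
    have hs0 : 0 < s := by
      refine Finset.sum_pos (fun i _ => by positivity) ?_
      rw [Finset.univ_nonempty_iff]
      by_contra hemp
      rw [not_nonempty_iff] at hemp
      simp at hs
    set μ : Fin n → ℝ := fun i => ((i : ℝ) + 1) / s with hμ
    have hμ0 : ∀ i, 0 < μ i := fun i => by simp only [hμ]; positivity
    have hμs : ∑ i, μ i = 1 := by
      simp only [hμ]
      rw [← Finset.sum_div, ← hsdef, div_self hs0.ne']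
    have hμi : Function.Injective μ := by
      intro i j hij
      have h1 := (div_left_inj' hs0.ne').mp hij
      have h2 : (i : ℝ) = j := by linarith
      exact Fin.ext (by exact_mod_cast h2)
    set q : ℝ → Fin n → ℝ := fun e i => (1 - e) * l i + e * μ i with hq
    have hqlim : Tendsto q (𝓝[>] 0) (𝓝 l) := by
      have hc : Continuous q := by
        rw [hq]; fun_prop
      have := (hc.tendsto 0).mono_left (nhdsWithin_le_nhds (s := Set.Ioi 0))
      have h0 : q 0 = l := by ext i; simp [hq]
      rwa [h0] at this
    have hqs : ∀ᶠ e in 𝓝[>] (0 : ℝ), (∀ i, 0 < q e i) ∧ ∑ i, q e i = 1 := by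
      filter_upwards [Ioo_mem_nhdsGT (show (0 : ℝ) < 1 by norm_num)] with e he
      refine ⟨fun i => ?_, ?_⟩
      · exact add_pos (mul_pos (by linarith [he.2]) (hl i)) (mul_pos he.1 (hμ0 i))
      · simp only [hq]
        rw [Finset.sum_add_distrib, ← Finset.mul_sum, ← Finset.mul_sum, hs, hμs]
        ring
    have hqi : ∀ᶠ e in 𝓝[>] (0 : ℝ), Function.Injective (q e) := by
      have hpair : ∀ i j : Fin n, i ≠ j → ∀ᶠ e in 𝓝[>] (0 : ℝ), q e i ≠ q e j := by
        intro i j hij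
        rcases eq_or_ne (l i) (l j) with hlij | hlij
        · filter_upwards [self_mem_nhdsWithin] with e he heq
          simp only [hq, hlij] at heq
          have : e * μ i = e * μ j := by linarith
          exact hij (hμi (mul_left_cancel₀ (ne_of_gt he) this))
        · have h1 := (tendsto_pi_nhds.mp hqlim i).sub (tendsto_pi_nhds.mp hqlim j)
          filter_upwards [h1.eventually_ne (sub_ne_zero.mpr hlij)] with e he
          exact sub_ne_zero.mp he
      have h2 : ∀ᶠ e in 𝓝[>] (0 : ℝ), ∀ i j : Fin n, i ≠ j → q e i ≠ q e j := by
        rw [Filter.eventually_all]; intro i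
        rw [Filter.eventually_all]; intro j
        rw [Filter.eventually_imp_distrib_left]
        exact hpair i j
      filter_upwards [h2] with e he i j hij
      by_contra hne
      exact he i j hne hij
    have t1 := hK.tendsto_rdiag hqlim hqs hl hs hA
    have t2 := hL.tendsto_rdiag hqlim hqs hl hs hA
    refine tendsto_nhds_unique (t1.congr' ?_) t2
    filter_upwards [hqs, hqi] with e he hei
    exact hsimple n _ he.1 he.2 hei A hA
  have hself : ∀ n, ∀ D ∈ States n, ∀ A ∈ Tangent n, K n D A A = L n D A A := by
    intro n D hD A hA
    obtain ⟨U, l, h1, h2, hl, hs, rfl⟩ := exists_unitary_of_mem_states hD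
    rw [hK.unitary_conj' h1 h2 hl hs hA, hL.unitary_conj' h1 h2 hl hs hA]
    refine hdiag n l hl hs _ ⟨conj_isHermitian' U hA.1, ?_⟩
    rw [Matrix.trace_mul_comm, ← mul_assoc, h2, one_mul, hA.2]
  -- Equality of the quadratic forms passes to the bilinear forms by polarization.
  intro n D hD A hA B hB
  have e1 := hK.add_self hD hA hB
  have e2 := hL.add_self hD hA hB
  rw [hself n D hD _ (add_mem_tangent hA hB), hself n D hD A hA, hself n D hD B hB] at e1
  linarith

end IsSymmetricMonotoneMetric

end WYD
end

/-! ### Generated metrics: scaling, the double eigenvalue, and an upper bound -/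

noncomputable section
namespace WYD

open Filter Topology

section Scaling

variable {n : ℕ}

/-- The isometries whose adjoints are the blocks of the partial trace. -/
def blockMap (n k : ℕ) (r : Fin k) : Matrix (Fin n) (Fin (n * k)) ℂ :=
  Matrix.of fun i e => if finProdFinEquiv.symm e = (i, r) then 1 else 0

theorem blockMap_apply {k : ℕ} (r : Fin k) (i : Fin n) (e : Fin n × Fin k) :
    blockMap n k r i (finProdFinEquiv e) = if e = (i, r) then 1 else 0 := by
  rw [blockMap, Matrix.of_apply, Equiv.symm_apply_apply]

theorem ext_prod {k : ℕ} {M N : Mat (n * k)}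
    (h : ∀ e f : Fin n × Fin k, M (finProdFinEquiv e) (finProdFinEquiv f) =
      N (finProdFinEquiv e) (finProdFinEquiv f)) : M = N := by
  ext a b
  obtain ⟨e, rfl⟩ := finProdFinEquiv.surjective a
  obtain ⟨f, rfl⟩ := finProdFinEquiv.surjective b
  exact h e f

/-- The stochastic mapping `A ↦ A ⊗ 1 / k`. -/
def ampliation (n k : ℕ) : Mat n →ₗ[ℂ] Mat (n * k) :=
  kraus fun r : Fin k => ((1 / √(k : ℝ) : ℝ) : ℂ) • (blockMap n k r).conjTranspose

/-- The partial trace. -/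
def partialTrace (n k : ℕ) : Mat (n * k) →ₗ[ℂ] Mat n :=
  kraus fun r : Fin k => blockMap n k r

theorem blockMap_mul_conjTranspose {k : ℕ} (r : Fin k) :
    blockMap n k r * (blockMap n k r).conjTranspose = 1 := by
  ext i j
  rw [Matrix.mul_apply, ← finProdFinEquiv.sum_comp]
  simp only [Matrix.conjTranspose_apply, blockMap_apply]
  simp [Matrix.one_apply, eq_comm]

theorem isStochastic_ampliation {k : ℕ} (hk : 0 < k) : IsStochastic (ampliation n k) := by
  refine isStochastic_kraus ?_
  have hk' : (0 : ℝ) < k := by exact_mod_cast hk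
  have h : ∀ r : Fin k, (((1 / √(k : ℝ) : ℝ) : ℂ) • (blockMap n k r).conjTranspose).conjTranspose *
      (((1 / √(k : ℝ) : ℝ) : ℂ) • (blockMap n k r).conjTranspose) =
      (1 / (k : ℂ)) • (1 : Mat n) := by
    intro r
    rw [Matrix.conjTranspose_smul, Matrix.conjTranspose_conjTranspose, Matrix.smul_mul,
      Matrix.mul_smul, blockMap_mul_conjTranspose, smul_smul, Complex.star_def,
      Complex.conj_ofReal, ← Complex.ofReal_mul, ← pow_two, div_pow, Real.sq_sqrt hk'.le]
    simp
  simp only [h, Finset.sum_const, Finset.card_univ, Fintype.card_fin]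
  rw [← Nat.cast_smul_eq_nsmul ℂ, smul_smul, mul_one_div, div_self (by exact_mod_cast hk.ne'),
    one_smul]

theorem isStochastic_partialTrace (k : ℕ) : IsStochastic (partialTrace n k) := by
  refine isStochastic_kraus (ext_prod fun e f => ?_)
  rw [Matrix.sum_apply]
  simp only [Matrix.mul_apply, Matrix.conjTranspose_apply, blockMap_apply]
  obtain ⟨e1, e2⟩ := e
  obtain ⟨f1, f2⟩ := f
  by_cases h1 : e1 = f1 <;> by_cases h2 : e2 = f2 <;>
    simp [Matrix.one_apply, Prod.ext_iff, ite_and, h1, h2]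

theorem ampliation_apply {k : ℕ} (A : Mat n) (e f : Fin n × Fin k) :
    ampliation n k A (finProdFinEquiv e) (finProdFinEquiv f) =
      if e.2 = f.2 then A e.1 f.1 / k else 0 := by
  have hs : ((√(k : ℝ) : ℝ) : ℂ)⁻¹ * ((√(k : ℝ) : ℝ) : ℂ)⁻¹ = (k : ℂ)⁻¹ := by
    rw [← mul_inv, ← Complex.ofReal_mul, Real.mul_self_sqrt (Nat.cast_nonneg k)]
    simp
  rw [ampliation, kraus_apply, Matrix.sum_apply]
  obtain ⟨e1, e2⟩ := e
  obtain ⟨f1, f2⟩ := f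
  simp only [Matrix.smul_mul, Matrix.conjTranspose_smul,
    Matrix.conjTranspose_conjTranspose, Matrix.smul_apply, Matrix.mul_apply,
    Matrix.conjTranspose_apply, blockMap_apply, Prod.ext_iff]
  by_cases h2 : e2 = f2
  · subst h2
    simp only [ite_and]
    simp
    linear_combination A e1 f1 * hs
  · simp only [ite_and]
    simp [h2]

theorem partialTrace_apply {k : ℕ} (B : Mat (n * k)) (i j : Fin n) :
    partialTrace n k B i j =
      ∑ r : Fin k, B (finProdFinEquiv (i, r)) (finProdFinEquiv (j, r)) := by
  rw [partialTrace, kraus_apply, Matrix.sum_apply]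
  refine Finset.sum_congr rfl fun r _ => ?_
  rw [Matrix.mul_apply, ← finProdFinEquiv.sum_comp, Finset.sum_eq_single (j, r)]
  · rw [Matrix.conjTranspose_apply, blockMap_apply, if_pos rfl, star_one, mul_one,
      Matrix.mul_apply, ← finProdFinEquiv.sum_comp, Finset.sum_eq_single (i, r)]
    · rw [blockMap_apply, if_pos rfl, one_mul]
    · intro e _ he
      rw [blockMap_apply, if_neg he, zero_mul]
    · simp
  · intro e _ he
    rw [Matrix.conjTranspose_apply, blockMap_apply, if_neg he, star_zero, mul_zero]
  · simp

theorem partialTrace_ampliation {k : ℕ} (hk : 0 < k) (A : Mat n) :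
    partialTrace n k (ampliation n k A) = A := by
  ext i j
  rw [partialTrace_apply]
  simp only [ampliation_apply, if_true, Finset.sum_const, Finset.card_univ, Fintype.card_fin,
    nsmul_eq_mul]
  exact mul_div_cancel₀ _ (by exact_mod_cast hk.ne')

variable {K : MetricFamily} {g gs : ℝ → ℝ}

/-- A generated monotone metric is invariant under `A ↦ A ⊗ 1 / k`. -/
theorem generated_sum_div (hK : IsSymmetricMonotoneMetric K) (hgen : IsGeneratedBy K g gs)
    (hg : ∀ x, 0 < x → DifferentiableAt ℝ g x) (hgs : ∀ x, 0 < x → DifferentiableAt ℝ gs x)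
    {l : Fin n → ℝ} (hl : ∀ i, 0 < l i) (hs : ∑ i, l i = 1) {X : Mat n} (hX : X.IsHermitian)
    {k : ℕ} (hk : 0 < k) :
    k * ∑ i, ∑ j, (g (l i / k) - g (l j / k)) * (gs (l i / k) - gs (l j / k)) *
        Complex.normSq (X i j) =
      ∑ i, ∑ j, (g (l i) - g (l j)) * (gs (l i) - gs (l j)) * Complex.normSq (X i j) := by
  have hk' : (0 : ℝ) < k := by exact_mod_cast hk
  set l' : Fin (n * k) → ℝ := fun e => l (finProdFinEquiv.symm e).1 / k with hl'
  set X' : Mat (n * k) := Matrix.of fun a b =>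
    if (finProdFinEquiv.symm a).2 = (finProdFinEquiv.symm b).2 then
      X (finProdFinEquiv.symm a).1 (finProdFinEquiv.symm b).1 else 0 with hX'
  have hX'a : ∀ e f : Fin n × Fin k, X' (finProdFinEquiv e) (finProdFinEquiv f) =
      if e.2 = f.2 then X e.1 f.1 else 0 := by
    intro e f
    rw [hX', Matrix.of_apply, Equiv.symm_apply_apply, Equiv.symm_apply_apply]
  have hl'a : ∀ e : Fin n × Fin k, l' (finProdFinEquiv e) = l e.1 / k := by
    intro e
    rw [hl']
    simp only [Equiv.symm_apply_apply]
  have hX'H : X'.IsHermitian := by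
    refine ext_prod fun e f => ?_
    rw [Matrix.conjTranspose_apply, hX'a, hX'a]
    by_cases h : e.2 = f.2
    · rw [if_pos h, if_pos h.symm, hX.apply]
    · rw [if_neg h, if_neg (Ne.symm h), star_zero]
  have hl'0 : ∀ e, 0 < l' e := fun e => div_pos (hl _) hk'
  have hl's : ∑ e, l' e = 1 := by
    rw [← finProdFinEquiv.sum_comp, Fintype.sum_prod_type]
    simp only [hl'a, Finset.sum_const, Finset.card_univ, Fintype.card_fin, nsmul_eq_mul]
    rw [← hs]
    exact Finset.sum_congr rfl fun i _ => mul_div_cancel₀ _ hk'.ne'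
  have hTD : ampliation n k (rdiag l) = rdiag l' := by
    refine ext_prod fun e f => ?_
    rw [ampliation_apply]
    rcases eq_or_ne e f with rfl | h
    · rw [if_pos rfl, rdiag_apply_self, rdiag_apply_self, hl'a]
      push_cast
      rfl
    · rw [rdiag_apply_ne l' (finProdFinEquiv.injective.ne h)]
      split_ifs with h2
      · rw [rdiag_apply_ne l fun h1 => h (Prod.ext h1 h2), zero_div]
      · rfl
  have hTA : ampliation n k (commTangent (rdiag l) X) = commTangent (rdiag l') X' := by
    refine ext_prod fun e f => ?_
    rw [ampliation_apply]
    simp only [commTangent, Matrix.smul_apply, Matrix.sub_apply, Matrix.diagonal_mul,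
      Matrix.mul_diagonal, smul_eq_mul, hX'a, hl'a]
    split_ifs with h
    · push_cast
      ring
    · simp
  have hD := rdiag_mem_states hl hs
  have hinv := hK.eq_of_leftInverse (isStochastic_ampliation hk) (isStochastic_partialTrace k)
    hD (by rw [hTD]; exact rdiag_mem_states hl'0 hl's)
    (commTangent_mem_tangent (rdiag_isHermitian l) hX)
    (partialTrace_ampliation hk _) (partialTrace_ampliation hk _)
  rw [hTD, hTA, hgen.apply_rdiag hg hgs hl'0 hl's hX'H, hgen.apply_rdiag hg hgs hl hs hX] at hinv
  rw [← hinv, ← finProdFinEquiv.sum_comp, Fintype.sum_prod_type, Finset.mul_sum]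
  refine Finset.sum_congr rfl fun i _ => ?_
  rw [Finset.mul_sum]
  have hin : ∀ r : Fin k, (∑ b, (g (l' (finProdFinEquiv (i, r))) - g (l' b)) *
      (gs (l' (finProdFinEquiv (i, r))) - gs (l' b)) *
      Complex.normSq (X' (finProdFinEquiv (i, r)) b)) =
      ∑ j, (g (l i / k) - g (l j / k)) * (gs (l i / k) - gs (l j / k)) *
        Complex.normSq (X i j) := by
    intro r
    rw [← finProdFinEquiv.sum_comp, Fintype.sum_prod_type]
    refine Finset.sum_congr rfl fun j _ => ?_
    rw [Finset.sum_eq_single r]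
    · rw [hl'a, hl'a, hX'a, if_pos rfl]
    · intro s _ hsr
      rw [hX'a, if_neg (Ne.symm hsr), Complex.normSq_zero, mul_zero]
    · simp
  simp only [hin, Finset.sum_const, Finset.card_univ, Fintype.card_fin, nsmul_eq_mul,
    Finset.mul_sum]

end Scaling

section LowDimension

variable {K : MetricFamily} {g gs : ℝ → ℝ}

/-- The numerator of the kernel of a generated metric. -/
def genNum (g gs : ℝ → ℝ) (x y : ℝ) : ℝ := (g x - g y) * (gs x - gs y)

theorem isHermitian_pair (c : ℂ) : (!![0, c, 0; star c, 0, 0; 0, 0, 0] : Mat 3).IsHermitian := by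
  ext i j
  fin_cases i <;> fin_cases j <;> simp

theorem sum_pair (G : Fin 3 → Fin 3 → ℝ) (c : ℂ) :
    ∑ i, ∑ j, G i j * Complex.normSq ((!![0, c, 0; star c, 0, 0; 0, 0, 0] : Mat 3) i j) =
      (G 0 1 + G 1 0) * Complex.normSq c := by
  simp [Fin.sum_univ_three]
  ring

theorem triple_pos {x y z : ℝ} (hx : 0 < x) (hy : 0 < y) (hz : 0 < z) (i : Fin 3) :
    0 < (![x, y, z] : Fin 3 → ℝ) i := by
  fin_cases i <;> simpa

/-- In dimension 3 the third eigenvalue 1 − x − y absorbs the trace condition, leaving x and y free;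
the direction X touches only the first two coordinates. -/
theorem genNum_natCast_div (hK : IsSymmetricMonotoneMetric K) (hgen : IsGeneratedBy K g gs)
    (hg : ∀ x, 0 < x → DifferentiableAt ℝ g x) (hgs : ∀ x, 0 < x → DifferentiableAt ℝ gs x)
    {x y : ℝ} (hx : 0 < x) (hy : 0 < y) (hxy : x + y < 1) {k : ℕ} (hk : 0 < k) :
    k * genNum g gs (x / k) (y / k) = genNum g gs x y := by
  have h := generated_sum_div hK hgen hg hgs (l := ![x, y, 1 - x - y])
    (triple_pos hx hy (by linarith)) (by simp [Fin.sum_univ_three]) (isHermitian_pair 1) hk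
  have h1 := sum_pair (fun i j => (g (![x, y, 1 - x - y] i / k) - g (![x, y, 1 - x - y] j / k)) *
    (gs (![x, y, 1 - x - y] i / k) - gs (![x, y, 1 - x - y] j / k))) 1
  have h2 := sum_pair (fun i j => (g (![x, y, 1 - x - y] i) - g (![x, y, 1 - x - y] j)) *
    (gs (![x, y, 1 - x - y] i) - gs (![x, y, 1 - x - y] j))) 1
  rw [h1, h2] at h
  simp only [Matrix.cons_val_zero, Matrix.cons_val_one, Complex.normSq_one, mul_one] at h
  simp only [genNum]
  linear_combination h / 2

/-- For c = a/d the points cx/a and x/d coincide, so the scaling by 1/k is used with d at (x, y) and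
with a at (cx, cy). Continuity passes from rational to real c. -/
theorem genNum_mul (hK : IsSymmetricMonotoneMetric K) (hgen : IsGeneratedBy K g gs)
    (hg : ∀ x, 0 < x → DifferentiableAt ℝ g x) (hgs : ∀ x, 0 < x → DifferentiableAt ℝ gs x)
    {x y : ℝ} (hx : 0 < x) (hy : 0 < y) (hxy : x + y < 1) {c : ℝ} (hc : c ∈ Set.Ioo (0 : ℝ) 1) :
    genNum g gs (c * x) (c * y) = c * genNum g gs x y := by
  have hrat : ∀ q : ℚ, (q : ℝ) ∈ Set.Ioo (0 : ℝ) 1 →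
      genNum g gs (q * x) (q * y) = q * genNum g gs x y := by
    intro q hq
    have hnum : 0 < q.num := Rat.num_pos.mpr (by exact_mod_cast hq.1)
    obtain ⟨a, ha⟩ := Int.eq_ofNat_of_zero_le hnum.le
    have ha0 : 0 < a := by omega
    have haR : (0 : ℝ) < a := by exact_mod_cast ha0
    have hdR : (0 : ℝ) < q.den := by exact_mod_cast q.den_pos
    have hqe : (q : ℝ) = a / q.den := by
      rw [Rat.cast_def, ha]; simp
    have h1 := genNum_natCast_div hK hgen hg hgs hx hy hxy q.den_pos
    have h2 := genNum_natCast_div hK hgen hg hgs (mul_pos hq.1 hx) (mul_pos hq.1 hy)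
      (by nlinarith [hq.2]) ha0
    have e1 : ∀ w : ℝ, (q : ℝ) * w / a = w / q.den := fun w => by
      rw [hqe]; field_simp
    rw [e1, e1] at h2
    rw [← h2, ← h1]
    rw [hqe]
    field_simp
  by_contra hne
  have hcont : ContinuousAt
      (fun c => genNum g gs (c * x) (c * y) - c * genNum g gs x y) c := by
    have hd : ∀ (h : ℝ → ℝ), (∀ x, 0 < x → DifferentiableAt ℝ h x) → ∀ w, 0 < w →
        ContinuousAt (fun c => h (c * w)) c := fun h hh w hw =>
      ContinuousAt.comp (f := fun c => c * w) (hh _ (mul_pos hc.1 hw)).continuousAt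
        (by fun_prop)
    simp only [genNum]
    exact (((hd g hg x hx).sub (hd g hg y hy)).mul ((hd gs hgs x hx).sub (hd gs hgs y hy))).sub
      (continuousAt_id.mul continuousAt_const)
  have hev := (hcont.eventually_ne (sub_ne_zero.mpr hne)).and (Ioo_mem_nhds hc.1 hc.2)
  obtain ⟨δ, hδ, hball⟩ := Metric.eventually_nhds_iff.mp hev
  obtain ⟨q, hq1, hq2⟩ := exists_rat_btwn (show c < c + δ by linarith)
  have := hball (y := (q : ℝ)) (by rw [Real.dist_eq, abs_lt]; constructor <;> linarith)
  exact this.1 (sub_eq_zero.mpr (hrat q this.2))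

/-- The off-diagonal selfadjoint direction in the first two coordinates. -/
def flip3 : Mat 3 := !![0, 1, 0; 1, 0, 0; 0, 0, 0]

theorem flip3_mem_tangent : flip3 ∈ Tangent 3 := by
  refine ⟨?_, by simp [flip3, Matrix.trace, Fin.sum_univ_three]⟩
  simpa [flip3] using isHermitian_pair 1

/-- The single direction `flip3` is a commutator at every state with x ≠ y, so y → x can be taken
with the tangent vector held fixed. -/
theorem commTangent_pair {x y : ℝ} (z : ℝ) (hxy : x ≠ y) :
    commTangent (rdiag ![x, y, z]) !![0, -Complex.I / ((x : ℂ) - y), 0;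
      star (-Complex.I / ((x : ℂ) - y)), 0, 0; 0, 0, 0] = flip3 := by
  have h : (x : ℂ) - y ≠ 0 := sub_ne_zero.mpr (by exact_mod_cast hxy)
  have h' : (y : ℂ) - x ≠ 0 := sub_ne_zero.mpr (by exact_mod_cast hxy.symm)
  have h2 : star (-Complex.I / ((x : ℂ) - y)) = Complex.I / ((x : ℂ) - y) := by
    simp
  rw [h2]
  ext i j
  simp only [commTangent, Matrix.smul_apply, Matrix.sub_apply, Matrix.diagonal_mul,
      Matrix.mul_diagonal, smul_eq_mul]
  fin_cases i <;> fin_cases j <;> simp [flip3]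
  · field_simp
    linear_combination (-((x : ℂ) - y)) * Complex.I_sq
  · field_simp
    linear_combination (-((x : ℂ) - y)) * Complex.I_sq

theorem generated_flip3 (hgen : IsGeneratedBy K g gs)
    (hg : ∀ x, 0 < x → DifferentiableAt ℝ g x) (hgs : ∀ x, 0 < x → DifferentiableAt ℝ gs x)
    {x y : ℝ} (hx : 0 < x) (hy : 0 < y) (hxy : x + y < 1) (hne : x ≠ y) :
    K 3 (rdiag ![x, y, 1 - x - y]) flip3 flip3 = 2 * genNum g gs x y / (x - y) ^ 2 := by
  rw [← commTangent_pair (1 - x - y) hne, hgen.apply_rdiag hg hgs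
    (triple_pos hx hy (by linarith)) (by simp [Fin.sum_univ_three]) (isHermitian_pair _),
    sum_pair (fun i j => (g (![x, y, 1 - x - y] i) - g (![x, y, 1 - x - y] j)) *
    (gs (![x, y, 1 - x - y] i) - gs (![x, y, 1 - x - y] j)))]
  have h : Complex.normSq (-Complex.I / ((x : ℂ) - y)) = 1 / (x - y) ^ 2 := by
    rw [← Complex.ofReal_sub, map_div₀, Complex.normSq_neg, Complex.normSq_I, Complex.normSq_ofReal,
      pow_two]
  rw [h]
  simp only [Matrix.cons_val_zero, Matrix.cons_val_one, genNum]
  ring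

/-- At a double eigenvalue the state commutes with the Hadamard rotation of the first two
coordinates, which turns `flip3` into Diag(1, −1, 0); there the Fisher condition gives 1/x + 1/x. -/
theorem flip3_degenerate (hK : IsSymmetricMonotoneMetric K) {x : ℝ} (hx : 0 < x)
    (hx2 : x < 1 / 2) : K 3 (rdiag ![x, x, 1 - x - x]) flip3 flip3 = 2 / x := by
  set h : ℂ := ((1 / √2 : ℝ) : ℂ) with hh
  have hsq : h * h = 1 / 2 := by
    rw [hh, ← Complex.ofReal_mul, ← pow_two, div_pow, Real.sq_sqrt (by norm_num)]
    norm_num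
  set U : Mat 3 := !![h, h, 0; h, -h, 0; 0, 0, 1] with hU
  have hUs : star U = U := by
    rw [Matrix.star_eq_conjTranspose]
    ext i j
    fin_cases i <;> fin_cases j <;> simp [hU, hh]
  have hUU : U * U = 1 := by
    ext i j
    fin_cases i <;> fin_cases j <;>
      simp [hU, Matrix.mul_apply, Fin.sum_univ_three, hsq] <;> norm_num
  have hl := triple_pos hx hx (show 0 < 1 - x - x by linarith)
  have hs : ∑ i, (![x, x, 1 - x - x] : Fin 3 → ℝ) i = 1 := by simp [Fin.sum_univ_three]
  have hD : U * rdiag ![x, x, 1 - x - x] * star U = rdiag ![x, x, 1 - x - x] := by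
    rw [hUs]
    ext i j
    rw [Matrix.mul_apply]
    simp only [Matrix.mul_diagonal]
    fin_cases i <;> fin_cases j <;> simp [hU, Fin.sum_univ_three]
    all_goals linear_combination (2 * (x : ℂ)) * hsq
  have hA : U * flip3 * star U = rdiag ![1, -1, 0] := by
    rw [hUs]
    ext i j
    fin_cases i <;> fin_cases j <;>
      simp [hU, flip3, Matrix.mul_apply, Fin.sum_univ_three, hsq] <;> norm_num
  have hinv := hK.unitary_conj (by rw [hUs, hUU]) (by rw [hUs, hUU])
    (rdiag_mem_states hl hs) (by rw [hD]; exact rdiag_mem_states hl hs) flip3_mem_tangent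
  rw [hD, hA] at hinv
  rw [← hinv]
  have := hK.fisher 3 ![x, x, 1 - x - x] ![1, -1, 0] hl hs (by simp [Fin.sum_univ_three])
  refine this.trans ?_
  simp [Fin.sum_univ_three]
  ring

/-- Off the diagonal the metric on `flip3` is twice the product of the slopes of g and gs. As y → x,
continuity of the metric compares the limit of this with the Fisher value 2/x. -/
theorem deriv_mul_deriv_generated (hK : IsSymmetricMonotoneMetric K) (hgen : IsGeneratedBy K g gs)
    (hg : ∀ x, 0 < x → DifferentiableAt ℝ g x) (hgs : ∀ x, 0 < x → DifferentiableAt ℝ gs x)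
    {x : ℝ} (hx : 0 < x) (hx2 : x < 1 / 2) : deriv g x * deriv gs x = 1 / x := by
  have h1 : Tendsto (fun y => K 3 (rdiag ![x, y, 1 - x - y]) flip3 flip3) (𝓝[≠] x)
      (𝓝 (2 / x)) := by
    rw [← flip3_degenerate hK hx hx2]
    refine hK.tendsto_rdiag (l := fun y => ![x, y, 1 - x - y]) ?_ ?_
      (triple_pos hx hx (by linarith)) (by simp [Fin.sum_univ_three]) flip3_mem_tangent
    · have hc : Continuous fun y : ℝ => (![x, y, 1 - x - y] : Fin 3 → ℝ) := by
        refine continuous_pi fun i => ?_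
        fin_cases i
        · exact continuous_const
        · exact continuous_id
        · exact continuous_const.sub continuous_id
      exact (hc.tendsto x).mono_left nhdsWithin_le_nhds
    · filter_upwards [mem_nhdsWithin_of_mem_nhds (Ioo_mem_nhds hx hx2)] with y hy
      refine ⟨triple_pos hx hy.1 (by linarith [hy.2]), ?_⟩
      simp [Fin.sum_univ_three]
  have h2 : Tendsto (fun y => 2 * (slope g x y * slope gs x y)) (𝓝[≠] x)
      (𝓝 (2 * (deriv g x * deriv gs x))) :=
    ((hasDerivAt_iff_tendsto_slope.mp (hg x hx).hasDerivAt).mul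
      (hasDerivAt_iff_tendsto_slope.mp (hgs x hx).hasDerivAt)).const_mul 2
  have h3 := tendsto_nhds_unique (h1.congr' ?_) h2
  · linear_combination -h3 / 2
  · filter_upwards [mem_nhdsWithin_of_mem_nhds (Ioo_mem_nhds hx hx2), self_mem_nhdsWithin]
      with y hy hne
    have hyx : y - x ≠ 0 := sub_ne_zero.mpr hne
    have hxy : x - y ≠ 0 := sub_ne_zero.mpr (Ne.symm hne)
    rw [generated_flip3 hgen hg hgs hx hy.1 (by linarith [hy.2]) (Ne.symm hne), slope_def_field,
      slope_def_field, genNum]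
    field_simp
    ring

theorem commTangent_pair_two {x y : ℝ} (hxy : x ≠ y) (s : ℝ) :
    commTangent (rdiag ![x, y]) !![0, -Complex.I * s / ((x : ℂ) - y);
      star (-Complex.I * s / ((x : ℂ) - y)), 0] = !![0, (s : ℂ); (s : ℂ), 0] := by
  have h : (x : ℂ) - y ≠ 0 := sub_ne_zero.mpr (by exact_mod_cast hxy)
  have h2 : star (-Complex.I * s / ((x : ℂ) - y)) = Complex.I * s / ((x : ℂ) - y) := by
    simp
  rw [h2]
  ext i j
  simp only [commTangent, Matrix.smul_apply, Matrix.sub_apply, Matrix.diagonal_mul,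
      Matrix.mul_diagonal, smul_eq_mul]
  fin_cases i <;> fin_cases j <;> simp
  · field_simp
    linear_combination (-((x : ℂ) - y)) * s * Complex.I_sq
  · field_simp
    linear_combination (-((x : ℂ) - y)) * s * Complex.I_sq

/-- The upper bound for monotone metrics obtained by preparing a state from two pure states. -/
theorem genNum_le (hK : IsSymmetricMonotoneMetric K) (hgen : IsGeneratedBy K g gs)
    (hg : ∀ x, 0 < x → DifferentiableAt ℝ g x) (hgs : ∀ x, 0 < x → DifferentiableAt ℝ gs x)
    {x y : ℝ} (hx : 0 < x) (hy : 0 < y) (hxy : x + y = 1) (hne : x ≠ y) :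
    2 * (x * y) * genNum g gs x y ≤ (x - y) ^ 2 := by
  -- This channel sends the two classical points to the pure states of (√x, √y) and (√x, −√y). Their
  -- even mixture is Diag(x, y), and half their difference is the off-diagonal matrix with entries
  -- √(xy).
  set V : Fin 2 → Mat 2 := ![!![(√x : ℂ), 0; (√y : ℂ), 0], !![0, (√x : ℂ); 0, -(√y : ℂ)]] with hV
  have hxx : (√x : ℂ) * √x = x := by rw [← Complex.ofReal_mul, Real.mul_self_sqrt hx.le]
  have hyy : (√y : ℂ) * √y = y := by rw [← Complex.ofReal_mul, Real.mul_self_sqrt hy.le]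
  have hxyC : (x : ℂ) + y = 1 := by exact_mod_cast hxy
  have hT : IsStochastic (kraus V) := by
    refine isStochastic_kraus ?_
    ext i j
    fin_cases i <;> fin_cases j <;> simp [hV, Matrix.mul_apply, Fin.sum_univ_two, hxx, hyy, hxyC]
  have hTD : kraus V (rdiag ![1 / 2, 1 / 2]) = rdiag ![x, y] := by
    rw [kraus_apply, Fin.sum_univ_two]
    ext i j
    simp only [Matrix.add_apply, Matrix.mul_apply (M := _ * rdiag _), Matrix.mul_diagonal]
    fin_cases i <;> fin_cases j <;> simp [hV, Fin.sum_univ_two]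
    all_goals first | linear_combination hxx | linear_combination hyy
  have hTA : kraus V (rdiag ![1 / 2, -1 / 2]) =
      !![0, ((√x * √y : ℝ) : ℂ); ((√x * √y : ℝ) : ℂ), 0] := by
    rw [kraus_apply, Fin.sum_univ_two]
    ext i j
    simp only [Matrix.add_apply, Matrix.mul_apply (M := _ * rdiag _), Matrix.mul_diagonal]
    fin_cases i <;> fin_cases j <;> simp [hV, Fin.sum_univ_two]
    all_goals ring
  have hl : ∀ i, 0 < (![x, y] : Fin 2 → ℝ) i := by intro i; fin_cases i <;> simpa
  have hs : ∑ i, (![x, y] : Fin 2 → ℝ) i = 1 := by simpa [Fin.sum_univ_two]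
  have hl2 : ∀ i, 0 < (![1 / 2, 1 / 2] : Fin 2 → ℝ) i := by intro i; fin_cases i <;> simp
  have hs2 : ∑ i, (![1 / 2, 1 / 2] : Fin 2 → ℝ) i = 1 := by simp [Fin.sum_univ_two]; norm_num
  have hA2 : ∑ i, (![1 / 2, -1 / 2] : Fin 2 → ℝ) i = 0 := by simp [Fin.sum_univ_two]; norm_num
  have hAt : rdiag ![1 / 2, -1 / 2] ∈ Tangent 2 :=
    ⟨rdiag_isHermitian _, by rw [Matrix.trace_diagonal]; exact_mod_cast hA2⟩
  have hmono := hK.monotone 2 2 _ hT _ (rdiag_mem_states hl2 hs2)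
    (by rw [hTD]; exact rdiag_mem_states hl hs) _ hAt
  have hfish : K 2 (rdiag ![1 / 2, 1 / 2]) (rdiag ![1 / 2, -1 / 2]) (rdiag ![1 / 2, -1 / 2]) = 1 := by
    refine (hK.fisher 2 _ _ hl2 hs2 hA2).trans ?_
    simp [Fin.sum_univ_two]
    norm_num
  have hH : ∀ c : ℂ, (!![0, c; star c, 0] : Mat 2).IsHermitian := by
    intro c
    ext i j
    fin_cases i <;> fin_cases j <;> simp
  rw [hfish, hTD, hTA, ← commTangent_pair_two hne, hgen.apply_rdiag hg hgs hl hs (hH _)] at hmono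
  have hn : Complex.normSq (-Complex.I * ((√x * √y : ℝ) : ℂ) / ((x : ℂ) - y)) =
      x * y / (x - y) ^ 2 := by
    rw [← Complex.ofReal_sub, map_div₀, map_mul, Complex.normSq_neg, Complex.normSq_I,
      Complex.normSq_ofReal, Complex.normSq_ofReal, ← pow_two, ← pow_two, mul_pow,
      Real.sq_sqrt hx.le, Real.sq_sqrt hy.le, one_mul]
  generalize -Complex.I * ((√x * √y : ℝ) : ℂ) / ((x : ℂ) - y) = c at hmono hn
  have hsum : 2 * genNum g gs x y * Complex.normSq c ≤ 1 := by
    refine le_trans (le_of_eq ?_) hmono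
    simp [Fin.sum_univ_two, genNum]
    ring
  rw [hn, mul_div_assoc', div_le_one (by have := sub_ne_zero.mpr hne; positivity)] at hsum
  linarith

end LowDimension

end WYD
end

/-! ### The functional equation for the generating pair -/

noncomputable section
namespace WYD

section FunctionalEquation

open Filter Topology Set

/-- A `C¹` function whose increments have shift invariant absolute values is affine. -/
theorem exists_affine_of_abs_sub_shift {θ : ℝ → ℝ} {a : ℝ}
    (hd : ∀ s < a, DifferentiableAt ℝ θ s) (hc : ContinuousOn (deriv θ) (Iio a))
    (h : ∀ s < a, ∀ t < a, ∀ u < 0, |θ (s + u) - θ (t + u)| = |θ s - θ t|) :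
    ∃ κ b, ∀ s < a, θ s = κ * s + b := by
  -- Passing to the limit in difference quotients makes |θ'| shift invariant, hence constant;
  -- continuity of θ' on a half-line then rules out a change of sign.
  have hshift : ∀ s < a, ∀ u < 0, |deriv θ (s + u)| = |deriv θ s| := by
    intro s hs u hu
    have h1 := (hasDerivAt_iff_tendsto_slope.mp (hd s hs).hasDerivAt).abs
    have h2 : HasDerivAt (fun t => θ (t + u)) (deriv θ (s + u)) s :=
      HasDerivAt.comp_add_const s u (hd (s + u) (by linarith)).hasDerivAt
    have h3 := (hasDerivAt_iff_tendsto_slope.mp h2).abs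
    refine tendsto_nhds_unique (h3.congr' ?_) h1
    filter_upwards [mem_nhdsWithin_of_mem_nhds (Iio_mem_nhds hs)] with t ht
    rw [slope_def_field, slope_def_field, abs_div, abs_div, h t ht s hs u hu]
  have hconst : ∀ s < a, ∀ t < a, |deriv θ s| = |deriv θ t| := by
    have key : ∀ s < a, ∀ t < s, |deriv θ t| = |deriv θ s| := fun s hs t ht => by
      have := hshift s hs (t - s) (by linarith)
      rwa [add_sub_cancel] at this
    intro s hs t ht
    rcases lt_trichotomy s t with hst | rfl | hst
    · exact key t ht s hst
    · rfl
    · exact (key s hs t hst).symm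
  set κ := deriv θ (a - 1) with hκ
  have habs : ∀ s < a, |deriv θ s| = |κ| := fun s hs => hconst s hs (a - 1) (by linarith)
  have hder : ∃ c : ℝ, EqOn (deriv θ) (fun _ => c) (Iio a) := by
    rcases eq_or_ne κ 0 with h0 | h0
    · refine ⟨0, fun s hs => ?_⟩
      have := habs s hs
      rw [h0, abs_zero, abs_eq_zero] at this
      exact this
    · rcases isPreconnected_Iio.eq_or_eq_neg_of_sq_eq hc (g := fun _ => κ) continuousOn_const
        (fun s hs => sq_eq_sq_iff_abs_eq_abs _ _ |>.mpr (habs s hs)) (fun _ => h0) with h1 | h1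
      · exact ⟨κ, h1⟩
      · exact ⟨-κ, h1⟩
  obtain ⟨c, hder⟩ := hder
  have hlin : ∀ s, HasDerivAt (fun s => c * s) c s := fun s => by
    simpa using (hasDerivAt_id s).const_mul c
  obtain ⟨b, hb⟩ := isOpen_Iio.exists_eq_add_of_deriv_eq isPreconnected_Iio
    (fun s hs => (hd s hs).differentiableWithinAt)
    (fun s _ => (hlin s).differentiableAt.differentiableWithinAt)
    (fun s hs => by rw [(hlin s).deriv]; exact hder hs)
  exact ⟨c, b, fun s hs => hb hs⟩

/-- A `C¹` function `G` such that `G x / G y + G y / G x` is homogeneous of degree `0` is a power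
function. -/
theorem exists_eq_rpow_of_add_inv_homogeneous {G : ℝ → ℝ} {r : ℝ} (hr : 0 < r)
    (hG : ContDiffOn ℝ 1 G (Ioo 0 r)) (hne : ∀ x ∈ Ioo 0 r, G x ≠ 0)
    (h : ∀ x ∈ Ioo 0 r, ∀ y ∈ Ioo 0 r, ∀ c ∈ Ioo (0 : ℝ) 1,
      G (c * x) / G (c * y) + G (c * y) / G (c * x) = G x / G y + G y / G x) :
    ∃ C κ : ℝ, C ≠ 0 ∧ ∀ x ∈ Ioo 0 r, G x = C * x ^ κ := by
  -- In logarithmic coordinates scaling becomes translation. `Real.log` sees only |G|, and as G x /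
  -- G y has the same sign as its inverse, the hypothesis says that cosh of the increments of θ is
  -- shift invariant; cosh determines its argument up to sign.
  set θ : ℝ → ℝ := fun s => Real.log (G (Real.exp s)) with hθ
  have hmem : ∀ s < Real.log r, Real.exp s ∈ Ioo 0 r := fun s hs =>
    ⟨Real.exp_pos s, (Real.lt_log_iff_exp_lt hr).mp hs⟩
  have hsm : ContDiffOn ℝ 1 θ (Iio (Real.log r)) :=
    (hG.comp Real.contDiff_exp.contDiffOn hmem).log fun s hs => hne _ (hmem s hs)
  have hcosh : ∀ x ∈ Ioo 0 r, ∀ y ∈ Ioo 0 r,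
      2 * Real.cosh (Real.log (G x) - Real.log (G y)) = |G x / G y + G y / G x| := by
    intro x hx y hy
    have h1 : Real.log (G x) - Real.log (G y) = Real.log (|G x / G y|) := by
      rw [Real.log_abs, Real.log_div (hne x hx) (hne y hy)]
    have hp : 0 < |G x / G y| := abs_pos.mpr (div_ne_zero (hne x hx) (hne y hy))
    rw [h1, Real.cosh_eq, Real.exp_neg, Real.exp_log hp, ← abs_inv, inv_div]
    have h2 : 0 ≤ G x / G y * (G y / G x) := by
      rw [div_mul_div_comm, mul_comm (G y), div_self (mul_ne_zero (hne x hx) (hne y hy))]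
      exact zero_le_one
    rw [abs_add_eq_add_abs_iff _ _ |>.mpr (mul_nonneg_iff.mp h2)]
    ring
  obtain ⟨κ, b, hκ⟩ := exists_affine_of_abs_sub_shift (θ := θ) (a := Real.log r)
    (fun s hs => (hsm.differentiableOn one_ne_zero).differentiableAt (Iio_mem_nhds hs))
    (hsm.continuousOn_deriv_of_isOpen isOpen_Iio le_rfl) (by
      intro s hs t ht u hu
      have hc : Real.exp u ∈ Ioo (0 : ℝ) 1 := ⟨Real.exp_pos u, by simpa using hu⟩
      have h1 := h _ (hmem s hs) _ (hmem t ht) _ hc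
      rw [← Real.exp_add, ← Real.exp_add, add_comm u, add_comm u] at h1
      have h2 := hcosh _ (hmem (s + u) (by linarith)) _ (hmem (t + u) (by linarith))
      rw [h1, ← hcosh _ (hmem s hs) _ (hmem t ht)] at h2
      have h3 := mul_left_cancel₀ two_ne_zero h2
      exact le_antisymm (Real.cosh_le_cosh.mp h3.le) (Real.cosh_le_cosh.mp h3.ge))
  have hpos : ∀ x ∈ Ioo 0 r, 0 < Real.exp b * x ^ κ := fun x hx =>
    mul_pos (Real.exp_pos b) (Real.rpow_pos_of_pos hx.1 κ)
  have habs : ∀ x ∈ Ioo 0 r, |G x| = Real.exp b * x ^ κ := by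
    intro x hx
    have h1 := hκ (Real.log x) (Real.log_lt_log hx.1 hx.2)
    simp only [hθ, Real.exp_log hx.1] at h1
    rw [← Real.exp_log_eq_abs (hne x hx), h1, Real.exp_add, Real.rpow_def_of_pos hx.1]
    ring_nf
  have hcont : ContinuousOn (fun x : ℝ => Real.exp b * x ^ κ) (Ioo 0 r) := fun x hx =>
    (continuousAt_const.mul (Real.continuousAt_rpow_const x κ (Or.inl hx.1.ne'))).continuousWithinAt
  rcases isPreconnected_Ioo.eq_or_eq_neg_of_sq_eq hG.continuousOn hcont
    (fun x hx => by
      rw [Pi.pow_apply, Pi.pow_apply, ← sq_abs, habs x hx]) (fun hx => (hpos _ hx).ne') with h1 | h1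
  · exact ⟨Real.exp b, κ, (Real.exp_pos b).ne', fun x hx => h1 hx⟩
  · exact ⟨-Real.exp b, κ, neg_ne_zero.mpr (Real.exp_pos b).ne', fun x hx => by
      rw [h1 hx, Pi.neg_apply, neg_mul]⟩

theorem pw_mul_sub_pw_mul (p : ℝ) {c x y : ℝ} (hc : 0 < c) (hx : 0 < x) (hy : 0 < y) :
    pw p (c * x) - pw p (c * y) = c ^ p * (pw p x - pw p y) := by
  rcases eq_or_ne p 0 with rfl | hp
  · rw [pw_zero, Real.log_mul hc.ne' hx.ne', Real.log_mul hc.ne' hy.ne', Real.rpow_zero]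
    ring
  · rw [pw_of_ne hp]
    beta_reduce
    rw [Real.mul_rpow hc.le hx.le, Real.mul_rpow hc.le hy.le]
    ring

theorem genNum_pw_mul (p : ℝ) {c x y : ℝ} (hc : 0 < c) (hx : 0 < x) (hy : 0 < y) :
    genNum (pw p) (pw (1 - p)) (c * x) (c * y) = c * genNum (pw p) (pw (1 - p)) x y := by
  rw [genNum, genNum, pw_mul_sub_pw_mul p hc hx hy, pw_mul_sub_pw_mul (1 - p) hc hx hy,
    mul_mul_mul_comm, ← Real.rpow_add hc]
  simp

variable {g h : ℝ → ℝ}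

/-- The mixed derivative of the homogeneity relation of `genNum`. -/
theorem deriv_mul_deriv_homogeneous (hg : ∀ x, 0 < x → DifferentiableAt ℝ g x)
    (hh : ∀ x, 0 < x → DifferentiableAt ℝ h x) {r c : ℝ} (hc : 0 < c)
    (hom : ∀ x ∈ Ioo 0 r, ∀ y ∈ Ioo 0 r, genNum g h (c * x) (c * y) = c * genNum g h x y)
    {x y : ℝ} (hx : x ∈ Ioo 0 r) (hy : y ∈ Ioo 0 r) :
    c * (deriv g (c * x) * deriv h (c * y) + deriv g (c * y) * deriv h (c * x)) =
      deriv g x * deriv h y + deriv g y * deriv h x := by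
  have hsc : ∀ {f : ℝ → ℝ}, (∀ x, 0 < x → DifferentiableAt ℝ f x) → ∀ x, 0 < x →
      HasDerivAt (fun x => f (c * x)) (c * deriv f (c * x)) x := by
    intro f hf x hx
    have h1 := (hf (c * x) (mul_pos hc hx)).hasDerivAt.comp x ((hasDerivAt_id x).const_mul c)
    rw [mul_one, mul_comm] at h1
    exact h1
  have hfirst : ∀ y ∈ Ioo 0 r,
      deriv g (c * x) * (h (c * x) - h (c * y)) + (g (c * x) - g (c * y)) * deriv h (c * x) =
        deriv g x * (h x - h y) + (g x - g y) * deriv h x := by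
    intro y hy
    have h1 := ((hsc hg x hx.1).sub_const (g (c * y))).mul ((hsc hh x hx.1).sub_const (h (c * y)))
    have h2 := ((((hg x hx.1).hasDerivAt).sub_const (g y)).mul
      (((hh x hx.1).hasDerivAt).sub_const (h y))).const_mul c
    have h3 := h1.unique (h2.congr_of_eventuallyEq (by
      filter_upwards [Ioo_mem_nhds hx.1 hx.2] with z hz
      exact hom z hz y hy))
    refine mul_left_cancel₀ hc.ne' ?_
    linear_combination h3
  have h1 := (((hsc hh y hy.1).const_sub (h (c * x))).const_mul (deriv g (c * x))).add
    (((hsc hg y hy.1).const_sub (g (c * x))).mul_const (deriv h (c * x)))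
  have h2 := ((((hh y hy.1).hasDerivAt).const_sub (h x)).const_mul (deriv g x)).add
    ((((hg y hy.1).hasDerivAt).const_sub (g x)).mul_const (deriv h x))
  have h3 := h1.unique (h2.congr_of_eventuallyEq (by
    filter_upwards [Ioo_mem_nhds hy.1 hy.2] with z hz
    exact hfirst z hz))
  linear_combination -h3

/-- Local solution of the functional equation for the generating pair. -/
theorem exists_pw_of_homogeneous (hg : ContDiffOn ℝ ∞ g (Ioi 0)) (hh : ContDiffOn ℝ ∞ h (Ioi 0))
    {r : ℝ} (hr : 0 < r) (hgh : ∀ x ∈ Ioo 0 r, deriv g x * deriv h x = 1 / x)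
    (hom : ∀ x ∈ Ioo 0 r, ∀ y ∈ Ioo 0 r, ∀ c ∈ Ioo (0 : ℝ) 1,
      genNum g h (c * x) (c * y) = c * genNum g h x y) :
    ∃ p C k l : ℝ, C ≠ 0 ∧
      ∀ x ∈ Ioo 0 r, g x = C * pw p x + k ∧ h x = C⁻¹ * pw (1 - p) x + l := by
  have hgd : ∀ x, 0 < x → DifferentiableAt ℝ g x := fun x hx =>
    (hg.differentiableOn (by simp)).differentiableAt (Ioi_mem_nhds hx)
  have hhd : ∀ x, 0 < x → DifferentiableAt ℝ h x := fun x hx =>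
    (hh.differentiableOn (by simp)).differentiableAt (Ioi_mem_nhds hx)
  have hg0 : ∀ x ∈ Ioo 0 r, deriv g x ≠ 0 := fun x hx h0 => by
    have := hgh x hx
    rw [h0, zero_mul] at this
    exact (one_div_pos.mpr hx.1).ne this
  have hcx : ∀ {c x : ℝ}, c ∈ Ioo (0 : ℝ) 1 → x ∈ Ioo 0 r → c * x ∈ Ioo 0 r := fun hc hx =>
    ⟨mul_pos hc.1 hx.1, (mul_lt_of_lt_one_left hx.1 hc.2).trans hx.2⟩
  have hh' : ∀ x ∈ Ioo 0 r, deriv h x = 1 / (x * deriv g x) := fun x hx => by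
    have := hgh x hx
    have h0 := hg0 x hx
    have hx0 := hx.1.ne'
    field_simp at this ⊢
    linear_combination this
  -- Substituting h' = 1/(x g') in the mixed derivative of the homogeneity relation and multiplying
  -- by √(xy) leaves exactly G(x)/G(y) + G(y)/G(x) for G = √x · g'. The exponent of the pair is
  -- therefore p = κ + 1/2.
  obtain ⟨C, κ, hC, hpow⟩ := exists_eq_rpow_of_add_inv_homogeneous
    (G := fun x => √x * deriv g x) hr
    ((contDiffOn_id.sqrt fun x hx => hx.1.ne').mul
      ((hg.deriv_of_isOpen (m := 1) isOpen_Ioi (WithTop.coe_le_coe.mpr le_top)).mono fun x hx => hx.1))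
    (fun x hx => mul_ne_zero (Real.sqrt_pos.mpr hx.1).ne' (hg0 x hx)) (by
      intro x hx y hy c hc
      have h1 := deriv_mul_deriv_homogeneous hgd hhd hc.1
        (fun x hx y hy => hom x hx y hy c hc) hx hy
      rw [hh' x hx, hh' y hy, hh' _ (hcx hc hx), hh' _ (hcx hc hy)] at h1
      have e : ∀ u ∈ Ioo 0 r, ∀ v ∈ Ioo 0 r,
          √u * deriv g u / (√v * deriv g v) + √v * deriv g v / (√u * deriv g u) =
            √u * √v * (deriv g u * (1 / (v * deriv g v)) + deriv g v * (1 / (u * deriv g u))) := by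
        intro u hu v hv
        have hu0 := hg0 u hu
        have hv0 := hg0 v hv
        have hu1 := (Real.sqrt_pos.mpr hu.1).ne'
        have hv1 := (Real.sqrt_pos.mpr hv.1).ne'
        have hu2 := Real.mul_self_sqrt hu.1.le
        have hv2 := Real.mul_self_sqrt hv.1.le
        have hu3 : 1 / (u * deriv g u) = 1 / (√u * √u * deriv g u) := by rw [hu2]
        have hv3 : 1 / (v * deriv g v) = 1 / (√v * √v * deriv g v) := by rw [hv2]
        rw [hu3, hv3]
        field_simp
      rw [e _ (hcx hc hx) _ (hcx hc hy), e x hx y hy, ← h1, Real.sqrt_mul hc.1.le,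
        Real.sqrt_mul hc.1.le]
      have hc2 := Real.mul_self_sqrt hc.1.le
      linear_combination (√x * √y * (deriv g (c * x) * (1 / (c * y * deriv g (c * y))) +
        deriv g (c * y) * (1 / (c * x * deriv g (c * x))))) * hc2)
  have hgp : ∀ x ∈ Ioo 0 r, deriv g x = C * x ^ (κ + 1 / 2 - 1) := fun x hx => by
    have h1 := hpow x hx
    have h2 : √x * x ^ (κ + 1 / 2 - 1) = x ^ κ := by
      rw [Real.sqrt_eq_rpow, ← Real.rpow_add hx.1]
      ring_nf
    rw [← h2] at h1
    refine mul_left_cancel₀ (Real.sqrt_pos.mpr hx.1).ne' ?_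
    linear_combination h1
  have hhp : ∀ x ∈ Ioo 0 r, deriv h x = C⁻¹ * x ^ (1 - (κ + 1 / 2) - 1) := fun x hx => by
    have h2 : x * x ^ (κ + 1 / 2 - 1) * x ^ (1 - (κ + 1 / 2) - 1) = 1 := by
      nth_rewrite 1 [← Real.rpow_one x]
      rw [← Real.rpow_add hx.1, ← Real.rpow_add hx.1]
      ring_nf
      exact Real.rpow_zero x
    rw [hh' x hx, hgp x hx, div_eq_iff (mul_ne_zero hx.1.ne' (mul_ne_zero hC
      (Real.rpow_pos_of_pos hx.1 _).ne'))]
    linear_combination -h2 - (x * x ^ (κ + 1 / 2 - 1) * x ^ (1 - (κ + 1 / 2) - 1)) *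
      inv_mul_cancel₀ hC
  have hint : ∀ {f : ℝ → ℝ} {D q : ℝ}, (∀ x, 0 < x → DifferentiableAt ℝ f x) →
      (∀ x ∈ Ioo 0 r, deriv f x = D * x ^ (q - 1)) →
      ∃ k, EqOn f (fun x => D * pw q x + k) (Ioo 0 r) := by
    intro f D q hf hf'
    have hd : ∀ x ∈ Ioo 0 r, HasDerivAt (fun x => D * pw q x) (D * x ^ (q - 1)) x := fun x hx =>
      (hasDerivAt_pw q hx.1).const_mul D
    exact isOpen_Ioo.exists_eq_add_of_deriv_eq isPreconnected_Ioo
      (fun x hx => (hf x hx.1).differentiableWithinAt)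
      (fun x hx => (hd x hx).differentiableAt.differentiableWithinAt)
      (fun x hx => by rw [hf' x hx, (hd x hx).deriv])
  obtain ⟨k, hk⟩ := hint hgd hgp
  obtain ⟨l, hl⟩ := hint hhd hhp
  exact ⟨κ + 1 / 2, C, k, l, hC, fun x hx => ⟨hk hx, hl hx⟩⟩

/-- A perturbation of the pair at one point that preserves `genNum` is trivial. -/
theorem eq_zero_of_genNum_perturb {p C δ ε u r : ℝ} (hC : C ≠ 0) (hr : 0 < r)
    (h : ∀ y ∈ Ioo 0 r, (C * (pw p u - pw p y) + δ) * (C⁻¹ * (pw (1 - p) u - pw (1 - p) y) + ε) =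
      genNum (pw p) (pw (1 - p)) u y) : δ = 0 ∧ ε = 0 := by
  have hlin : ∀ y ∈ Ioo 0 r, ε * C * (pw p u - pw p y) +
      δ * C⁻¹ * (pw (1 - p) u - pw (1 - p) y) + δ * ε = 0 := by
    intro y hy
    have h1 := h y hy
    rw [genNum] at h1
    linear_combination h1 - (pw p u - pw p y) * (pw (1 - p) u - pw (1 - p) y) * mul_inv_cancel₀ hC
  have hder : ∀ y ∈ Ioo 0 r, ε * C * y ^ (2 * p - 1) + δ * C⁻¹ = 0 := by
    intro y hy
    have h1 := ((((hasDerivAt_pw p hy.1).const_sub (pw p u)).const_mul (ε * C)).add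
      (((hasDerivAt_pw (1 - p) hy.1).const_sub (pw (1 - p) u)).const_mul (δ * C⁻¹))).add_const (δ * ε)
    have h2 := h1.unique ((hasDerivAt_const y (0 : ℝ)).congr_of_eventuallyEq (by
      filter_upwards [Ioo_mem_nhds hy.1 hy.2] with z hz
      exact hlin z hz))
    have e1 : y ^ (2 * p - 1) = y ^ p * y ^ (p - 1) := by
      rw [← Real.rpow_add hy.1]
      ring_nf
    have e2 : y ^ p * y ^ (1 - p - 1) = 1 := by
      rw [← Real.rpow_add hy.1]
      ring_nf
      exact Real.rpow_zero y
    rw [e1]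
    linear_combination -(y ^ p) * h2 - δ * C⁻¹ * e2
  have hr2 : r / 2 ∈ Ioo 0 r := ⟨by linarith, by linarith⟩
  have hr3 : r / 3 ∈ Ioo 0 r := ⟨by linarith, by linarith⟩
  -- At p = 1/2 the power y^(2p-1) is constant, so comparing two values of y gives nothing. The
  -- undifferentiated relation then supplies δε = 0.
  rcases eq_or_ne p (1 / 2) with rfl | hp
  · have h1 := hder _ hr2
    norm_num at h1
    have h2 := hlin _ hr2
    have h3 : δ * ε = 0 := by
      norm_num at h2
      linear_combination h2 - (pw (1 / 2) u - pw (1 / 2) (r / 2)) * h1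
    rcases mul_eq_zero.mp h3 with h0 | h0
    · rw [h0] at h1 ⊢
      simpa [hC] using h1
    · rw [h0] at h1 ⊢
      simpa [hC] using h1
  · have hε : ε = 0 := by
      by_contra hε
      have h1 := hder _ hr2
      have h2 := hder _ hr3
      have h3 : (r / 2) ^ (2 * p - 1) = (r / 3) ^ (2 * p - 1) := by
        refine mul_left_cancel₀ (mul_ne_zero hε hC) ?_
        linear_combination h1 - h2
      rw [Real.rpow_left_inj hr2.1.le hr3.1.le (by
        intro h0
        exact hp (by linarith))] at h3
      linarith
    have h1 := hder _ hr2
    rw [hε] at h1 ⊢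
    simpa [hC] using h1

/-- Global solution on `(0, 1)` of the functional equation for the generating pair. -/
theorem exists_pw_of_homogeneous_Ioo (hg : ContDiffOn ℝ ∞ g (Ioi 0))
    (hh : ContDiffOn ℝ ∞ h (Ioi 0)) (hgh : ∀ x ∈ Ioo (0 : ℝ) (1 / 2), deriv g x * deriv h x = 1 / x)
    (hom : ∀ x y c : ℝ, 0 < x → 0 < y → x + y < 1 → c ∈ Ioo (0 : ℝ) 1 →
      genNum g h (c * x) (c * y) = c * genNum g h x y) :
    ∃ p C k l : ℝ, C ≠ 0 ∧
      ∀ x ∈ Ioo (0 : ℝ) 1, g x = C * pw p x + k ∧ h x = C⁻¹ * pw (1 - p) x + l := by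
  obtain ⟨p, C, k, l, hC, hloc⟩ := exists_pw_of_homogeneous hg hh one_half_pos hgh
    (fun x hx y hy c hc => hom x y c hx.1 hy.1 (by linarith [hx.2, hy.2]) hc)
  refine ⟨p, C, k, l, hC, fun x hx => ?_⟩
  have hx1 := hx.1
  have hx2 := hx.2
  -- For such small y the pair (x, y) is admissible in the homogeneity relation. Scaling by 1/2
  -- brings x and y below 1/2, where the local formula is known, so g and h can deviate at x only by
  -- a perturbation that preserves the numerator.
  have hr : 0 < min (1 / 2) (min x (1 - x)) := by
    simp only [lt_min_iff]
    exact ⟨by norm_num, hx1, by linarith⟩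
  have := eq_zero_of_genNum_perturb (p := p) (δ := g x - (C * pw p x + k))
    (ε := h x - (C⁻¹ * pw (1 - p) x + l)) hC hr (by
      intro y hy
      obtain ⟨hy0, hy⟩ := hy
      simp only [lt_min_iff] at hy
      obtain ⟨hy2, hyx, hyx1⟩ := hy
      have h1 := hom x y (1 / 2) hx1 hy0 (by linarith) ⟨by norm_num, by norm_num⟩
      obtain ⟨e1, e2⟩ := hloc (1 / 2 * x) ⟨by linarith, by linarith⟩
      obtain ⟨e3, e4⟩ := hloc (1 / 2 * y) ⟨by linarith, by linarith⟩
      obtain ⟨e5, e6⟩ := hloc y ⟨hy0, hy2⟩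
      have h2 := genNum_pw_mul p (c := 1 / 2) one_half_pos hx1 hy0
      rw [genNum, genNum, e1, e2, e3, e4, e5, e6] at h1
      rw [genNum] at h2
      linear_combination -2 * h1 + 2 * h2 + 2 * (pw p (1 / 2 * x) - pw p (1 / 2 * y)) *
        (pw (1 - p) (1 / 2 * x) - pw (1 - p) (1 / 2 * y)) * mul_inv_cancel₀ hC)
  exact ⟨sub_eq_zero.mp this.1, sub_eq_zero.mp this.2⟩

end FunctionalEquation

end WYD
end

/-! ### The admissible exponents and the characterization -/

noncomputable section
namespace WYD

section Characterization

open Filter Topology Set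

theorem genNum_pw_one_sub (p x y : ℝ) :
    genNum (pw (1 - p)) (pw p) x y = genNum (pw p) (pw (1 - p)) x y :=
  mul_comm _ _

/-- With y = 1 − x and x → 0, the left side contains x · x^(1-p) = x^(2-p) with a coefficient
bounded away from 0, while (x − y)² ≤ 1. For p > 2 this blows up. -/
theorem le_two_of_genNum_pw_le {p : ℝ} (h : ∀ x y : ℝ, 0 < x → 0 < y → x + y = 1 → x ≠ y →
    2 * (x * y) * genNum (pw p) (pw (1 - p)) x y ≤ (x - y) ^ 2) : p ≤ 2 := by
  by_contra! hp
  have hbound : ∀ x ∈ Ioo (0 : ℝ) (1 / 2),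
      x ^ (-(p - 2)) ≤ (p * (p - 1) + 1) / (2 * (1 / 2) ^ (p + 1)) := by
    intro x hx
    have hx0 := hx.1
    have hx2 := hx.2
    obtain ⟨y, hxy⟩ : ∃ y, x + y = 1 := ⟨1 - x, by ring⟩
    have hy : 0 < y := by linarith
    have h1 := h x y hx0 hy hxy (by linarith)
    rw [genNum, pw_of_ne (show p ≠ 0 by linarith), pw_of_ne (show 1 - p ≠ 0 by linarith)] at h1
    have e1 : x * x ^ (1 - p) = x ^ (-(p - 2)) := by
      nth_rewrite 1 [← Real.rpow_one x]
      rw [← Real.rpow_add hx0]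
      ring_nf
    have e2 : y * y ^ p = y ^ (p + 1) := by
      rw [Real.rpow_add hy, Real.rpow_one, mul_comm]
    have e3 : ∀ {u : ℝ}, 0 < u → u ^ p * u ^ (1 - p) = u := fun hu => by
      rw [← Real.rpow_add hu]
      simp
    have hpp : 0 < p * (p - 1) := mul_pos (by linarith) (by linarith)
    have h2 : 2 * (x * y) * ((y ^ p - x ^ p) * (x ^ (1 - p) - y ^ (1 - p))) ≤
        p * (p - 1) * (x - y) ^ 2 := by
      refine le_trans (le_of_eq ?_) (mul_le_mul_of_nonneg_left h1 hpp.le)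
      have : p ≠ 0 := by linarith
      have : 1 - p ≠ 0 := by linarith
      field_simp
      ring
    have h3 : (x - y) ^ 2 ≤ 1 := by nlinarith
    have h4 : 2 * (x * y) ≤ 1 := by nlinarith
    have h5 : 0 ≤ x * y * (x ^ p * y ^ (1 - p)) := by positivity
    have h6 : 2 * (x ^ (-(p - 2)) * y ^ (p + 1)) ≤ p * (p - 1) + 1 := by
      have h7 := mul_le_mul_of_nonneg_left h3 hpp.le
      rw [← e1, ← e2]
      have e4 : 2 * (x * y) * ((y ^ p - x ^ p) * (x ^ (1 - p) - y ^ (1 - p))) =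
          2 * (x * x ^ (1 - p) * (y * y ^ p)) - 2 * (x * y) +
            2 * (x * y * (x ^ p * y ^ (1 - p))) := by
        linear_combination -2 * (x * y) * (e3 hx0 + e3 hy) - 2 * (x * y) * hxy
      linarith
    have h8 : (1 / 2 : ℝ) ^ (p + 1) ≤ y ^ (p + 1) :=
      Real.rpow_le_rpow (by norm_num) (by linarith) (by linarith)
    rw [le_div_iff₀ (by positivity)]
    refine le_trans ?_ h6
    have := mul_le_mul_of_nonneg_left h8 (Real.rpow_nonneg hx0.le (-(p - 2)))
    linarith
  have htend := tendsto_rpow_neg_nhdsGT_zero (y := -(p - 2)) (by linarith)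
  obtain ⟨x, hx, hx'⟩ := ((htend.eventually_gt_atTop
    ((p * (p - 1) + 1) / (2 * (1 / 2) ^ (p + 1)))).and
      (Ioo_mem_nhdsGT (one_half_pos (α := ℝ)))).exists
  exact (hbound x hx').not_gt hx

/-- Normalizing the powers by `pw` absorbs the factor 1/(p(1−p)) and the logarithmic cases, so the
condition on ab becomes that the two coefficients are inverse to each other. -/
theorem isPowerPair_iff {p : ℝ} {g gs : ℝ → ℝ} : IsPowerPair p g gs ↔ ∃ C k l : ℝ, C ≠ 0 ∧
    ∀ x ∈ Ioo (0 : ℝ) 1, g x = C * pw p x + k ∧ gs x = C⁻¹ * pw (1 - p) x + l := by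
  constructor
  · rintro ⟨a, b, k, l, ⟨h0, h1, hab, h⟩ | ⟨rfl, hab, h⟩ | ⟨rfl, hab, h⟩⟩
    · have hq : 1 - p ≠ 0 := sub_ne_zero.mpr h1.symm
      have hC : (a * p) * (b * (1 - p)) = 1 := by
        field_simp at hab
        linear_combination hab
      refine ⟨a * p, k, l, left_ne_zero_of_mul_eq_one hC, fun x hx => ?_⟩
      rw [inv_eq_of_mul_eq_one_right hC, (h x hx).1, (h x hx).2, pw_of_ne h0, pw_of_ne hq]
      constructor <;> field_simp
    · refine ⟨a, k, l, left_ne_zero_of_mul_eq_one hab, fun x hx => ?_⟩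
      rw [inv_eq_of_mul_eq_one_right hab, (h x hx).1, (h x hx).2, sub_zero, pw_zero, pw_one]
      exact ⟨rfl, rfl⟩
    · refine ⟨a, k, l, left_ne_zero_of_mul_eq_one hab, fun x hx => ?_⟩
      rw [inv_eq_of_mul_eq_one_right hab, (h x hx).1, (h x hx).2, sub_self, pw_zero, pw_one]
      exact ⟨rfl, rfl⟩
  · rintro ⟨C, k, l, hC, h⟩
    rcases eq_or_ne p 0 with rfl | h0
    · refine ⟨C, C⁻¹, k, l, Or.inr (Or.inl ⟨rfl, mul_inv_cancel₀ hC, fun x hx => ?_⟩)⟩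
      rw [(h x hx).1, (h x hx).2, sub_zero, pw_zero, pw_one]
      exact ⟨rfl, rfl⟩
    · rcases eq_or_ne p 1 with rfl | h1
      · refine ⟨C, C⁻¹, k, l, Or.inr (Or.inr ⟨rfl, mul_inv_cancel₀ hC, fun x hx => ?_⟩)⟩
        rw [(h x hx).1, (h x hx).2, sub_self, pw_zero, pw_one]
        exact ⟨rfl, rfl⟩
      · have hq : 1 - p ≠ 0 := sub_ne_zero.mpr h1.symm
        refine ⟨C / p, C⁻¹ / (1 - p), k, l, Or.inl ⟨h0, h1, by field_simp, fun x hx => ?_⟩⟩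
        rw [(h x hx).1, (h x hx).2, pw_of_ne h0, pw_of_ne hq]
        constructor <;> ring

theorem commTangent_smul_add_smul_one {n : ℕ} (c k : ℝ) (M X : Mat n) :
    commTangent (c • M + k • 1) X = c • commTangent M X := by
  rw [commTangent, commTangent, add_mul, mul_add, smul_mul_assoc, smul_mul_assoc, mul_smul_comm,
    mul_smul_comm, one_mul, mul_one, add_sub_add_right_eq_sub, ← smul_sub, smul_comm]

/-- On a state, two functions related affinely on `(0, 1)` have proportional commutators. -/
theorem commTangent_cfc_eq_smul {n : ℕ} {ρ : Mat n} (hρ : ρ ∈ States n) {g f : ℝ → ℝ} {c k : ℝ}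
    (h : ∀ x ∈ Ioo (0 : ℝ) 1, g x = c * f x + k) (X : Mat n) :
    commTangent (cfc g ρ) X = c • commTangent (cfc f ρ) X := by
  obtain ⟨U, l, h1, h2, hl, hs, rfl⟩ := exists_unitary_of_mem_states hρ
  -- The relation is given only on (0, 1). An eigenvalue ≥ 1 of a state leaves room for no other, so
  -- one constant fits trivially, and constants drop out of commutators.
  obtain ⟨k', hk'⟩ : ∃ k', ∀ i, g (l i) = c * f (l i) + k' := by
    by_cases h0 : ∀ i, l i < 1
    · exact ⟨k, fun i => h _ ⟨hl i, h0 i⟩⟩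
    · push Not at h0
      obtain ⟨i, hi⟩ := h0
      refine ⟨g (l i) - c * f (l i), fun j => ?_⟩
      obtain rfl : j = i := by
        by_contra hji
        have := Finset.add_le_sum (f := l) (fun i _ => (hl i).le) (Finset.mem_univ j)
          (Finset.mem_univ i) hji
        linarith [hl j]
      ring
  have hd : rdiag (fun i => g (l i)) = c • rdiag (fun i => f (l i)) + k' • (1 : Mat n) := by
    ext i j
    rcases eq_or_ne i j with rfl | hij
    · simp [hk']
    · simp [hij]
  rw [cfc_unitary_rdiag h1 h2, cfc_unitary_rdiag h1 h2, hd, ← commTangent_smul_add_smul_one c k']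
  congr 1
  rw [mul_add, add_mul, mul_smul_comm, smul_mul_assoc, mul_smul_comm, smul_mul_assoc, mul_one, h2]

/-- On commutators both sides are the trace of the product of the commutators with `pw p` and `pw (1
- p)` of the state: additive constants vanish and C cancels C⁻¹. Symmetry of the metric reconciles
the order of the two factors with that in the entropy. -/
theorem isGeneratedBy_alphaMetric {p : ℝ} (hp : p ∈ Icc (-1 : ℝ) 2) {g gs : ℝ → ℝ}
    (hg : ∀ x, 0 < x → DifferentiableAt ℝ g x) (hgs : ∀ x, 0 < x → DifferentiableAt ℝ gs x)
    (h : IsPowerPair p g gs) : IsGeneratedBy (alphaMetric (2 * p - 1)) g gs := by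
  obtain ⟨C, k, l, hC, h⟩ := isPowerPair_iff.mp h
  intro n ρ hρ X Y hX hY
  rw [mixedDeriv_generated hρ hX hY hg hgs, commTangent_cfc_eq_smul hρ (fun x hx => (h x hx).1),
    commTangent_cfc_eq_smul hρ (fun x hx => (h x hx).2), smul_mul_smul_comm, mul_inv_cancel₀ hC,
    one_smul, (isSymmetricMonotoneMetric_alphaMetric hp).symm n ρ hρ _
      (commTangent_mem_tangent hρ.1.1 hX) _ (commTangent_mem_tangent hρ.1.1 hY)]
  obtain ⟨U, m, h1, h2, hm, -, rfl⟩ := exists_unitary_of_mem_states hρ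
  rw [alphaMetric_eq_trace p h1 h2 hm (commTangent_isHermitian hρ.1.1 hY)
    (commTangent_isHermitian hρ.1.1 hX), cfcDeriv_commTangent h1 h2, cfcDeriv_commTangent h1 h2,
    Matrix.trace_mul_comm]

variable {K : MetricFamily} {g gs : ℝ → ℝ}

theorem IsGeneratedBy.of_sameMetric {L : MetricFamily} (hL : IsGeneratedBy L g gs)
    (h : SameMetric K L) : IsGeneratedBy K g gs := fun n ρ hρ X Y hX hY =>
  (h n ρ hρ _ (commTangent_mem_tangent hρ.1.1 hX) _ (commTangent_mem_tangent hρ.1.1 hY)).trans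
    (hL n ρ hρ X Y hX hY)

/-- A generated metric is an `α`-metric, and the generating functions are powers. -/
theorem exists_alphaMetric_of_isGeneratedBy (hK : IsSymmetricMonotoneMetric K)
    (hg : ContDiffOn ℝ ∞ g (Ioi 0)) (hgs : ContDiffOn ℝ ∞ gs (Ioi 0))
    (hgen : IsGeneratedBy K g gs) :
    ∃ p ∈ Icc (-1 : ℝ) 2, SameMetric K (alphaMetric (2 * p - 1)) ∧ IsPowerPair p g gs := by
  have hgd : ∀ x, 0 < x → DifferentiableAt ℝ g x := fun x hx =>
    (hg.differentiableOn (by simp)).differentiableAt (Ioi_mem_nhds hx)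
  have hgsd : ∀ x, 0 < x → DifferentiableAt ℝ gs x := fun x hx =>
    (hgs.differentiableOn (by simp)).differentiableAt (Ioi_mem_nhds hx)
  obtain ⟨p, C, k, l, hC, h⟩ := exists_pw_of_homogeneous_Ioo hg hgs
    (fun x hx => deriv_mul_deriv_generated hK hgen hgd hgsd hx.1 hx.2)
    (fun x y c hx hy hxy hc => genNum_mul hK hgen hgd hgsd hx hy hxy hc)
  have hle : ∀ x y : ℝ, 0 < x → 0 < y → x + y = 1 → x ≠ y →
      2 * (x * y) * genNum (pw p) (pw (1 - p)) x y ≤ (x - y) ^ 2 := by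
    intro x y hx hy hxy hne
    have h1 := h x ⟨hx, by linarith⟩
    have h2 := h y ⟨hy, by linarith⟩
    refine le_trans (le_of_eq ?_) (genNum_le hK hgen hgd hgsd hx hy hxy hne)
    rw [genNum, genNum, h1.1, h1.2, h2.1, h2.2]
    linear_combination -2 * (x * y) * (pw p x - pw p y) * (pw (1 - p) x - pw (1 - p) y) *
      mul_inv_cancel₀ hC
  have hp2 : p ≤ 2 := le_two_of_genNum_pw_le hle
  have hp1 : 1 - p ≤ 2 := le_two_of_genNum_pw_le (by
    rw [sub_sub_cancel]
    simpa only [genNum_pw_one_sub] using hle)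
  have hp : p ∈ Icc (-1 : ℝ) 2 := ⟨by linarith, hp2⟩
  have hpow : IsPowerPair p g gs := isPowerPair_iff.mpr ⟨C, k, l, hC, h⟩
  refine ⟨p, hp, ?_, hpow⟩
  refine hK.sameMetric_of_commTangent (isSymmetricMonotoneMetric_alphaMetric hp) ?_
  intro n m hm hs _ Z hZ
  rw [hgen.apply_rdiag hgd hgsd hm hs hZ,
    (isGeneratedBy_alphaMetric hp hgd hgsd hpow).apply_rdiag hgd hgsd hm hs hZ]

end Characterization

end WYD
end

theorem theorem3p5 :
    (∀ α ∈ Set.Icc (-3 : ℝ) 3, WYD.IsSymmetricMonotoneMetric (WYD.alphaMetric α)) ∧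
    ∀ K : WYD.MetricFamily, WYD.IsSymmetricMonotoneMetric K →
      ((∃ g gs : ℝ → ℝ, ContDiffOn ℝ ∞ g (Set.Ioi 0) ∧ ContDiffOn ℝ ∞ gs (Set.Ioi 0) ∧
          WYD.IsGeneratedBy K g gs) ↔
        ∃ α ∈ Set.Icc (-3 : ℝ) 3, WYD.SameMetric K (WYD.alphaMetric α)) ∧
      ∀ g gs : ℝ → ℝ, ContDiffOn ℝ ∞ g (Set.Ioi 0) → ContDiffOn ℝ ∞ gs (Set.Ioi 0) →
        (WYD.IsGeneratedBy K g gs ↔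
          ∃ p ∈ Set.Icc (-1 : ℝ) 2,
            WYD.SameMetric K (WYD.alphaMetric (2 * p - 1)) ∧ WYD.IsPowerPair p g gs) := by
  have hα : ∀ α ∈ Set.Icc (-3 : ℝ) 3, ∃ p ∈ Set.Icc (-1 : ℝ) 2, α = 2 * p - 1 := fun α h =>
    ⟨(α + 1) / 2, ⟨by linarith [h.1], by linarith [h.2]⟩, by ring⟩
  have hdiff : ∀ {f : ℝ → ℝ}, ContDiffOn ℝ ∞ f (Set.Ioi 0) → ∀ x, 0 < x → DifferentiableAt ℝ f x :=
    fun hf x hx => (hf.differentiableOn (by simp)).differentiableAt (Ioi_mem_nhds hx)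
  refine ⟨fun α h => ?_, fun K hK => ⟨⟨?_, ?_⟩, fun g gs hg hgs => ⟨?_, ?_⟩⟩⟩
  · obtain ⟨p, hp, rfl⟩ := hα α h
    exact WYD.isSymmetricMonotoneMetric_alphaMetric hp
  · rintro ⟨g, gs, hg, hgs, hgen⟩
    obtain ⟨p, hp, hsame, -⟩ := WYD.exists_alphaMetric_of_isGeneratedBy hK hg hgs hgen
    exact ⟨2 * p - 1, ⟨by linarith [hp.1], by linarith [hp.2]⟩, hsame⟩
  · rintro ⟨α, h, hsame⟩
    obtain ⟨p, hp, rfl⟩ := hα α h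
    refine ⟨WYD.pw p, WYD.pw (1 - p), WYD.contDiffOn_pw p, WYD.contDiffOn_pw (1 - p), ?_⟩
    exact (WYD.isGeneratedBy_alphaMetric hp (hdiff (WYD.contDiffOn_pw p))
      (hdiff (WYD.contDiffOn_pw (1 - p))) (WYD.isPowerPair_iff.mpr
        ⟨1, 0, 0, one_ne_zero, fun x _ => by simp⟩)).of_sameMetric hsame
  · exact WYD.exists_alphaMetric_of_isGeneratedBy hK hg hgs
  · rintro ⟨p, hp, hsame, hpow⟩
    exact (WYD.isGeneratedBy_alphaMetric hp (hdiff hg) (hdiff hgs) hpow).of_sameMetric hsame
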